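/- **Setting.** Let $R\in[0,1)$, $n\ge2$, and let $c\colon[R,1]\to(0,\infty)$ be of class $C^{1,1}$ (differentiable with Lipschitz derivative), with $c'(0)=0$ if $R=0$. Put $g=c(|x|)^{-2}e$, where $e$ is the Euclidean metric, on the closed unit ball of $\mathbb R^n$ if $R=0$ and on the closed annulus $\{R\le|x|\le1\}\subset\mathbb R^n$ if $R>0$. * $c$ satisfies the *Herglotz condition* if $\frac{d}{dr}\left(\frac{r}{c(r)}\right)>0$ for all $r\in[R,1]$. * A *maximal geodesic* is a unit speed $g$-geodesic with both endpoints on the outer boundary $|x|=1$ and all other points in the interior of the manifold; its *radius* is its Euclidean distance to the origin. $c$ satisfies the *countable conjugacy condition* if there are at most countably many $r\in(R,1)$ such that, in dimension $2$, the endpoints of the maximal geodesic of radius $r$ (unique up to rotation) are conjugate along it. * A *broken ray* is a concatenation of finitely many (at least one) unit speed geodesic segments of positive length, whose interiors lie in the interior of the manifold and whose endpoints lie on the boundary, consecutive segments satisfying the reflection law. It is *periodic* if its initial and final points coincide. $\operatorname{lsp}(c)$ is the set of lengths of all periodic broken rays all of whose segments have both endpoints on the outer boundary $|x|=1$ (no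 inner reflections). For $R>0$, $\operatorname{lsp}'(c)$ is the set of lengths of all periodic broken rays, the segments being allowed to have endpoints on the inner boundary $|x|=R$ as well. **Theorem.** Let $N,N'\ge0$ be integers with $N+N'\ge1$. Let $R_1,\dots,R_N\in[0,1)$ and $R'_1,\dots,R'_{N'}\in(0,1)$, and let $n_1,\dots,n_N$ and $n'_1,\dots,n'_{N'}$ be integers, each at least $2$. Fix $\varepsilon>0$ and, for $\tau\in(-\varepsilon,\varepsilon)$, let $c_{i,\tau}\colon[R_i,1]\to(0,\infty)$ ($1\le i\le N$) and $c'_{i,\tau}\colon[R'_i,1]\to(0,\infty)$ ($1\le i\le N'$) be $C^{1,1}$ functions satisfying the Herglotz condition and the countable conjugacy condition and depending $C^1$-smoothly on $\tau$, in the sense that $(\tau,r)\mapsto c_{i,\tau}(r)$ and $(\tau,r)\mapsto c'_{i,\tau}(r)$ are $C^1$ on $(-\varepsilon,\varepsilon)\times[R_i,1]$ and $(-\varepsilon,\varepsilon)\times[R'_i,1]$ respectively. For every $i$ with $R_i=0$ assume $\left.\frac{d}{dr}c_{i,\tau}(r)\right|_{r=0}=0$ for all $\tau$. If the set $$\bigcup_{i=1}^{N}\operatorname{lsp}(c_{i,\tau})\cup\bigcup_{i=1}^{N'}\operatorname{lsp}'(c'_{i,\tau})$$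 is the same for all $\tau\in(-\varepsilon,\varepsilon)$, where $\operatorname{lsp}(c_{i,\tau})$ is taken in dimension $n_i$ and $\operatorname{lsp}'(c'_{i,\tau})$ in dimension $n'_i$, then every $c_{i,\tau}$ and every $c'_{i,\tau}$ is independent of $\tau$. -/

import Mathlib

namespace RadialRigidity

/-- `c` restricted to `[R, 1]` is a positive `C^{1,1}` function: it is differentiable and its
derivative (one-sided at the end points) is Lipschitz. -/
structure IsSoundSpeed (R : ℝ) (c : ℝ → ℝ) : Prop where
  pos : ∀ r ∈ Set.Icc R 1, 0 < c r
  differentiableOn : DifferentiableOn ℝ c (Set.Icc R 1)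
  lipschitz_deriv : ∃ K : NNReal,
    LipschitzOnWith K (derivWithin c (Set.Icc R 1)) (Set.Icc R 1)

/-- The Herglotz condition `d/dr (r / c(r)) > 0` everywhere on `[R, 1]`. -/
def Herglotz (R : ℝ) (c : ℝ → ℝ) : Prop :=
  ∀ r ∈ Set.Icc R 1, 0 < derivWithin (fun s => s / c s) (Set.Icc R 1) r

/-- The interior of the manifold: the open annulus `R < |x| < 1` if `R > 0`,
and the open unit ball (origin included) if `R = 0`. -/
def openShell (n : ℕ) (R : ℝ) : Set (EuclideanSpace ℝ (Fin n)) :=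
  {x | (R < ‖x‖ ∨ R = 0) ∧ ‖x‖ < 1}

/-- The outer boundary `|x| = 1`. -/
def outerBoundary (n : ℕ) : Set (EuclideanSpace ℝ (Fin n)) := Metric.sphere 0 1

/-- The inner boundary `|x| = R`. -/
def innerBoundary (n : ℕ) (R : ℝ) : Set (EuclideanSpace ℝ (Fin n)) := Metric.sphere 0 R

/-- The Euclidean gradient of `x ↦ c(|x|)`, namely `c'(|x|) x / |x|`. It is `0` at the origin,
where `c'(0) = 0` is assumed whenever the origin belongs to the manifold. -/
noncomputable def radialGradient {n : ℕ} (R : ℝ) (c : ℝ → ℝ) (x : EuclideanSpace ℝ (Fin n)) :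
    EuclideanSpace ℝ (Fin n) :=
  (derivWithin c (Set.Icc R 1) ‖x‖ / ‖x‖) • x

/-- `γ : [0, T] → ℝⁿ`, with velocity `v`, is a unit speed geodesic of the metric
`g = c(|x|)⁻² e` which runs in the interior of the manifold except for its two end points, which
lie on the part `B` of the boundary.

The geodesic equation of `g = e^{2φ} e` is `γ'' + 2 ⟨∇φ, γ'⟩ γ' - |γ'|² ∇φ = 0`;
here `φ = -log c(|x|)`, so `∇φ = -∇c / c`. Unit speed with respect to `g` means `|γ'| = c(|γ|)`. -/
structure IsGeodesicSegment {n : ℕ} (R : ℝ) (c : ℝ → ℝ) (B : Set (EuclideanSpace ℝ (Fin n)))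
    (T : ℝ) (γ v : ℝ → EuclideanSpace ℝ (Fin n)) : Prop where
  length_pos : 0 < T
  interior : ∀ t ∈ Set.Ioo 0 T, γ t ∈ openShell n R
  start_mem : γ 0 ∈ B
  end_mem : γ T ∈ B
  hasDeriv : ∀ t ∈ Set.Icc 0 T, HasDerivWithinAt γ (v t) (Set.Icc 0 T) t
  unit_speed : ∀ t ∈ Set.Icc 0 T, ‖v t‖ = c ‖γ t‖
  geodesic : ∀ t ∈ Set.Icc 0 T,
    HasDerivWithinAt v
      ((2 * (inner ℝ (radialGradient R c (γ t)) (v t) / c ‖γ t‖)) • v t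
        - (‖v t‖ ^ 2 / c ‖γ t‖) • radialGradient R c (γ t))
      (Set.Icc 0 T) t

/-- The Gaussian curvature of the two-dimensional metric `g = c(|x|)⁻² e` at Euclidean distance
`r ∈ (R, 1)` from the origin. For `g = e^{2φ} e` it is `-e^{-2φ} Δφ`, that is `c² Δ(log c)`,
and `Δ` of a radial function `u` is `u'' + u' / r`. For `c` of class `C^{1,1}` it is a bounded
function defined at almost every `r`. -/
noncomputable def gaussCurvature (c : ℝ → ℝ) (r : ℝ) : ℝ :=
  c r ^ 2 * (deriv (deriv (fun s => Real.log (c s))) r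
    + deriv (fun s => Real.log (c s)) r / r)

/-- The end points of the unit speed geodesic `γ : [0, T] → ℝ²` are conjugate along `γ`:
there is a nontrivial Jacobi field along `γ` vanishing at both end points. In dimension two such a
field is normal to `γ`, hence given by a scalar `j` with `j'' + K j = 0`, where `K` is the Gaussian
curvature along `γ`. As `K` is only defined almost everywhere, the equation is understood in the
Carathéodory (integrated) sense; `j'` below is the derivative of `j`. -/
def EndpointsConjugate (c : ℝ → ℝ) (T : ℝ) (γ : ℝ → EuclideanSpace ℝ (Fin 2)) : Prop :=
  ∃ j j' : ℝ → ℝ,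
    (∀ t ∈ Set.Icc 0 T, HasDerivWithinAt j (j' t) (Set.Icc 0 T) t) ∧
    IntervalIntegrable (fun s => gaussCurvature c ‖γ s‖ * j s) MeasureTheory.volume 0 T ∧
    (∀ t ∈ Set.Icc 0 T, j' t = j' 0 - ∫ s in (0 : ℝ)..t, gaussCurvature c ‖γ s‖ * j s) ∧
    j 0 = 0 ∧ j T = 0 ∧ ∃ t ∈ Set.Icc 0 T, j t ≠ 0

/-- The countable conjugacy condition: there are at most countably many radii `r ∈ (R, 1)` such
that the end points of the maximal geodesic of radius `r` (its Euclidean distance to the origin;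
the geodesic is unique up to rotation) are conjugate along it. A maximal geodesic has both end
points on the outer boundary. -/
def CountableConjugacy (R : ℝ) (c : ℝ → ℝ) : Prop :=
  {r : ℝ | r ∈ Set.Ioo R 1 ∧
    ∃ (T : ℝ) (γ v : ℝ → EuclideanSpace ℝ (Fin 2)),
      IsGeodesicSegment R c (outerBoundary 2) T γ v ∧
      IsLeast ((fun t => ‖γ t‖) '' Set.Icc 0 T) r ∧
      EndpointsConjugate c T γ}.Countable

/-- A periodic broken ray reflecting at the part `B` of the boundary: `k ≥ 1` unit speed geodesic
segments, the `i`-th one being `γ i : [0, T i] → ℝⁿ` with velocity `v i`, such that consecutive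
segments meet and satisfy the law of reflection there (the boundary spheres have normal `x` at the
point `x`), and such that the final point is the initial point. -/
structure IsPeriodicBrokenRay {n : ℕ} (R : ℝ) (c : ℝ → ℝ) (B : Set (EuclideanSpace ℝ (Fin n)))
    (k : ℕ) (T : ℕ → ℝ) (γ v : ℕ → ℝ → EuclideanSpace ℝ (Fin n)) : Prop where
  one_le : 1 ≤ k
  segment : ∀ i < k, IsGeodesicSegment R c B (T i) (γ i) (v i)
  concat : ∀ i, i + 1 < k → γ (i + 1) 0 = γ i (T i)
  reflect : ∀ i, i + 1 < k →
    v (i + 1) 0 = v i (T i)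
      - (2 * inner ℝ (γ i (T i)) (v i (T i)) / ‖γ i (T i)‖ ^ 2) • γ i (T i)
  closed : γ (k - 1) (T (k - 1)) = γ 0 0

/-- The set of lengths of all periodic broken rays reflecting at the part `B` of the boundary.
As the segments have unit speed, the length is the total parameter time. -/
def brokenRayLengths {n : ℕ} (R : ℝ) (c : ℝ → ℝ) (B : Set (EuclideanSpace ℝ (Fin n))) : Set ℝ :=
  {l | ∃ (k : ℕ) (T : ℕ → ℝ) (γ v : ℕ → ℝ → EuclideanSpace ℝ (Fin n)),
    IsPeriodicBrokenRay R c B k T γ v ∧ l = ∑ i ∈ Finset.range k, T i}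

/-- The length spectrum `lsp(c)` in dimension `n`, without reflections at the inner boundary. -/
def lsp (n : ℕ) (R : ℝ) (c : ℝ → ℝ) : Set ℝ :=
  brokenRayLengths R c (outerBoundary n)

/-- The length spectrum `lsp'(c)` in dimension `n`, including the periodic broken rays which reflect
at the inner boundary. -/
def lsp' (n : ℕ) (R : ℝ) (c : ℝ → ℝ) : Set ℝ :=
  brokenRayLengths R c (outerBoundary n ∪ innerBoundary n R)

/-- A family `c τ`, `τ ∈ (-ε, ε)`, of `C^{1,1}` sound speeds on `[R, 1]` satisfying the Herglotz and
countable conjugacy conditions and depending `C¹`-smoothly on `τ`. -/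
structure IsAdmissibleFamily (ε R : ℝ) (c : ℝ → ℝ → ℝ) : Prop where
  soundSpeed : ∀ τ ∈ Set.Ioo (-ε) ε, IsSoundSpeed R (c τ)
  herglotz : ∀ τ ∈ Set.Ioo (-ε) ε, Herglotz R (c τ)
  countableConjugacy : ∀ τ ∈ Set.Ioo (-ε) ε, CountableConjugacy R (c τ)
  contDiffOn : ContDiffOn ℝ 1 (fun q : ℝ × ℝ => c q.1 q.2) (Set.Ioo (-ε) ε ×ˢ Set.Icc R 1)

end RadialRigidity

open MeasureTheory Set Filter Topology
open scoped NNReal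

namespace RadialRigidity

set_option linter.unusedSectionVars false

lemma exists_lipschitzOnWith_mul {f g : ℝ → ℝ} {s : Set ℝ} (hs : IsCompact s)
    (hf : ∃ K, LipschitzOnWith K f s) (hg : ∃ K, LipschitzOnWith K g s) :
    ∃ K, LipschitzOnWith K (fun x => f x * g x) s := by
  obtain ⟨K, hK⟩ := hf
  obtain ⟨L, hL⟩ := hg
  obtain ⟨A, hA⟩ := hs.exists_bound_of_continuousOn hK.continuousOn
  obtain ⟨B, hB⟩ := hs.exists_bound_of_continuousOn hL.continuousOn
  refine ⟨Real.toNNReal (|A| * L + |B| * K), LipschitzOnWith.of_dist_le_mul fun x hx y hy => ?_⟩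
  rw [Real.coe_toNNReal _ (by positivity)]
  have h1 := hK.dist_le_mul x hx y hy
  have h2 := hL.dist_le_mul x hx y hy
  have h3 := (hA x hx).trans (le_abs_self A)
  have h4 := (hB y hy).trans (le_abs_self B)
  rw [Real.dist_eq] at h1 h2 ⊢
  rw [Real.norm_eq_abs] at h3 h4
  calc |f x * g x - f y * g y| = |f x * (g x - g y) + (f x - f y) * g y| := by ring_nf
    _ ≤ |f x| * |g x - g y| + |f x - f y| * |g y| := by
        refine (abs_add_le _ _).trans ?_
        rw [abs_mul, abs_mul]
    _ ≤ |A| * (L * dist x y) + (K * dist x y) * |B| := by gcongr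
    _ = _ := by ring

lemma exists_lipschitzOnWith_inv {f : ℝ → ℝ} {s : Set ℝ} {κ : ℝ} (hκ : 0 < κ)
    (hf : ∃ K, LipschitzOnWith K f s) (hlow : ∀ x ∈ s, κ ≤ f x) :
    ∃ K, LipschitzOnWith K (fun x => (f x)⁻¹) s := by
  obtain ⟨K, hK⟩ := hf
  refine ⟨Real.toNNReal (K / κ ^ 2), LipschitzOnWith.of_dist_le_mul fun x hx y hy => ?_⟩
  rw [Real.coe_toNNReal _ (by positivity)]
  have h1 := hK.dist_le_mul x hx y hy
  have hx' := hlow x hx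
  have hy' := hlow y hy
  have hfx : 0 < f x := hκ.trans_le hx'
  have hfy : 0 < f y := hκ.trans_le hy'
  rw [Real.dist_eq] at h1 ⊢
  have : (f x)⁻¹ - (f y)⁻¹ = (f y - f x) / (f x * f y) := by field_simp
  rw [this, abs_div, abs_sub_comm, abs_of_pos (mul_pos hfx hfy), div_mul_eq_mul_div]
  have h2 : κ ^ 2 ≤ f x * f y := by
    rw [sq]; exact mul_le_mul hx' hy' hκ.le hfx.le
  exact div_le_div₀ (by positivity) h1 (by positivity) h2

/-- A real function with a continuous derivative bounded below by a positive constant has a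
differentiable global inverse. -/
lemma exists_hasDerivAt_inverse {f f' : ℝ → ℝ} {κ : ℝ} (hκ : 0 < κ)
    (hf : ∀ x, HasDerivAt f (f' x) x) (hlow : ∀ x, κ ≤ f' x) :
    ∃ g : ℝ → ℝ, (∀ x, g (f x) = x) ∧ (∀ y, f (g y) = y) ∧
      ∀ y, HasDerivAt g (1 / f' (g y)) y := by
  have hd : Differentiable ℝ f := fun x => (hf x).differentiableAt
  have hmono : StrictMono f := strictMono_of_deriv_pos fun x => by
    rw [(hf x).deriv]; exact hκ.trans_le (hlow x)
  have key : ∀ x y, x ≤ y → κ * (y - x) ≤ f y - f x := fun x y hxy =>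
    mul_sub_le_image_sub_of_le_deriv hd (fun z => by rw [(hf z).deriv]; exact hlow z) hxy
  have hsurj : Function.Surjective f := by
    refine hd.continuous.surjective ?_ ?_
    · refine tendsto_atTop_mono' atTop (f₁ := fun x => κ * x + f 0) ?_ ?_
      · filter_upwards [eventually_ge_atTop 0] with x hx
        have := key 0 x hx; linarith
      · exact tendsto_atTop_add_const_right _ _ (tendsto_id.const_mul_atTop hκ)
    · refine tendsto_atBot_mono' atBot (f₁ := fun x => κ * x + f 0) ?_ ?_
      · filter_upwards [eventually_le_atBot 0] with x hx
        have := key x 0 hx; linarith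
      · exact tendsto_atBot_add_const_right _ _ (tendsto_id.const_mul_atBot hκ)
  let e := hmono.orderIsoOfSurjective f hsurj
  have hfe : ∀ x, f (e.symm x) = x := fun x => e.apply_symm_apply x
  have hef : ∀ x, e.symm (f x) = x := fun x => e.symm_apply_apply x
  refine ⟨e.symm, hef, hfe, fun y => ?_⟩
  rw [one_div]
  exact HasDerivAt.of_local_left_inverse e.symm.continuous.continuousAt (hf _)
    (hκ.trans_le (hlow _)).ne' (Eventually.of_forall hfe)

/-- The data attached to a radial sound speed `c` on `[R, 1]`: a diffeomorphism `ρ` of the line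
extending `r / c r`, its derivative `ρ'`, its inverse `σ`, and a Lipschitz function `Q` of
`u = ρ r` which extends `1 / (c r * ρ' r)`. -/
structure Profile (R : ℝ) (c ρ ρ' σ Q : ℝ → ℝ) : Prop where
  R_nonneg : 0 ≤ R
  R_lt : R < 1
  c_pos : ∀ r ∈ Icc R 1, 0 < c r
  c_deriv : ∀ r ∈ Icc R 1, HasDerivWithinAt c (derivWithin c (Icc R 1) r) (Icc R 1) r
  ρ_eq : ∀ r ∈ Icc R 1, ρ r = r / c r
  ρ_deriv : ∀ s, HasDerivAt ρ (ρ' s) s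
  ρ'_cont : Continuous ρ'
  ρ'_low : ∃ κ > 0, ∀ s, κ ≤ ρ' s
  ρ'_eq : ∀ r ∈ Icc R 1, ρ' r = (c r - r * derivWithin c (Icc R 1) r) / c r ^ 2
  σ_ρ : ∀ s, σ (ρ s) = s
  ρ_σ : ∀ u, ρ (σ u) = u
  σ_deriv : ∀ u, HasDerivAt σ (1 / ρ' (σ u)) u
  Q_lip : ∃ K, LipschitzWith K Q
  Q_low : ∃ κ > 0, ∀ u, κ ≤ Q u
  Q_eq : ∀ r ∈ Icc R 1, Q (ρ r) = 1 / (c r * ρ' r)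

theorem exists_profile {R : ℝ} {c : ℝ → ℝ} (hR : 0 ≤ R) (hR1 : R < 1)
    (hc : IsSoundSpeed R c) (hH : Herglotz R c) : ∃ ρ ρ' σ Q, Profile R c ρ ρ' σ Q := by
  obtain ⟨K, hK⟩ := hc.lipschitz_deriv
  set c1 : ℝ → ℝ := derivWithin c (Icc R 1) with hc1
  have hud : UniqueDiffOn ℝ (Icc R 1) := uniqueDiffOn_Icc hR1
  have hcd : ∀ r ∈ Icc R 1, HasDerivWithinAt c (c1 r) (Icc R 1) r := fun r hr =>
    (hc.differentiableOn r hr).hasDerivWithinAt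
  have hccont : ContinuousOn c (Icc R 1) := hc.differentiableOn.continuousOn
  have hclip : ∃ L, LipschitzOnWith L c (Icc R 1) := by
    obtain ⟨A, hA⟩ := isCompact_Icc.exists_bound_of_continuousOn hK.continuousOn
    refine ⟨Real.toNNReal |A|, (convex_Icc R 1).lipschitzOnWith_of_nnnorm_hasDerivWithin_le hcd ?_⟩
    intro x hx
    rw [← NNReal.coe_le_coe, Real.coe_toNNReal _ (abs_nonneg _)]
    exact (hA x hx).trans (le_abs_self A)
  obtain ⟨κ, hκ, hcκ⟩ : ∃ κ > 0, ∀ r ∈ Icc R 1, κ ≤ c r := by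
    obtain ⟨x, hx, hxm⟩ := isCompact_Icc.exists_isMinOn (nonempty_Icc.2 hR1.le) hccont
    exact ⟨c x, hc.pos x hx, fun r hr => hxm hr⟩
  have hρd : ∀ r ∈ Icc R 1, HasDerivWithinAt (fun s => s / c s)
      ((c r - r * c1 r) / c r ^ 2) (Icc R 1) r := fun r hr => by
    have := (hasDerivWithinAt_id r (Icc R 1)).div (hcd r hr) (hc.pos r hr).ne'
    convert! this using 1
    simp
  let d : ℝ → ℝ := fun r => (c r - r * c1 r) / c r ^ 2
  have hdpos : ∀ r ∈ Icc R 1, 0 < d r := fun r hr => by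
    have := hH r hr
    rwa [(hρd r hr).derivWithin (hud r hr)] at this
  have hcinv : ∃ L, LipschitzOnWith L (fun r => (c r)⁻¹) (Icc R 1) :=
    exists_lipschitzOnWith_inv hκ hclip hcκ
  have hid : ∃ L, LipschitzOnWith L (fun r : ℝ => r) (Icc R 1) :=
    ⟨1, LipschitzWith.id.lipschitzOnWith⟩
  have hK' : ∃ L, LipschitzOnWith L c1 (Icc R 1) := ⟨K, hK⟩
  have hprod : ∃ L, LipschitzOnWith L (fun r => r * c1 r) (Icc R 1) :=
    exists_lipschitzOnWith_mul isCompact_Icc hid hK'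
  have hsub : ∃ L, LipschitzOnWith L (fun r => c r - r * c1 r) (Icc R 1) := by
    obtain ⟨L, hL⟩ := hclip
    obtain ⟨M, hM⟩ := hprod
    exact ⟨L + M, hL.sub hM⟩
  have hcinv2 := exists_lipschitzOnWith_mul isCompact_Icc hcinv hcinv
  have hdlip : ∃ L, LipschitzOnWith L d (Icc R 1) := by
    obtain ⟨L, hL⟩ := exists_lipschitzOnWith_mul isCompact_Icc hsub hcinv2
    have hd : d = fun r => (c r - r * c1 r) * ((c r)⁻¹ * (c r)⁻¹) := by
      funext r
      simp only [d, div_eq_mul_inv, sq, mul_inv]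
    exact ⟨L, hd ▸ hL⟩
  have hcdlip := exists_lipschitzOnWith_mul isCompact_Icc hclip hdlip
  obtain ⟨κ', hκ', hdκ⟩ : ∃ κ' > 0, ∀ r ∈ Icc R 1, κ' ≤ d r := by
    obtain ⟨L, hL⟩ := hdlip
    obtain ⟨x, hx, hxm⟩ := isCompact_Icc.exists_isMinOn (nonempty_Icc.2 hR1.le) hL.continuousOn
    exact ⟨d x, hdpos x hx, fun r hr => hxm hr⟩
  have hqlip : ∃ L, LipschitzOnWith L (fun r => (c r * d r)⁻¹) (Icc R 1) :=
    exists_lipschitzOnWith_inv (mul_pos hκ hκ') hcdlip fun x hx =>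
      mul_le_mul (hcκ x hx) (hdκ x hx) hκ'.le (hc.pos x hx).le
  let π : ℝ → ℝ := fun s => (projIcc R 1 hR1.le s : ℝ)
  have hπ : ∀ s, π s ∈ Icc R 1 := fun s => (projIcc R 1 hR1.le s).2
  have hπe : ∀ s ∈ Icc R 1, π s = s := fun s hs => by
    simp only [π, projIcc_of_mem hR1.le hs]
  have hπl : LipschitzWith 1 π := (LipschitzWith.projIcc hR1.le)
  have hρ'cont : Continuous (fun s => d (π s)) := by
    obtain ⟨L, hL⟩ := hdlip
    exact hL.continuousOn.comp_continuous hπl.continuous hπ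
  let ρ : ℝ → ℝ := fun s => R / c R + ∫ x in R..s, d (π x)
  have hρ : ∀ s, HasDerivAt ρ (d (π s)) s := fun s =>
    ((hρ'cont.integral_hasStrictDerivAt R s).hasDerivAt).const_add _
  obtain ⟨σ, hσρ, hρσ, hσd⟩ := exists_hasDerivAt_inverse hκ' hρ (fun x => hdκ _ (hπ x))
  have hρeq : ∀ r ∈ Icc R 1, ρ r = r / c r := by
    intro r hr
    have h0 : ∫ x in R..r, d (π x) = r / c r - R / c R := by
      refine intervalIntegral.integral_eq_sub_of_hasDerivAt_of_le hr.1 (f := fun s => s / c s)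
        ?_ ?_ (hρ'cont.intervalIntegrable _ _)
      · exact fun x hx => ((hρd x ⟨hx.1, hx.2.trans hr.2⟩).continuousWithinAt).mono
          (Icc_subset_Icc_right hr.2)
      · intro x hx
        have hx' : x ∈ Icc R 1 := ⟨hx.1.le, hx.2.le.trans hr.2⟩
        rw [hπe x hx']
        exact (hρd x hx').hasDerivAt (Icc_mem_nhds hx.1 (hx.2.trans_le hr.2))
    simp only [ρ, h0]; ring
  have hσlip : LipschitzWith (Real.toNNReal (1 / κ')) σ := by
    refine lipschitzWith_of_nnnorm_deriv_le (fun y => (hσd y).differentiableAt) fun y => ?_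
    rw [← NNReal.coe_le_coe, Real.coe_toNNReal _ (by positivity), (hσd y).deriv, coe_nnnorm,
      Real.norm_of_nonneg (one_div_nonneg.2 (hκ'.le.trans (hdκ _ (hπ _))))]
    exact one_div_le_one_div_of_le hκ' (hdκ _ (hπ _))
  obtain ⟨Lq, hLq⟩ := hqlip
  have hq : LipschitzWith Lq (fun s => (c (π s) * d (π s))⁻¹) := by
    refine LipschitzWith.of_dist_le_mul fun x y => ?_
    refine (hLq.dist_le_mul _ (hπ x) _ (hπ y)).trans ?_
    have := hπl.dist_le_mul x y
    simp only [NNReal.coe_one, one_mul] at this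
    gcongr
  refine ⟨ρ, fun s => d (π s), σ, fun u => (c (π (σ u)) * d (π (σ u)))⁻¹,
    hR, hR1, hc.pos, hcd, hρeq, hρ, hρ'cont, ⟨κ', hκ', fun s => hdκ _ (hπ s)⟩, ?_, hσρ, hρσ, hσd,
    ⟨_, hq.comp hσlip⟩, ?_, ?_⟩
  · intro r hr
    rw [hπe r hr]
  · have hcont : ContinuousOn (fun r => c r * d r) (Icc R 1) := by
      obtain ⟨L, hL⟩ := hcdlip
      exact hL.continuousOn
    obtain ⟨A, hA⟩ := isCompact_Icc.exists_bound_of_continuousOn hcont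
    have hAp : ∀ r ∈ Icc R 1, 0 < c r * d r ∧ c r * d r ≤ |A| := fun r hr =>
      ⟨mul_pos (hc.pos r hr) (hdpos r hr),
        (le_abs_self _).trans ((hA r hr).trans (le_abs_self A))⟩
    have hA0 : 0 < |A| := (hAp R ⟨le_rfl, hR1.le⟩).1.trans_le (hAp R ⟨le_rfl, hR1.le⟩).2
    refine ⟨|A|⁻¹, inv_pos.2 hA0, fun u => ?_⟩
    exact inv_anti₀ (hAp _ (hπ _)).1 (hAp _ (hπ _)).2
  · intro r hr
    simp only [hσρ, hπe r hr, one_div]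

namespace Profile

variable {R : ℝ} {c ρ ρ' σ Q : ℝ → ℝ} (P : Profile R c ρ ρ' σ Q)
include P

lemma ρ'_pos (s : ℝ) : 0 < ρ' s := by
  obtain ⟨κ, h, h'⟩ := P.ρ'_low
  exact h.trans_le (h' s)

lemma Q_pos (u : ℝ) : 0 < Q u := by
  obtain ⟨κ, h, h'⟩ := P.Q_low
  exact h.trans_le (h' u)

lemma Q_cont : Continuous Q := by
  obtain ⟨K, h⟩ := P.Q_lip
  exact h.continuous

lemma ρ_cont : Continuous ρ := continuous_iff_continuousAt.2 fun s => (P.ρ_deriv s).continuousAt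

lemma σ_cont : Continuous σ := continuous_iff_continuousAt.2 fun s => (P.σ_deriv s).continuousAt

lemma ρ_strictMono : StrictMono ρ := strictMono_of_deriv_pos fun x => by
  rw [(P.ρ_deriv x).deriv]; exact P.ρ'_pos x

lemma ρ_lt {a b : ℝ} : ρ a < ρ b ↔ a < b := P.ρ_strictMono.lt_iff_lt

lemma ρ_le {a b : ℝ} : ρ a ≤ ρ b ↔ a ≤ b := P.ρ_strictMono.le_iff_le

lemma mem_R : R ∈ Icc R 1 := ⟨le_rfl, P.R_lt.le⟩

lemma mem_one : (1 : ℝ) ∈ Icc R 1 := ⟨P.R_lt.le, le_rfl⟩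

lemma ρ_nonneg {r : ℝ} (hr : r ∈ Icc R 1) : 0 ≤ ρ r := by
  rw [P.ρ_eq r hr]; exact div_nonneg (P.R_nonneg.trans hr.1) (P.c_pos r hr).le

lemma ρ_R_nonneg : 0 ≤ ρ R := P.ρ_nonneg P.mem_R

lemma ρ_one_pos : 0 < ρ 1 := P.ρ_R_nonneg.trans_lt (P.ρ_lt.2 P.R_lt)

lemma ρ_pos {r : ℝ} (hr : r ∈ Icc R 1) (h : 0 < r) : 0 < ρ r := by
  rw [P.ρ_eq r hr]; exact div_pos h (P.c_pos r hr)

lemma c_eq {r : ℝ} (hr : r ∈ Icc R 1) (h : 0 < r) : c r = r / ρ r := by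
  rw [P.ρ_eq r hr]
  have := P.c_pos r hr
  field_simp

lemma exists_mul_abs_sub_le : ∃ κ > 0, ∀ s p, κ * |s - σ p| ≤ |ρ s - p| := by
  obtain ⟨κ, hκ, h⟩ := P.ρ'_low
  have key : ∀ x y, x ≤ y → κ * (y - x) ≤ ρ y - ρ x := fun x y hxy =>
    mul_sub_le_image_sub_of_le_deriv (fun x => (P.ρ_deriv x).differentiableAt)
      (fun z => by rw [(P.ρ_deriv z).deriv]; exact h z) hxy
  refine ⟨κ, hκ, fun s p => ?_⟩
  rcases le_total s (σ p) with hs | hs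
  · have := key _ _ hs
    rw [P.ρ_σ] at this
    rw [abs_of_nonpos (by linarith)]
    exact le_trans (by linarith) (neg_le_abs _)
  · have := key _ _ hs
    rw [P.ρ_σ] at this
    rw [abs_of_nonneg (by linarith)]
    exact this.trans (le_abs_self _)

end Profile

/-- The normalised radial component `⟨x, v⟩ / c(|x|)²` of a tangent vector. -/
noncomputable def radialMoment {n : ℕ} (c : ℝ → ℝ) (x v : EuclideanSpace ℝ (Fin n)) : ℝ :=
  inner ℝ x v / c ‖x‖ ^ 2

/-- The square of the angular momentum of a unit tangent vector. -/
noncomputable def momentumSq {n : ℕ} (c : ℝ → ℝ) (x v : EuclideanSpace ℝ (Fin n)) : ℝ :=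
  ‖x‖ ^ 2 / c ‖x‖ ^ 2 - radialMoment c x v ^ 2

/-- The component of the rescaled velocity which is orthogonal to the position. -/
noncomputable def transverse {n : ℕ} (c : ℝ → ℝ) (x v : EuclideanSpace ℝ (Fin n)) :
    EuclideanSpace ℝ (Fin n) :=
  (‖x‖ ^ 2 / c ‖x‖ ^ 2) • v - radialMoment c x v • x

section Algebra

variable {n : ℕ} {c : ℝ → ℝ} {x v : EuclideanSpace ℝ (Fin n)}

lemma momentumSq_nonneg (hC : 0 < c ‖x‖) (hv : ‖v‖ = c ‖x‖) : 0 ≤ momentumSq c x v := by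
  have h := abs_real_inner_le_norm x v
  have h2 : inner ℝ x v ^ 2 ≤ (‖x‖ * ‖v‖) ^ 2 := by
    rw [← sq_abs]; gcongr
  rw [hv] at h2
  have : momentumSq c x v = ((‖x‖ * c ‖x‖) ^ 2 - inner ℝ x v ^ 2) / c ‖x‖ ^ 4 := by
    unfold momentumSq radialMoment
    field_simp
  rw [this]
  exact div_nonneg (by linarith) (by positivity)

lemma inner_transverse (x v : EuclideanSpace ℝ (Fin n)) : inner ℝ x (transverse c x v) = 0 := by
  unfold transverse radialMoment
  rw [inner_sub_right, inner_smul_right, inner_smul_right, real_inner_self_eq_norm_sq]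
  ring

/-- Reflection at a sphere reverses the radial moment. -/
lemma radialMoment_reflect (hx : x ≠ 0) :
    radialMoment c x (v - (2 * inner ℝ x v / ‖x‖ ^ 2) • x) = -radialMoment c x v := by
  have hx' : ‖x‖ ≠ 0 := norm_ne_zero_iff.2 hx
  unfold radialMoment
  rw [inner_sub_right, inner_smul_right, real_inner_self_eq_norm_sq]
  field_simp
  ring

lemma momentumSq_reflect (hx : x ≠ 0) :
    momentumSq c x (v - (2 * inner ℝ x v / ‖x‖ ^ 2) • x) = momentumSq c x v := by
  unfold momentumSq
  rw [radialMoment_reflect hx, neg_sq]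

/-- Reflection at a sphere does not change the transverse component. -/
lemma transverse_reflect (hC : 0 < c ‖x‖) (hx : x ≠ 0) :
    transverse c x (v - (2 * inner ℝ x v / ‖x‖ ^ 2) • x) = transverse c x v := by
  have hx' : ‖x‖ ≠ 0 := norm_ne_zero_iff.2 hx
  unfold transverse
  rw [radialMoment_reflect hx, smul_sub, smul_smul, sub_sub, ← add_smul]
  congr 2
  unfold radialMoment
  field_simp
  ring

end Algebra

section Segment

variable {R : ℝ} {c ρ ρ' σ Q : ℝ → ℝ} {n : ℕ} {B : Set (EuclideanSpace ℝ (Fin n))} {T : ℝ}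
  {γ v : ℝ → EuclideanSpace ℝ (Fin n)}

lemma IsGeodesicSegment.norm_mem (P : Profile R c ρ ρ' σ Q)
    (hB : ∀ x ∈ B, ‖x‖ = 1 ∨ (0 < R ∧ ‖x‖ = R)) (h : IsGeodesicSegment R c B T γ v) {t : ℝ}
    (ht : t ∈ Icc 0 T) : ‖γ t‖ ∈ Icc R 1 := by
  have hb : ∀ x ∈ B, ‖x‖ ∈ Icc R 1 := fun x hx => by
    rcases hB x hx with h | h
    · rw [h]; exact P.mem_one
    · rw [h.2]; exact P.mem_R
  rcases eq_or_lt_of_le ht.1 with h0 | h0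
  · rw [← h0]; exact hb _ h.start_mem
  rcases eq_or_lt_of_le ht.2 with h1 | h1
  · rw [h1]; exact hb _ h.end_mem
  obtain ⟨h2, h3⟩ := h.interior t ⟨h0, h1⟩
  refine ⟨?_, h3.le⟩
  rcases h2 with h2 | h2
  · exact h2.le
  · rw [h2]; exact norm_nonneg _

lemma IsGeodesicSegment.hasDeriv_speed (P : Profile R c ρ ρ' σ Q)
    (hc0 : R = 0 → derivWithin c (Icc R 1) 0 = 0)
    (hB : ∀ x ∈ B, ‖x‖ = 1 ∨ (0 < R ∧ ‖x‖ = R)) (h : IsGeodesicSegment R c B T γ v) {t : ℝ}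
    (ht : t ∈ Icc 0 T) :
    HasDerivWithinAt (fun t => c ‖γ t‖)
      (derivWithin c (Icc R 1) ‖γ t‖ / ‖γ t‖ * inner ℝ (γ t) (v t)) (Icc 0 T) t := by
  have hmap : MapsTo (fun t => ‖γ t‖) (Icc 0 T) (Icc R 1) := fun s hs => h.norm_mem P hB hs
  have hcd := P.c_deriv _ (hmap ht)
  by_cases hx : γ t = 0
  · have hR0 : R = 0 := le_antisymm (by simpa [hx] using (hmap ht).1) P.R_nonneg
    simp only [hx, norm_zero, hc0 hR0, inner_zero_left, mul_zero] at hcd ⊢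
    rw [hasDerivWithinAt_iff_isLittleO] at hcd ⊢
    simp only [hx, norm_zero, smul_zero, sub_zero] at hcd ⊢
    have hlim : Tendsto (fun t => ‖γ t‖) (𝓝[Icc 0 T] t) (𝓝[Icc R 1] 0) := by
      have h1 := ((h.hasDeriv t ht).continuousWithinAt.norm)
      have h2 := h1.tendsto_nhdsWithin hmap
      simpa [hx] using h2
    have h3 := hcd.comp_tendsto hlim
    have h4 := (h.hasDeriv t ht).isBigO_sub.comp_tendsto
      (tendsto_id.prodMk (tendsto_const_pure : Tendsto (fun _ : ℝ => t) _ (pure t)))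
    simp only [Function.comp_def, id, hx, sub_zero] at h3 h4
    exact h3.trans_isBigO h4.norm_left
  · have hn := (h.hasDeriv t ht).norm_sq
    have hx' : ‖γ t‖ ≠ 0 := norm_ne_zero_iff.2 hx
    have h2 := hn.sqrt (by positivity)
    simp only [Real.sqrt_sq (norm_nonneg _)] at h2
    convert! hcd.comp t h2 hmap using 1
    field_simp

/-- The derivative of the radial moment along a geodesic. -/
noncomputable def momentRate (R : ℝ) (c : ℝ → ℝ) (x : EuclideanSpace ℝ (Fin n)) : ℝ :=
  1 - derivWithin c (Icc R 1) ‖x‖ / ‖x‖ * ‖x‖ ^ 2 / c ‖x‖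

lemma momentRate_pos (P : Profile R c ρ ρ' σ Q) {x : EuclideanSpace ℝ (Fin n)}
    (hx : ‖x‖ ∈ Icc R 1) : 0 < momentRate R c x := by
  unfold momentRate
  rcases eq_or_ne ‖x‖ 0 with h0 | h0
  · simp [h0]
  · have h1 := P.ρ'_eq _ hx
    have h2 := P.c_pos _ hx
    have h3 := mul_pos h2 (P.ρ'_pos ‖x‖)
    rw [h1] at h3
    convert! h3 using 1
    field_simp

variable (P : Profile R c ρ ρ' σ Q) (hc0 : R = 0 → derivWithin c (Icc R 1) 0 = 0)
  (hB : ∀ x ∈ B, ‖x‖ = 1 ∨ (0 < R ∧ ‖x‖ = R)) (h : IsGeodesicSegment R c B T γ v)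
include P hc0 hB h

namespace IsGeodesicSegment

lemma hasDeriv_radialMoment {t : ℝ} (ht : t ∈ Icc 0 T) :
    HasDerivWithinAt (fun t => radialMoment c (γ t) (v t)) (momentRate R c (γ t)) (Icc 0 T) t := by
  have hC := P.c_pos _ (h.norm_mem P hB ht)
  have h1 := ((h.hasDeriv t ht).inner ℝ (h.geodesic t ht)).div
    ((h.hasDeriv_speed P hc0 hB ht).pow 2) (pow_pos hC 2).ne'
  unfold radialMoment momentRate
  convert! h1 using 1
  simp only [radialGradient, inner_smul_left, inner_sub_right, inner_smul_right,
    real_inner_self_eq_norm_sq, conj_trivial, h.unit_speed t ht, Pi.pow_apply]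
  set g := derivWithin c (Icc R 1) ‖γ t‖ / ‖γ t‖
  field_simp
  ring

lemma hasDeriv_ratio {t : ℝ} (ht : t ∈ Icc 0 T) :
    HasDerivWithinAt (fun t => ‖γ t‖ ^ 2 / c ‖γ t‖ ^ 2)
      (2 * radialMoment c (γ t) (v t) * momentRate R c (γ t)) (Icc 0 T) t := by
  have hC := P.c_pos _ (h.norm_mem P hB ht)
  have h1 := ((h.hasDeriv t ht).norm_sq).div ((h.hasDeriv_speed P hc0 hB ht).pow 2)
    (pow_pos hC 2).ne'
  unfold radialMoment momentRate
  convert! h1 using 1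
  set g := derivWithin c (Icc R 1) ‖γ t‖ / ‖γ t‖
  simp only [Pi.pow_apply]
  field_simp
  ring

/-- The angular momentum is conserved along a geodesic. -/
lemma momentumSq_eq {t : ℝ} (ht : t ∈ Icc 0 T) :
    momentumSq c (γ t) (v t) = momentumSq c (γ 0) (v 0) := by
  have hd : ∀ t ∈ Icc 0 T, HasDerivWithinAt (fun t => momentumSq c (γ t) (v t)) 0 (Icc 0 T) t := by
    intro t ht
    have h1 := (h.hasDeriv_ratio P hc0 hB ht).sub ((h.hasDeriv_radialMoment P hc0 hB ht).pow 2)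
    unfold momentumSq
    convert! h1 using 1
    push_cast
    ring
  exact constant_of_derivWithin_zero (fun t ht => (hd t ht).differentiableWithinAt)
    (fun t ht => (hd t (Ico_subset_Icc_self ht)).derivWithin
      (uniqueDiffOn_Icc h.length_pos t (Ico_subset_Icc_self ht))) t ht

lemma hasDeriv_transverse {t : ℝ} (ht : t ∈ Icc 0 T) :
    HasDerivWithinAt (fun t => transverse c (γ t) (v t))
      (radialMoment c (γ t) (v t) • v t - γ t) (Icc 0 T) t := by
  have hC := P.c_pos _ (h.norm_mem P hB ht)
  have h1 := ((h.hasDeriv_ratio P hc0 hB ht).smul (h.geodesic t ht)).sub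
    ((h.hasDeriv_radialMoment P hc0 hB ht).smul (h.hasDeriv t ht))
  unfold transverse
  convert! h1 using 1
  have e1 : inner ℝ (γ t) (v t) = radialMoment c (γ t) (v t) * c ‖γ t‖ ^ 2 := by
    unfold radialMoment; field_simp
  simp only [radialGradient, momentRate, inner_smul_left, conj_trivial, e1, h.unit_speed t ht]
  set g := derivWithin c (Icc R 1) ‖γ t‖ / ‖γ t‖
  set z := radialMoment c (γ t) (v t)
  match_scalars
  · field_simp; ring
  · field_simp; ring

lemma radialMoment_strictMonoOn :
    StrictMonoOn (fun t => radialMoment c (γ t) (v t)) (Icc 0 T) := by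
  refine strictMonoOn_of_deriv_pos (convex_Icc _ _)
    (fun t ht => (h.hasDeriv_radialMoment P hc0 hB ht).continuousWithinAt) fun t ht => ?_
  rw [interior_Icc] at ht
  rw [((h.hasDeriv_radialMoment P hc0 hB (Ioo_subset_Icc_self ht)).hasDerivAt
    (Icc_mem_nhds ht.1 ht.2)).deriv]
  exact momentRate_pos P (h.norm_mem P hB (Ioo_subset_Icc_self ht))

lemma radialMoment_sq {t : ℝ} (ht : t ∈ Icc 0 T) :
    radialMoment c (γ t) (v t) ^ 2 = ρ ‖γ t‖ ^ 2 - momentumSq c (γ 0) (v 0) := by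
  rw [← h.momentumSq_eq P hc0 hB ht, P.ρ_eq _ (h.norm_mem P hB ht)]
  unfold momentumSq
  ring

end IsGeodesicSegment

end Segment

section Frame

variable {R : ℝ} {c ρ ρ' σ Q : ℝ → ℝ} {n : ℕ} {B : Set (EuclideanSpace ℝ (Fin n))} {T : ℝ}
  {γ v : ℝ → EuclideanSpace ℝ (Fin n)}

/-- The unit vector in the direction of the position. -/
noncomputable def radialUnit {n : ℕ} (x : EuclideanSpace ℝ (Fin n)) : EuclideanSpace ℝ (Fin n) :=
  (1 / ‖x‖) • x

/-- The unit vector orthogonal to the position in the plane of motion. -/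
noncomputable def angularUnit {n : ℕ} (c : ℝ → ℝ) (p : ℝ) (x v : EuclideanSpace ℝ (Fin n)) :
    EuclideanSpace ℝ (Fin n) :=
  (1 / (p * ‖x‖)) • transverse c x v

lemma IsGeodesicSegment.hasDeriv_norm (h : IsGeodesicSegment R c B T γ v) {t : ℝ}
    (ht : t ∈ Icc 0 T) (hx : γ t ≠ 0) :
    HasDerivWithinAt (fun t => ‖γ t‖) (inner ℝ (γ t) (v t) / ‖γ t‖) (Icc 0 T) t := by
  have hn := (h.hasDeriv t ht).norm_sq
  have hx' : ‖γ t‖ ≠ 0 := norm_ne_zero_iff.2 hx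
  have h2 := hn.sqrt (by positivity)
  simp only [Real.sqrt_sq (norm_nonneg _)] at h2
  convert! h2 using 1
  field_simp

variable (P : Profile R c ρ ρ' σ Q) (hc0 : R = 0 → derivWithin c (Icc R 1) 0 = 0)
  (hB : ∀ x ∈ B, ‖x‖ = 1 ∨ (0 < R ∧ ‖x‖ = R)) (h : IsGeodesicSegment R c B T γ v)
include P hc0 hB h

lemma IsGeodesicSegment.ne_zero {p : ℝ} (hp : 0 < p)
    (hm : momentumSq c (γ 0) (v 0) = p ^ 2) {t : ℝ} (ht : t ∈ Icc 0 T) : γ t ≠ 0 := by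
  intro h0
  have h1 := h.momentumSq_eq P hc0 hB ht
  rw [hm] at h1
  unfold momentumSq at h1
  rw [h0, norm_zero] at h1
  have := sq_nonneg (radialMoment c (0 : EuclideanSpace ℝ (Fin n)) (v t))
  have := pow_pos hp 2
  simp at h1
  linarith

/-- Along a geodesic the orthonormal frame spanned by the position and the velocity turns in its
plane by the angle `∫ p c² / |γ|²`. -/
lemma IsGeodesicSegment.frame_rotation {p : ℝ} (hp : 0 < p)
    (hm : momentumSq c (γ 0) (v 0) = p ^ 2) {Θ : ℝ}
    (hΘ : Θ = ∫ t in (0 : ℝ)..T, p * c ‖γ t‖ ^ 2 / ‖γ t‖ ^ 2) :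
    radialUnit (γ T) = Real.cos Θ • radialUnit (γ 0) + Real.sin Θ • angularUnit c p (γ 0) (v 0) ∧
    angularUnit c p (γ T) (v T)
      = -Real.sin Θ • radialUnit (γ 0) + Real.cos Θ • angularUnit c p (γ 0) (v 0) := by
  have hT := h.length_pos
  set κ : ℝ → ℝ := fun t => p * c ‖γ t‖ ^ 2 / ‖γ t‖ ^ 2 with hκ
  have hne : ∀ t ∈ Icc 0 T, γ t ≠ 0 := fun t ht => h.ne_zero P hc0 hB hp hm ht
  have hκc : ContinuousOn κ (Icc 0 T) := by
    have h1 : ContinuousOn (fun t => ‖γ t‖) (Icc 0 T) := fun t ht =>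
      (h.hasDeriv t ht).continuousWithinAt.norm
    have h2 : ContinuousOn (fun t => c ‖γ t‖) (Icc 0 T) := fun t ht =>
      (h.hasDeriv_speed P hc0 hB ht).continuousWithinAt
    refine (continuousOn_const.mul (h2.pow 2)).div (h1.pow 2) fun t ht => ?_
    exact pow_ne_zero _ (norm_ne_zero_iff.2 (hne t ht))
  let κe : ℝ → ℝ := fun t => κ (projIcc 0 T hT.le t)
  have hκe : Continuous κe :=
    hκc.comp_continuous (continuous_subtype_val.comp continuous_projIcc) fun t =>
      (projIcc 0 T hT.le t).2
  have hκeq : ∀ t ∈ Icc 0 T, κe t = κ t := fun t ht => by simp only [κe, projIcc_of_mem hT.le ht]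
  let θ : ℝ → ℝ := fun t => ∫ s in (0 : ℝ)..t, κe s
  have hθ : ∀ t ∈ Icc 0 T, HasDerivWithinAt θ (κ t) (Icc 0 T) t := fun t ht => by
    rw [← hκeq t ht]
    exact (hκe.integral_hasStrictDerivAt 0 t).hasDerivAt.hasDerivWithinAt
  have hθ0 : θ 0 = 0 := intervalIntegral.integral_same
  have hθT : θ T = Θ := by
    rw [hΘ]
    refine intervalIntegral.integral_congr fun t ht => ?_
    rw [uIcc_of_le hT.le] at ht
    exact hκeq t ht
  set X : ℝ → EuclideanSpace ℝ (Fin n) := fun t => radialUnit (γ t) with hX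
  set Y : ℝ → EuclideanSpace ℝ (Fin n) := fun t => angularUnit c p (γ t) (v t) with hY
  have hmom : ∀ t ∈ Icc 0 T,
      ‖γ t‖ ^ 2 = c ‖γ t‖ ^ 2 * (p ^ 2 + radialMoment c (γ t) (v t) ^ 2) := fun t ht => by
    have h1 := h.momentumSq_eq P hc0 hB ht
    have hC := P.c_pos _ (h.norm_mem P hB ht)
    rw [hm] at h1
    rw [← h1]
    unfold momentumSq
    field_simp
    ring
  have hXd : ∀ t ∈ Icc 0 T, HasDerivWithinAt X (κ t • Y t) (Icc 0 T) t := fun t ht => by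
    have hr : ‖γ t‖ ≠ 0 := norm_ne_zero_iff.2 (hne t ht)
    have hC := P.c_pos _ (h.norm_mem P hB ht)
    have h1 := ((hasDerivWithinAt_const t (Icc 0 T) (1 : ℝ)).div
      (h.hasDeriv_norm ht (hne t ht)) hr).smul (h.hasDeriv t ht)
    convert! h1 using 1
    have e1 : inner ℝ (γ t) (v t) = radialMoment c (γ t) (v t) * c ‖γ t‖ ^ 2 := by
      unfold radialMoment; field_simp
    rw [e1]
    simp only [hY, hκ, angularUnit, transverse]
    set z := radialMoment c (γ t) (v t)
    match_scalars
    · simp only [Pi.div_apply]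
      field_simp
    · field_simp
      ring
  have hYd : ∀ t ∈ Icc 0 T, HasDerivWithinAt Y (-κ t • X t) (Icc 0 T) t := fun t ht => by
    have hr : ‖γ t‖ ≠ 0 := norm_ne_zero_iff.2 (hne t ht)
    have hC := P.c_pos _ (h.norm_mem P hB ht)
    have h1 := ((hasDerivWithinAt_const t (Icc 0 T) (1 : ℝ)).div
      ((h.hasDeriv_norm ht (hne t ht)).const_mul p) (mul_ne_zero hp.ne' hr)).smul
      (h.hasDeriv_transverse P hc0 hB ht)
    convert! h1 using 1
    have e1 : inner ℝ (γ t) (v t) = radialMoment c (γ t) (v t) * c ‖γ t‖ ^ 2 := by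
      unfold radialMoment; field_simp
    have e2 := hmom t ht
    rw [e1]
    simp only [hX, hκ, radialUnit, transverse]
    set z := radialMoment c (γ t) (v t)
    match_scalars
    · simp only [Pi.div_apply]
      field_simp
      rw [e2]
      ring
    · simp only [Pi.div_apply]
      field_simp
      ring
  have hA : ∀ t ∈ Icc 0 T, Real.cos (θ t) • X t - Real.sin (θ t) • Y t = X 0 := by
    have hd : ∀ t ∈ Icc 0 T, HasDerivWithinAt
        (fun t => Real.cos (θ t) • X t - Real.sin (θ t) • Y t) 0 (Icc 0 T) t := fun t ht => by
      have h1 := ((hθ t ht).cos.smul (hXd t ht)).sub ((hθ t ht).sin.smul (hYd t ht))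
      convert! h1 using 1
      module
    intro t ht
    have := constant_of_derivWithin_zero (fun t ht => (hd t ht).differentiableWithinAt)
      (fun t ht => (hd t (Ico_subset_Icc_self ht)).derivWithin
        (uniqueDiffOn_Icc hT t (Ico_subset_Icc_self ht))) t ht
    rw [this, hθ0]; simp
  have hBt : ∀ t ∈ Icc 0 T, Real.sin (θ t) • X t + Real.cos (θ t) • Y t = Y 0 := by
    have hd : ∀ t ∈ Icc 0 T, HasDerivWithinAt
        (fun t => Real.sin (θ t) • X t + Real.cos (θ t) • Y t) 0 (Icc 0 T) t := fun t ht => by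
      have h1 := ((hθ t ht).sin.smul (hXd t ht)).add ((hθ t ht).cos.smul (hYd t ht))
      convert! h1 using 1
      module
    intro t ht
    have := constant_of_derivWithin_zero (fun t ht => (hd t ht).differentiableWithinAt)
      (fun t ht => (hd t (Ico_subset_Icc_self ht)).derivWithin
        (uniqueDiffOn_Icc hT t (Ico_subset_Icc_self ht))) t ht
    rw [this, hθ0]; simp
  have hTm : T ∈ Icc 0 T := ⟨hT.le, le_rfl⟩
  have h1 := hA T hTm
  have h2 := hBt T hTm
  rw [hθT] at h1 h2
  change X T = _ • X 0 + _ • Y 0 ∧ Y T = _ • X 0 + _ • Y 0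
  rw [← h1, ← h2]
  have hsc := Real.sin_sq_add_cos_sq Θ
  constructor
  · match_scalars
    · linear_combination -hsc
    · ring
  · match_scalars
    · linear_combination -hsc
    · ring

end Frame

/-- Half the length of a maximal geodesic of angular momentum `p`. -/
noncomputable def halfLength (ρ : ℝ → ℝ) (R p : ℝ) : ℝ :=
  ∫ s in Ioc R 1, ρ s ^ 2 / (s * √(ρ s ^ 2 - p ^ 2))

/-- Half the angle swept by a maximal geodesic of angular momentum `p`. -/
noncomputable def halfAngle (ρ : ℝ → ℝ) (R p : ℝ) : ℝ :=
  ∫ s in Ioc R 1, p / (s * √(ρ s ^ 2 - p ^ 2))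

section Integrals

variable {R : ℝ} {c ρ ρ' σ Q : ℝ → ℝ} {n : ℕ} {B : Set (EuclideanSpace ℝ (Fin n))} {T : ℝ}
  {γ v : ℝ → EuclideanSpace ℝ (Fin n)}

lemma IsGeodesicSegment.norm_continuousOn (h : IsGeodesicSegment R c B T γ v) :
    ContinuousOn (fun t => ‖γ t‖) (Icc 0 T) := fun t ht =>
  (h.hasDeriv t ht).continuousWithinAt.norm

variable (P : Profile R c ρ ρ' σ Q) (hc0 : R = 0 → derivWithin c (Icc R 1) 0 = 0)
  (hB : ∀ x ∈ B, ‖x‖ = 1 ∨ (0 < R ∧ ‖x‖ = R)) (h : IsGeodesicSegment R c B T γ v)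
include P hc0 hB h

namespace IsGeodesicSegment

lemma setIntegral_radius_of_injOn {p : ℝ} (hm : momentumSq c (γ 0) (v 0) = p ^ 2)
    {t₁ t₂ m : ℝ} (h1 : 0 ≤ t₁) (h2 : t₂ ≤ T)
    (hz : ∀ t ∈ Ioo t₁ t₂, radialMoment c (γ t) (v t) ≠ 0)
    (hinj : InjOn (fun t => ‖γ t‖) (Ioo t₁ t₂))
    (himg : (fun t => ‖γ t‖) '' Ioo t₁ t₂ = Ioo m 1) (hmI : m ∈ Icc R 1)
    (hm' : m = R ∨ ρ m ^ 2 = p ^ 2) (f : ℝ → ℝ) :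
    ∫ t in Ioo t₁ t₂, f ‖γ t‖
      = ∫ s in Ioc R 1, f s * ρ s / (c s * √(ρ s ^ 2 - p ^ 2)) := by
  set g : ℝ → ℝ := fun s => f s * ρ s / (c s * √(ρ s ^ 2 - p ^ 2)) with hg
  have hsub : ∀ t ∈ Ioo t₁ t₂, t ∈ Ioo 0 T := fun t ht =>
    ⟨h1.trans_lt ht.1, ht.2.trans_le h2⟩
  have hsub' : ∀ t ∈ Ioo t₁ t₂, t ∈ Icc 0 T := fun t ht => Ioo_subset_Icc_self (hsub t ht)
  have hne : ∀ t ∈ Ioo t₁ t₂, γ t ≠ 0 := fun t ht h0 => by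
    apply hz t ht
    unfold radialMoment
    rw [h0, inner_zero_left, zero_div]
  have hIoc : ∫ s in Ioc R 1, g s = ∫ s in Ioo m 1, g s := by
    rw [← integral_Ioc_eq_integral_Ioo]
    refine setIntegral_eq_of_subset_of_forall_sdiff_eq_zero measurableSet_Ioc
      (Ioc_subset_Ioc_left hmI.1) fun s hs => ?_
    have hs1 : s ≤ m := by
      by_contra hcon
      exact hs.2 ⟨not_le.1 hcon, hs.1.2⟩
    rcases hm' with hmR | hmp
    · exact absurd hs.1.1 (not_lt.2 (hmR ▸ hs1))
    · have h3 : ρ s ^ 2 ≤ p ^ 2 := by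
        rw [← hmp]
        exact pow_le_pow_left₀ (P.ρ_nonneg ⟨hs.1.1.le, hs.1.2⟩) (P.ρ_le.2 hs1) 2
      simp only [hg]
      rw [Real.sqrt_eq_zero_of_nonpos (by linarith), mul_zero, div_zero]
  rw [hIoc, ← himg, integral_image_eq_integral_abs_deriv_smul measurableSet_Ioo
    (fun t ht => ((h.hasDeriv_norm (hsub' t ht) (hne t ht)).hasDerivAt
      (Icc_mem_nhds (hsub t ht).1 (hsub t ht).2)).hasDerivWithinAt) hinj]
  refine setIntegral_congr_fun measurableSet_Ioo fun t ht => ?_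
  have hr := norm_pos_iff.2 (hne t ht)
  have hrm := h.norm_mem P hB (hsub' t ht)
  have hC := P.c_pos _ hrm
  have hzsq := h.radialMoment_sq P hc0 hB (hsub' t ht)
  rw [hm] at hzsq
  have e1 : inner ℝ (γ t) (v t) = radialMoment c (γ t) (v t) * c ‖γ t‖ ^ 2 := by
    unfold radialMoment; field_simp
  have hzp : 0 < |radialMoment c (γ t) (v t)| := abs_pos.2 (hz t ht)
  simp only [hg, smul_eq_mul]
  rw [← hzsq, Real.sqrt_sq_eq_abs, e1, abs_div, abs_mul, abs_of_pos hr, abs_of_pos (pow_pos hC 2),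
    P.ρ_eq _ hrm]
  field_simp

/-- Change of variables from arc length to radius on an outgoing piece of a geodesic. -/
lemma setIntegral_radius_outgoing {p : ℝ} (hm : momentumSq c (γ 0) (v 0) = p ^ 2)
    {t₁ t₂ : ℝ} (h1 : 0 ≤ t₁) (h12 : t₁ < t₂) (h2 : t₂ ≤ T)
    (hz : ∀ t ∈ Ioo t₁ t₂, 0 < radialMoment c (γ t) (v t)) (hend : ‖γ t₂‖ = 1)
    (hlow : ‖γ t₁‖ = R ∨ radialMoment c (γ t₁) (v t₁) = 0) (f : ℝ → ℝ) :
    ∫ t in Ioo t₁ t₂, f ‖γ t‖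
      = ∫ s in Ioc R 1, f s * ρ s / (c s * √(ρ s ^ 2 - p ^ 2)) := by
  have hI : Icc t₁ t₂ ⊆ Icc 0 T := Icc_subset_Icc h1 h2
  have ht1 : t₁ ∈ Icc 0 T := hI ⟨le_rfl, h12.le⟩
  have hcont := (h.norm_continuousOn).mono hI
  have hmono : StrictMonoOn (fun t => ‖γ t‖) (Icc t₁ t₂) := by
    refine strictMonoOn_of_deriv_pos (convex_Icc _ _) hcont fun t ht => ?_
    rw [interior_Icc] at ht
    have hne : γ t ≠ 0 := fun h0 => by
      have := hz t ht
      unfold radialMoment at this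
      rw [h0, inner_zero_left, zero_div] at this
      exact lt_irrefl _ this
    have htI := hI (Ioo_subset_Icc_self ht)
    rw [((h.hasDeriv_norm htI hne).hasDerivAt
      (Icc_mem_nhds (h1.trans_lt ht.1) (ht.2.trans_le h2))).deriv]
    refine div_pos ?_ (norm_pos_iff.2 hne)
    have hC := P.c_pos _ (h.norm_mem P hB htI)
    have h3 := hz t ht
    unfold radialMoment at h3
    exact (div_pos_iff_of_pos_right (pow_pos hC 2)).1 h3
  refine h.setIntegral_radius_of_injOn P hc0 hB hm (m := ‖γ t₁‖) h1 h2 (fun t ht => (hz t ht).ne')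
    (hmono.injOn.mono Ioo_subset_Icc_self) ?_ (h.norm_mem P hB ht1) ?_ f
  · refine Subset.antisymm ?_ ?_
    · rintro _ ⟨t, ht, rfl⟩
      rw [← hend]
      exact ⟨hmono ⟨le_rfl, h12.le⟩ (Ioo_subset_Icc_self ht) ht.1,
        hmono (Ioo_subset_Icc_self ht) ⟨h12.le, le_rfl⟩ ht.2⟩
    · have := intermediate_value_Ioo h12.le hcont
      simpa only [hend] using this
  · refine hlow.imp_right fun h0 => ?_
    have := h.radialMoment_sq P hc0 hB ht1
    rw [h0, hm] at this
    linarith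

/-- Change of variables from arc length to radius on an ingoing piece of a geodesic. -/
lemma setIntegral_radius_ingoing {p : ℝ} (hm : momentumSq c (γ 0) (v 0) = p ^ 2)
    {t₁ t₂ : ℝ} (h1 : 0 ≤ t₁) (h12 : t₁ < t₂) (h2 : t₂ ≤ T)
    (hz : ∀ t ∈ Ioo t₁ t₂, radialMoment c (γ t) (v t) < 0) (hend : ‖γ t₁‖ = 1)
    (hlow : ‖γ t₂‖ = R ∨ radialMoment c (γ t₂) (v t₂) = 0) (f : ℝ → ℝ) :
    ∫ t in Ioo t₁ t₂, f ‖γ t‖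
      = ∫ s in Ioc R 1, f s * ρ s / (c s * √(ρ s ^ 2 - p ^ 2)) := by
  have hI : Icc t₁ t₂ ⊆ Icc 0 T := Icc_subset_Icc h1 h2
  have ht2 : t₂ ∈ Icc 0 T := hI ⟨h12.le, le_rfl⟩
  have hcont := (h.norm_continuousOn).mono hI
  have hanti : StrictAntiOn (fun t => ‖γ t‖) (Icc t₁ t₂) := by
    refine strictAntiOn_of_deriv_neg (convex_Icc _ _) hcont fun t ht => ?_
    rw [interior_Icc] at ht
    have hne : γ t ≠ 0 := fun h0 => by
      have := hz t ht
      unfold radialMoment at this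
      rw [h0, inner_zero_left, zero_div] at this
      exact lt_irrefl _ this
    have htI := hI (Ioo_subset_Icc_self ht)
    rw [((h.hasDeriv_norm htI hne).hasDerivAt
      (Icc_mem_nhds (h1.trans_lt ht.1) (ht.2.trans_le h2))).deriv]
    refine div_neg_of_neg_of_pos ?_ (norm_pos_iff.2 hne)
    have hC := P.c_pos _ (h.norm_mem P hB htI)
    have h3 := hz t ht
    unfold radialMoment at h3
    by_contra hcon
    exact absurd h3 (not_lt.2 (div_nonneg (not_lt.1 hcon) (pow_pos hC 2).le))
  refine h.setIntegral_radius_of_injOn P hc0 hB hm (m := ‖γ t₂‖) h1 h2 (fun t ht => (hz t ht).ne)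
    (hanti.injOn.mono Ioo_subset_Icc_self) ?_ (h.norm_mem P hB ht2) ?_ f
  · refine Subset.antisymm ?_ ?_
    · rintro _ ⟨t, ht, rfl⟩
      rw [← hend]
      exact ⟨hanti (Ioo_subset_Icc_self ht) ⟨h12.le, le_rfl⟩ ht.2,
        hanti ⟨le_rfl, h12.le⟩ (Ioo_subset_Icc_self ht) ht.1⟩
    · have := intermediate_value_Ioo' h12.le hcont
      simpa only [hend] using this
  · refine hlow.imp_right fun h0 => ?_
    have := h.radialMoment_sq P hc0 hB ht2
    rw [h0, hm] at this
    linarith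

/-- The integral of a radial function along a geodesic segment, as an integral over radii. The
segment is a full chord unless it runs between the two boundary components. -/
theorem integral_radius {p : ℝ} (hp : 0 ≤ p) (hm : momentumSq c (γ 0) (v 0) = p ^ 2)
    {f : ℝ → ℝ} (hf : ContinuousOn (fun t => f ‖γ t‖) (Icc 0 T)) :
    ∫ t in (0 : ℝ)..T, f ‖γ t‖ = (if 0 < R ∧ p ≤ ρ R then 1 else 2) *
      ∫ s in Ioc R 1, f s * ρ s / (c s * √(ρ s ^ 2 - p ^ 2)) := by
  have hT := h.length_pos
  have h0m : (0 : ℝ) ∈ Icc 0 T := ⟨le_rfl, hT.le⟩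
  have hTm : T ∈ Icc 0 T := ⟨hT.le, le_rfl⟩
  set z : ℝ → ℝ := fun t => radialMoment c (γ t) (v t) with hz
  have hzm : StrictMonoOn z (Icc 0 T) := h.radialMoment_strictMonoOn P hc0 hB
  have hzc : ContinuousOn z (Icc 0 T) := fun t ht =>
    (h.hasDeriv_radialMoment P hc0 hB ht).continuousWithinAt
  have hzsq : ∀ t ∈ Icc 0 T, z t ^ 2 = ρ ‖γ t‖ ^ 2 - p ^ 2 := fun t ht => by
    rw [← hm]; exact h.radialMoment_sq P hc0 hB ht
  have key : ∀ t₁ t₂ : ℝ, 0 ≤ t₁ → t₁ ≤ t₂ → t₂ ≤ T →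
      ∫ t in t₁..t₂, f ‖γ t‖ = ∫ t in Ioo t₁ t₂, f ‖γ t‖ := fun t₁ t₂ _ h12 _ => by
    rw [intervalIntegral.integral_of_le h12, integral_Ioc_eq_integral_Ioo]
  have hb0 := hB _ h.start_mem
  have hbT := hB _ h.end_mem
  have hρ0 := P.ρ_nonneg (h.norm_mem P hB h0m)
  have hρT := P.ρ_nonneg (h.norm_mem P hB hTm)
  split_ifs with hcase
  · obtain ⟨hRp, hpR⟩ := hcase
    have hz0 : ∀ t ∈ Ioo 0 T, z t ≠ 0 := fun t ht h0 => by
      have h1 := hzsq t (Ioo_subset_Icc_self ht)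
      rw [h0] at h1
      have h2 : R < ‖γ t‖ := (h.interior t ht).1.resolve_right hRp.ne'
      have h3 := P.ρ_lt.2 h2
      nlinarith [P.ρ_R_nonneg]
    rw [one_mul, key 0 T le_rfl hT.le le_rfl]
    by_cases hneg : ∃ t ∈ Ioo 0 T, z t < 0
    · obtain ⟨a, ha, haz⟩ := hneg
      have hall : ∀ t ∈ Ioo 0 T, z t < 0 := fun t ht => by
        by_contra hcon
        have hsub : uIcc a t ⊆ Ioo 0 T := (ordConnected_Ioo).uIcc_subset ha ht
        have := intermediate_value_uIcc (hzc.mono (hsub.trans Ioo_subset_Icc_self))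
        obtain ⟨b, hb, hb0⟩ := this (mem_uIcc.2 (Or.inl ⟨haz.le, not_lt.1 hcon⟩))
        exact hz0 b (hsub hb) hb0
      have hz0T : z 0 < 0 := (hzm h0m (Ioo_subset_Icc_self ha) ha.1).trans haz
      have hzT0 : z T ≤ 0 := by
        by_contra hcon
        have := intermediate_value_Ioo hT.le hzc
        obtain ⟨b, hb, hb0⟩ := this ⟨hz0T, not_le.1 hcon⟩
        exact hz0 b hb hb0
      have hlt : z T ^ 2 < z 0 ^ 2 := by nlinarith [hzm h0m hTm hT]
      rw [hzsq T hTm, hzsq 0 h0m] at hlt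
      have hrr : ‖γ T‖ < ‖γ 0‖ := P.ρ_lt.1 (by nlinarith)
      have e0 : ‖γ 0‖ = 1 := by
        rcases hb0 with e | e
        · exact e
        · exact absurd hrr (not_lt.2 (e.2 ▸ (h.norm_mem P hB hTm).1))
      have eT : ‖γ T‖ = R := by
        rcases hbT with e | e
        · rw [e, e0] at hrr; exact absurd hrr (lt_irrefl _)
        · exact e.2
      exact h.setIntegral_radius_ingoing P hc0 hB hm le_rfl hT le_rfl hall e0 (Or.inl eT) f
    · push Not at hneg
      have hall : ∀ t ∈ Ioo 0 T, 0 < z t := fun t ht => lt_of_le_of_ne (hneg t ht) (hz0 t ht).symm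
      have hz0' : 0 ≤ z 0 := by
        by_contra hcon
        have hzT : 0 < z T := (hall (T / 2) ⟨by linarith, by linarith⟩).trans
          (hzm ⟨by linarith, by linarith⟩ hTm (by linarith))
        have := intermediate_value_Ioo hT.le hzc
        obtain ⟨b, hb, hb0⟩ := this ⟨not_le.1 hcon, hzT⟩
        exact hz0 b hb hb0
      have hlt : z 0 ^ 2 < z T ^ 2 := by nlinarith [hzm h0m hTm hT]
      rw [hzsq T hTm, hzsq 0 h0m] at hlt
      have hrr : ‖γ 0‖ < ‖γ T‖ := P.ρ_lt.1 (by nlinarith)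
      have eT : ‖γ T‖ = 1 := by
        rcases hbT with e | e
        · exact e
        · exact absurd hrr (not_lt.2 (e.2 ▸ (h.norm_mem P hB h0m).1))
      have e0 : ‖γ 0‖ = R := by
        rcases hb0 with e | e
        · rw [e, eT] at hrr; exact absurd hrr (lt_irrefl _)
        · exact e.2
      exact h.setIntegral_radius_outgoing P hc0 hB hm le_rfl hT le_rfl hall eT (Or.inl e0) f
  · have hout : ∀ t ∈ Icc 0 T, γ t ∈ B → ‖γ t‖ = 1 := fun t ht hb => by
      rcases hB _ hb with e | e
      · exact e
      · exfalso
        apply hcase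
        refine ⟨e.1, ?_⟩
        have h1 := hzsq t ht
        rw [e.2] at h1
        exact abs_le_of_sq_le_sq' (by nlinarith [sq_nonneg (z t)]) P.ρ_R_nonneg |>.2
    have e0 := hout 0 h0m h.start_mem
    have eT := hout T hTm h.end_mem
    have hsq : z 0 ^ 2 = z T ^ 2 := by rw [hzsq 0 h0m, hzsq T hTm, e0, eT]
    have hlt : z 0 < z T := hzm h0m hTm hT
    have hz00 : z 0 < 0 := by nlinarith
    have hzT0 : 0 < z T := by nlinarith
    obtain ⟨a, ha, haz⟩ := intermediate_value_Ioo hT.le hzc ⟨hz00, hzT0⟩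
    have haI := Ioo_subset_Icc_self ha
    rw [← intervalIntegral.integral_add_adjacent_intervals (b := a)
      ((hf.mono (Icc_subset_Icc_right ha.2.le)).intervalIntegrable_of_Icc ha.1.le)
      ((hf.mono (Icc_subset_Icc_left ha.1.le)).intervalIntegrable_of_Icc ha.2.le),
      key 0 a le_rfl ha.1.le ha.2.le, key a T ha.1.le ha.2.le le_rfl,
      h.setIntegral_radius_ingoing P hc0 hB hm le_rfl ha.1 ha.2.le
        (fun t ht => by
          have := hzm ⟨ht.1.le, ht.2.le.trans ha.2.le⟩ haI ht.2
          rwa [haz] at this) e0 (Or.inr haz) f,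
      h.setIntegral_radius_outgoing P hc0 hB hm ha.1.le ha.2 le_rfl
        (fun t ht => by
          have := hzm haI ⟨ha.1.le.trans ht.1.le, ht.2.le⟩ ht.1
          rwa [haz] at this) eT (Or.inr haz) f]
    ring

/-- The length of a geodesic segment in terms of its angular momentum. -/
theorem length_eq {p : ℝ} (hp : 0 ≤ p) (hm : momentumSq c (γ 0) (v 0) = p ^ 2) :
    T = (if 0 < R ∧ p ≤ ρ R then 1 else 2) * halfLength ρ R p := by
  have h1 := h.integral_radius P hc0 hB hp hm (f := fun _ => 1) continuousOn_const
  simp only [intervalIntegral.integral_const, sub_zero, smul_eq_mul, mul_one] at h1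
  rw [h1]
  congr 1
  refine setIntegral_congr_fun measurableSet_Ioc fun s hs => ?_
  have hsI : s ∈ Icc R 1 := ⟨hs.1.le, hs.2⟩
  have hs0 : 0 < s := P.R_nonneg.trans_lt hs.1
  have hρ := P.ρ_pos hsI hs0
  rw [P.c_eq hsI hs0]
  field_simp

/-- The angle swept by a geodesic segment in terms of its angular momentum. -/
theorem angle_eq {p : ℝ} (hp : 0 < p) (hm : momentumSq c (γ 0) (v 0) = p ^ 2) :
    ∫ t in (0 : ℝ)..T, p * c ‖γ t‖ ^ 2 / ‖γ t‖ ^ 2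
      = (if 0 < R ∧ p ≤ ρ R then 1 else 2) * halfAngle ρ R p := by
  have hcont : ContinuousOn (fun t => p * c ‖γ t‖ ^ 2 / ‖γ t‖ ^ 2) (Icc 0 T) := by
    have h2 : ContinuousOn (fun t => c ‖γ t‖) (Icc 0 T) := fun t ht =>
      (h.hasDeriv_speed P hc0 hB ht).continuousWithinAt
    refine (continuousOn_const.mul (h2.pow 2)).div ((h.norm_continuousOn).pow 2)
      fun t ht => ?_
    exact pow_ne_zero _ (norm_ne_zero_iff.2 (h.ne_zero P hc0 hB hp hm ht))
  rw [h.integral_radius P hc0 hB hp.le hm (f := fun r => p * c r ^ 2 / r ^ 2) hcont]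
  congr 1
  refine setIntegral_congr_fun measurableSet_Ioc fun s hs => ?_
  have hsI : s ∈ Icc R 1 := ⟨hs.1.le, hs.2⟩
  have hs0 : 0 < s := P.R_nonneg.trans_lt hs.1
  have hρ := P.ρ_pos hsI hs0
  rw [P.c_eq hsI hs0]
  field_simp

end IsGeodesicSegment

end Integrals

section Rays

variable {R : ℝ} {c ρ ρ' σ Q : ℝ → ℝ} {n : ℕ} {B : Set (EuclideanSpace ℝ (Fin n))}

/-- The lengths of periodic broken rays are multiples of the half lengths of chords whose half
angle is commensurable with `2π`. -/
theorem exists_momentum_of_mem_brokenRayLengths (P : Profile R c ρ ρ' σ Q)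
    (hc0 : R = 0 → derivWithin c (Icc R 1) 0 = 0)
    (hB : ∀ x ∈ B, ‖x‖ = 1 ∨ (0 < R ∧ ‖x‖ = R)) {l : ℝ} (hl : l ∈ brokenRayLengths R c B) :
    ∃ (K : ℕ) (p : ℝ), 0 ≤ p ∧ l = K * halfLength ρ R p ∧
      (0 < p → Real.cos (K * halfAngle ρ R p) = 1) := by
  obtain ⟨k, T, γ, v, h, rfl⟩ := hl
  have hk : 0 < k := h.one_le
  have hB0 : ∀ x ∈ B, x ≠ 0 := fun x hx h0 => by
    rcases hB x hx with e | e <;> rw [h0, norm_zero] at e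
    · exact zero_ne_one e
    · exact e.1.ne e.2
  have hCpos : ∀ x ∈ B, 0 < c ‖x‖ := fun x hx => by
    rcases hB x hx with e | e
    · rw [e]; exact P.c_pos _ P.mem_one
    · rw [e.2]; exact P.c_pos _ P.mem_R
  have hs0 := h.segment 0 hk
  set p : ℝ := √(momentumSq c (γ 0 0) (v 0 0)) with hp
  have hp0 : 0 ≤ p := Real.sqrt_nonneg _
  have hpsq : momentumSq c (γ 0 0) (v 0 0) = p ^ 2 :=
    (Real.sq_sqrt (momentumSq_nonneg (hCpos _ hs0.start_mem)
      (hs0.unit_speed 0 ⟨le_rfl, hs0.length_pos.le⟩))).symm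
  have hTm : ∀ i < k, T i ∈ Icc 0 (T i) := fun i hi => ⟨(h.segment i hi).length_pos.le, le_rfl⟩
  have hstep : ∀ i, i + 1 < k → ∀ q,
      momentumSq c (γ (i + 1) 0) (v (i + 1) 0) = momentumSq c (γ i (T i)) (v i (T i)) ∧
      angularUnit c q (γ (i + 1) 0) (v (i + 1) 0) = angularUnit c q (γ i (T i)) (v i (T i)) := by
    intro i hi q
    have hm := (h.segment i (by omega)).end_mem
    rw [h.concat i hi, h.reflect i hi]
    refine ⟨momentumSq_reflect (hB0 _ hm), ?_⟩
    unfold angularUnit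
    rw [transverse_reflect (hCpos _ hm) (hB0 _ hm)]
  have hmom : ∀ i, i < k → momentumSq c (γ i 0) (v i 0) = p ^ 2 := by
    intro i
    induction i with
    | zero => exact fun _ => hpsq
    | succ i ih =>
      intro hi
      have hi' : i < k := by omega
      rw [(hstep i hi p).1, (h.segment i hi').momentumSq_eq P hc0 hB (hTm i hi'), ih hi']
  set m : ℕ := if 0 < R ∧ p ≤ ρ R then 1 else 2 with hmdef
  have hmcast : (m : ℝ) = if 0 < R ∧ p ≤ ρ R then 1 else 2 := by
    rw [hmdef]; split_ifs <;> simp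
  refine ⟨k * m, p, hp0, ?_, fun hpp => ?_⟩
  · have : ∀ i ∈ Finset.range k, T i = m * halfLength ρ R p := fun i hi => by
      rw [hmcast]
      exact (h.segment i (Finset.mem_range.1 hi)).length_eq P hc0 hB hp0
        (hmom i (Finset.mem_range.1 hi))
    rw [Finset.sum_congr rfl this, Finset.sum_const, Finset.card_range]
    simp only [nsmul_eq_mul, Nat.cast_mul]
    ring
  · set φ : ℝ := m * halfAngle ρ R p with hφ
    have hrot : ∀ i (hi : i < k),
        radialUnit (γ i (T i)) = Real.cos φ • radialUnit (γ i 0)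
          + Real.sin φ • angularUnit c p (γ i 0) (v i 0) ∧
        angularUnit c p (γ i (T i)) (v i (T i)) = -Real.sin φ • radialUnit (γ i 0)
          + Real.cos φ • angularUnit c p (γ i 0) (v i 0) := fun i hi => by
      refine (h.segment i hi).frame_rotation P hc0 hB hpp (hmom i hi) ?_
      rw [(h.segment i hi).angle_eq P hc0 hB hpp (hmom i hi), hφ, hmcast]
    set X := radialUnit (γ 0 0) with hX
    set Y := angularUnit c p (γ 0 0) (v 0 0) with hY
    have hframe : ∀ i, i < k →
        radialUnit (γ i (T i)) = Real.cos ((i + 1 : ℕ) * φ) • X + Real.sin ((i + 1 : ℕ) * φ) • Y ∧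
        angularUnit c p (γ i (T i)) (v i (T i))
          = -Real.sin ((i + 1 : ℕ) * φ) • X + Real.cos ((i + 1 : ℕ) * φ) • Y := by
      intro i
      induction i with
      | zero =>
        intro hi
        simpa using hrot 0 hi
      | succ i ih =>
        intro hi
        have hi' : i < k := by omega
        obtain ⟨h1, h2⟩ := ih hi'
        obtain ⟨h3, h4⟩ := hrot (i + 1) hi
        rw [(hstep i hi p).2, h.concat i hi, h1, h2] at h3 h4
        have e : ((i + 1 + 1 : ℕ) : ℝ) * φ = ((i + 1 : ℕ) : ℝ) * φ + φ := by push_cast; ring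
        rw [h3, h4, e, Real.cos_add, Real.sin_add]
        constructor <;> module
    obtain ⟨h1, -⟩ := hframe (k - 1) (by omega)
    rw [h.closed, Nat.sub_add_cancel h.one_le] at h1
    have hx0 : γ 0 0 ≠ 0 := hB0 _ hs0.start_mem
    have hX1 : inner ℝ X X = 1 := by
      rw [real_inner_self_eq_norm_sq, hX, radialUnit, norm_smul]
      have := norm_pos_iff.2 hx0
      simp only [norm_div, norm_one, norm_norm]
      field_simp
    have hXY : inner ℝ X Y = 0 := by
      rw [hX, hY, radialUnit, angularUnit, inner_smul_left, inner_smul_right, inner_transverse]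
      simp
    have h2 := congrArg (fun w => inner ℝ X w) h1
    simp only [inner_add_right, inner_smul_right] at h2
    rw [← hX, hX1, hXY] at h2
    have e : ((k * m : ℕ) : ℝ) * halfAngle ρ R p = k * φ := by rw [hφ]; push_cast; ring
    rw [e]
    linarith

lemma IsGeodesicSegment.mono {B' : Set (EuclideanSpace ℝ (Fin n))} (hBB : B ⊆ B') {T : ℝ}
    {γ v : ℝ → EuclideanSpace ℝ (Fin n)} (h : IsGeodesicSegment R c B T γ v) :
    IsGeodesicSegment R c B' T γ v :=
  ⟨h.length_pos, h.interior, hBB h.start_mem, hBB h.end_mem, h.hasDeriv, h.unit_speed, h.geodesic⟩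

lemma lsp_subset_lsp' (n : ℕ) (R : ℝ) (c : ℝ → ℝ) : lsp n R c ⊆ lsp' n R c := by
  rintro l ⟨k, T, γ, v, h, rfl⟩
  exact ⟨k, T, γ, v, ⟨h.one_le, fun i hi => (h.segment i hi).mono subset_union_left, h.concat,
    h.reflect, h.closed⟩, rfl⟩

end Rays

/-- The maximal geodesic of angular momentum `p` in polar coordinates `(r, θ)`, parametrised by arc
length from its midpoint; `z` is its radial moment and `τ` the inverse function of `z`. -/
structure Chord (R : ℝ) (ρ σ Q : ℝ → ℝ) (p : ℝ) (τ z r θ : ℝ → ℝ) : Prop where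
  lt_p : ρ R < p
  p_lt : p < ρ 1
  τ_eq : ∀ w, τ w = ∫ x in (0 : ℝ)..w, Q √(p ^ 2 + x ^ 2)
  z_τ : ∀ w, z (τ w) = w
  τ_z : ∀ t, τ (z t) = t
  z_deriv : ∀ t, HasDerivAt z (1 / Q √(p ^ 2 + z t ^ 2)) t
  r_eq : ∀ t, r t = σ √(p ^ 2 + z t ^ 2)
  θ_zero : θ 0 = 0
  θ_deriv : ∀ t, HasDerivAt θ (p / (p ^ 2 + z t ^ 2)) t

/-- The arc length from the midpoint to the end of the chord. -/
noncomputable def chordHalf (ρ : ℝ → ℝ) (p : ℝ) (τ : ℝ → ℝ) : ℝ := τ √(ρ 1 ^ 2 - p ^ 2)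

/-- The chord as a curve in the complex plane. -/
noncomputable def chordCurve (r θ : ℝ → ℝ) (t : ℝ) : ℂ := r t * Complex.exp (θ t * Complex.I)

/-- The velocity of the chord. -/
noncomputable def chordVelocity (p : ℝ) (z r θ : ℝ → ℝ) (t : ℝ) : ℂ :=
  (z t - p * Complex.I)⁻¹ * chordCurve r θ t

section

variable {R : ℝ} {c ρ ρ' σ Q : ℝ → ℝ} {p : ℝ} {τ z r θ : ℝ → ℝ}

theorem exists_chord (P : Profile R c ρ ρ' σ Q) (h1 : ρ R < p) (h2 : p < ρ 1) :
    ∃ τ z r θ, Chord R ρ σ Q p τ z r θ := by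
  have hp : 0 < p := P.ρ_R_nonneg.trans_lt h1
  obtain ⟨κ, hκ, hQ⟩ := P.Q_low
  have hcont : Continuous fun x : ℝ => Q √(p ^ 2 + x ^ 2) := P.Q_cont.comp (by fun_prop)
  obtain ⟨z, hz1, hz2, hz3⟩ := exists_hasDerivAt_inverse hκ
    (f := fun w => ∫ x in (0 : ℝ)..w, Q √(p ^ 2 + x ^ 2))
    (fun w => (hcont.integral_hasStrictDerivAt 0 w).hasDerivAt) (fun w => hQ _)
  have hzc : Continuous z := continuous_iff_continuousAt.2 fun t => (hz3 t).continuousAt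
  have hcont2 : Continuous fun t => p / (p ^ 2 + z t ^ 2) :=
    continuous_const.div (by fun_prop) fun t => by positivity
  exact ⟨_, z, _, fun t => ∫ s in (0 : ℝ)..t, p / (p ^ 2 + z s ^ 2), h1, h2, fun w => rfl, hz1, hz2,
    hz3, fun t => rfl, intervalIntegral.integral_same,
    fun t => (hcont2.integral_hasStrictDerivAt 0 t).hasDerivAt⟩

namespace Chord

variable (P : Profile R c ρ ρ' σ Q) (C : Chord R ρ σ Q p τ z r θ)
include P C

lemma p_pos : 0 < p := P.ρ_R_nonneg.trans_lt C.lt_p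

lemma Z_pos : 0 < √(ρ 1 ^ 2 - p ^ 2) := by
  apply Real.sqrt_pos.2
  have := C.p_pos P
  nlinarith [C.p_lt]

lemma z_strictMono : StrictMono z := strictMono_of_deriv_pos fun t => by
  rw [(C.z_deriv t).deriv]
  exact one_div_pos.2 (P.Q_pos _)

lemma integrand_continuous : Continuous fun x : ℝ => Q √(p ^ 2 + x ^ 2) :=
  P.Q_cont.comp (by fun_prop)

lemma τ_deriv (w : ℝ) : HasDerivAt τ (Q √(p ^ 2 + w ^ 2)) w := by
  have e : τ = fun w => ∫ x in (0 : ℝ)..w, Q √(p ^ 2 + x ^ 2) := funext C.τ_eq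
  rw [e]
  exact ((C.integrand_continuous P).integral_hasStrictDerivAt 0 w).hasDerivAt

lemma τ_neg (w : ℝ) : τ (-w) = -τ w := by
  rw [C.τ_eq, C.τ_eq]
  have := intervalIntegral.integral_comp_neg (a := 0) (b := w)
    (f := fun x : ℝ => Q √(p ^ 2 + x ^ 2))
  simp only [neg_sq, neg_zero] at this
  rw [this, intervalIntegral.integral_symm]

lemma z_half : z (chordHalf ρ p τ) = √(ρ 1 ^ 2 - p ^ 2) := C.z_τ _

lemma z_neg_half : z (-chordHalf ρ p τ) = -√(ρ 1 ^ 2 - p ^ 2) := by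
  unfold chordHalf
  rw [← C.τ_neg P, C.z_τ]

lemma z_zero : z 0 = 0 := by
  have h0 : τ 0 = 0 := by rw [C.τ_eq]; exact intervalIntegral.integral_same
  have := C.z_τ 0
  rwa [h0] at this

lemma half_pos : 0 < chordHalf ρ p τ := by
  rw [← (C.z_strictMono P).lt_iff_lt, C.z_half P, C.z_zero P]
  exact C.Z_pos P

lemma ρ_r (t : ℝ) : ρ (r t) = √(p ^ 2 + z t ^ 2) := by rw [C.r_eq, P.ρ_σ]

lemma ρ_r_sq (t : ℝ) : ρ (r t) ^ 2 = p ^ 2 + z t ^ 2 := by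
  rw [C.ρ_r P, Real.sq_sqrt (by positivity)]

lemma le_r (t : ℝ) : σ p ≤ r t := by
  rw [← P.ρ_le, P.ρ_σ, C.ρ_r P]
  apply Real.le_sqrt_of_sq_le
  nlinarith [sq_nonneg (z t)]

lemma R_lt_σp : R < σ p := by
  rw [← P.ρ_lt, P.ρ_σ]; exact C.lt_p

lemma R_lt_r (t : ℝ) : R < r t := (C.R_lt_σp P).trans_le (C.le_r P t)

lemma r_pos (t : ℝ) : 0 < r t := P.R_nonneg.trans_lt (C.R_lt_r P t)

lemma r_zero : r 0 = σ p := by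
  rw [C.r_eq, C.z_zero P]
  simp [Real.sqrt_sq (C.p_pos P).le]

lemma sq_Z : √(ρ 1 ^ 2 - p ^ 2) ^ 2 = ρ 1 ^ 2 - p ^ 2 :=
  Real.sq_sqrt (Real.sqrt_pos.1 (C.Z_pos P)).le

lemma r_of_sq_eq {t : ℝ} (h : z t ^ 2 = ρ 1 ^ 2 - p ^ 2) : r t = 1 := by
  rw [C.r_eq, h]
  simp [Real.sqrt_sq P.ρ_one_pos.le, P.σ_ρ]

lemma r_half : r (chordHalf ρ p τ) = 1 := C.r_of_sq_eq P (by rw [C.z_half P, C.sq_Z P])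

lemma r_neg_half : r (-chordHalf ρ p τ) = 1 :=
  C.r_of_sq_eq P (by rw [C.z_neg_half P, neg_sq, C.sq_Z P])

lemma r_le {t : ℝ} (h : t ∈ Icc (-chordHalf ρ p τ) (chordHalf ρ p τ)) : r t ≤ 1 := by
  rw [← P.ρ_le, C.ρ_r P]
  apply Real.sqrt_le_iff.2 ⟨P.ρ_one_pos.le, ?_⟩
  have h1 := (C.z_strictMono P).monotone h.1
  have h2 := (C.z_strictMono P).monotone h.2
  rw [C.z_half P] at h2
  rw [C.z_neg_half P] at h1
  have := sq_le_sq' h1 h2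
  rw [C.sq_Z P] at this
  linarith

lemma r_lt {t : ℝ} (h : t ∈ Ioo (-chordHalf ρ p τ) (chordHalf ρ p τ)) : r t < 1 := by
  rw [← P.ρ_lt, C.ρ_r P]
  apply (Real.sqrt_lt' P.ρ_one_pos).2
  have h1 := (C.z_strictMono P) h.1
  have h2 := (C.z_strictMono P) h.2
  rw [C.z_half P] at h2
  rw [C.z_neg_half P] at h1
  have := sq_lt_sq' h1 h2
  rw [C.sq_Z P] at this
  linarith

lemma r_mem {t : ℝ} (h : t ∈ Icc (-chordHalf ρ p τ) (chordHalf ρ p τ)) : r t ∈ Icc R 1 :=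
  ⟨(C.R_lt_r P t).le, C.r_le P h⟩

lemma sqrt_pos (t : ℝ) : 0 < √(p ^ 2 + z t ^ 2) := by
  have := C.p_pos P
  positivity

lemma r_deriv {t : ℝ} (h : t ∈ Icc (-chordHalf ρ p τ) (chordHalf ρ p τ)) :
    HasDerivAt r (z t / (p ^ 2 + z t ^ 2) * r t) t := by
  have hp := C.p_pos P
  have hpos : 0 < p ^ 2 + z t ^ 2 := by positivity
  have h1 : HasDerivAt (fun t => √(p ^ 2 + z t ^ 2)) _ t :=
    (((C.z_deriv t).pow 2).const_add (p ^ 2)).sqrt hpos.ne'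
  have h2 := (P.σ_deriv _).comp t h1
  have h3 := h2.congr_of_eventuallyEq (Eventually.of_forall C.r_eq)
  convert! h3 using 1
  rw [← C.r_eq, ← C.ρ_r P, P.Q_eq _ (C.r_mem P h)]
  have hC := P.c_eq (C.r_mem P h) (C.r_pos P t)
  have hr := C.r_pos P t
  have hρ := P.ρ_pos (C.r_mem P h) hr
  have hρ' := P.ρ'_pos (r t)
  rw [← C.ρ_r_sq P, hC]
  simp only [Pi.pow_apply]
  field_simp
  rw [C.ρ_r P]
  norm_num
  ring

lemma norm_curve (t : ℝ) : ‖chordCurve r θ t‖ = r t := by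
  unfold chordCurve
  rw [norm_mul, Complex.norm_exp_ofReal_mul_I, mul_one, Complex.norm_real,
    Real.norm_of_nonneg (C.r_pos P t).le]

lemma den_ne (t : ℝ) : ((z t : ℂ) - p * Complex.I) ≠ 0 := fun h => by
  have := congrArg Complex.im h
  simp at this
  exact (C.p_pos P).ne' this

lemma inv_eq (t : ℝ) : ((z t : ℂ) - p * Complex.I)⁻¹
    = (z t + p * Complex.I) / ((p ^ 2 + z t ^ 2 : ℝ) : ℂ) := by
  have h1 := C.den_ne P t
  have hp := C.p_pos P
  have h2 : ((p ^ 2 + z t ^ 2 : ℝ) : ℂ) ≠ 0 := by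
    rw [Complex.ofReal_ne_zero]; positivity
  rw [inv_eq_one_div, div_eq_div_iff h1 h2]
  push_cast
  linear_combination (p : ℂ) ^ 2 * Complex.I_sq

lemma curve_deriv {t : ℝ} (h : t ∈ Icc (-chordHalf ρ p τ) (chordHalf ρ p τ)) :
    HasDerivAt (chordCurve r θ) (chordVelocity p z r θ t) t := by
  have h1 := (C.r_deriv P h).ofReal_comp.mul (((C.θ_deriv t).ofReal_comp.mul_const Complex.I).cexp)
  convert! h1 using 1
  unfold chordVelocity
  rw [C.inv_eq P]
  unfold chordCurve
  push_cast
  ring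

lemma norm_velocity {t : ℝ} (h : t ∈ Icc (-chordHalf ρ p τ) (chordHalf ρ p τ)) :
    ‖chordVelocity p z r θ t‖ = c (r t) := by
  have hr := C.r_pos P t
  have hρ := P.ρ_pos (C.r_mem P h) hr
  unfold chordVelocity
  rw [norm_mul, norm_inv, C.norm_curve P, P.c_eq (C.r_mem P h) hr, div_eq_inv_mul]
  congr 2
  rw [C.ρ_r P, Complex.norm_def]
  congr 1
  rw [Complex.normSq_apply]
  simp
  ring

lemma velocity_deriv {t : ℝ} (h : t ∈ Icc (-chordHalf ρ p τ) (chordHalf ρ p τ)) :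
    HasDerivAt (chordVelocity p z r θ)
      (((2 * (derivWithin c (Icc R 1) (r t) / r t * (z t / (p ^ 2 + z t ^ 2) * r t ^ 2) / c (r t))
        : ℝ) : ℂ) * chordVelocity p z r θ t
        - ((c (r t) ^ 2 / c (r t) * (derivWithin c (Icc R 1) (r t) / r t) : ℝ) : ℂ)
          * chordCurve r θ t) t := by
  have h1 := (((C.z_deriv t).ofReal_comp.sub_const (p * Complex.I)).inv (C.den_ne P t)).mul
    (C.curve_deriv P h)
  convert! h1 using 1
  have hr := C.r_pos P t
  have hm := C.r_mem P h
  have hp := C.p_pos P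
  have hpos : (p ^ 2 + z t ^ 2) ≠ 0 := by positivity
  have hC := P.c_pos _ hm
  have hρ' := P.ρ'_eq _ hm
  have hρ'p := P.ρ'_pos (r t)
  have hQ : 1 / Q √(p ^ 2 + z t ^ 2) = 1 - r t * derivWithin c (Icc R 1) (r t) / c (r t) := by
    rw [← C.ρ_r P, P.Q_eq _ hm, one_div_one_div, hρ']
    field_simp
  have hsq : (p ^ 2 + z t ^ 2) * c (r t) ^ 2 = r t ^ 2 := by
    rw [← C.ρ_r_sq P, P.ρ_eq _ hm]; field_simp
  have e1 : derivWithin c (Icc R 1) (r t) / r t * (z t / (p ^ 2 + z t ^ 2) * r t ^ 2) / c (r t)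
      = (r t * derivWithin c (Icc R 1) (r t) / c (r t)) * (z t / (p ^ 2 + z t ^ 2)) := by
    field_simp
  have e2 : c (r t) ^ 2 / c (r t) * (derivWithin c (Icc R 1) (r t) / r t)
      = (r t * derivWithin c (Icc R 1) (r t) / c (r t)) * (1 / (p ^ 2 + z t ^ 2)) := by
    have : (p ^ 2 + z t ^ 2) = r t ^ 2 / c (r t) ^ 2 := by
      rw [eq_div_iff (by positivity)]; exact hsq
    rw [this]
    field_simp
  have hden := C.den_ne P t
  rw [hQ, e1, e2]
  unfold chordVelocity
  simp only [Pi.inv_apply]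
  set G := r t * derivWithin c (Icc R 1) (r t) / c (r t)
  set ξ := chordCurve r θ t
  have hquad : ((z t - p * Complex.I : ℂ)⁻¹) ^ 2
      = 2 * ((z t / (p ^ 2 + z t ^ 2) : ℝ) : ℂ) * (z t - p * Complex.I)⁻¹
        - ((1 / (p ^ 2 + z t ^ 2) : ℝ) : ℂ) := by
    rw [C.inv_eq P]
    have h2 : ((p ^ 2 + z t ^ 2 : ℝ) : ℂ) ≠ 0 := by exact_mod_cast hpos
    push_cast at h2 ⊢
    field_simp
    linear_combination (p : ℂ) ^ 2 * Complex.I_sq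
  have hd : ∀ w : ℂ, -w / ((z t : ℂ) - p * Complex.I) ^ 2
      = -w * ((z t - p * Complex.I : ℂ)⁻¹) ^ 2 := fun w => by
    rw [inv_pow, div_eq_mul_inv]
  rw [hd]
  push_cast at hquad ⊢
  linear_combination ((-G : ℂ) * ξ) * hquad

lemma inner_curve {n : ℕ} (ι : ℂ →ₗᵢ[ℝ] EuclideanSpace ℝ (Fin n)) {ω : ℂ} (hω : ‖ω‖ = 1) (t : ℝ) :
    inner ℝ (ι (ω * chordCurve r θ t)) (ι (ω * chordVelocity p z r θ t))
      = z t / (p ^ 2 + z t ^ 2) * r t ^ 2 := by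
  rw [ι.inner_map_map, Complex.inner]
  unfold chordVelocity
  rw [C.inv_eq P]
  have e1 : (starRingEnd ℂ) (ω * chordCurve r θ t) * (ω * ((z t + p * Complex.I)
      / ((p ^ 2 + z t ^ 2 : ℝ) : ℂ) * chordCurve r θ t))
      = ((Complex.normSq ω * Complex.normSq (chordCurve r θ t)
        / (p ^ 2 + z t ^ 2) : ℝ) : ℂ) * (z t + p * Complex.I) := by
    push_cast
    rw [Complex.normSq_eq_conj_mul_self, Complex.normSq_eq_conj_mul_self, map_mul]
    ring
  rw [mul_comm, e1, Complex.re_ofReal_mul, Complex.normSq_eq_norm_sq, Complex.normSq_eq_norm_sq, hω,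
    C.norm_curve P]
  simp
  ring

lemma geodesicSegment {n : ℕ} (ι : ℂ →ₗᵢ[ℝ] EuclideanSpace ℝ (Fin n)) {ω : ℂ} (hω : ‖ω‖ = 1) :
    IsGeodesicSegment R c (outerBoundary n) (2 * chordHalf ρ p τ)
      (fun t => ι (ω * chordCurve r θ (t - chordHalf ρ p τ)))
      (fun t => ι (ω * chordVelocity p z r θ (t - chordHalf ρ p τ))) := by
  set h := chordHalf ρ p τ with hh
  have hpos : 0 < h := C.half_pos P
  have hI : ∀ t ∈ Icc 0 (2 * h), t - h ∈ Icc (-h) h := fun t ht =>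
    ⟨by linarith [ht.1], by linarith [ht.2]⟩
  have hn : ∀ t, ‖ι (ω * chordCurve r θ (t - h))‖ = r (t - h) := fun t => by
    rw [ι.norm_map, norm_mul, hω, one_mul, C.norm_curve P]
  have hnv : ∀ t ∈ Icc 0 (2 * h), ‖ι (ω * chordVelocity p z r θ (t - h))‖ = c (r (t - h)) :=
    fun t ht => by rw [ι.norm_map, norm_mul, hω, one_mul, C.norm_velocity P (hI t ht)]
  have hlift : ∀ (f : ℝ → ℂ) (f' : ℂ) (t : ℝ), HasDerivAt f f' (t - h) →
      HasDerivAt (fun t => ι (ω * f (t - h))) (ι (ω * f')) t := fun f f' t hf =>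
    ι.toContinuousLinearMap.hasFDerivAt.comp_hasDerivAt t
      ((hf.comp_sub_const t h).const_mul ω)
  refine ⟨by linarith, fun t ht => ?_, ?_, ?_, fun t ht => ?_, fun t ht => ?_, fun t ht => ?_⟩
  · refine ⟨Or.inl ?_, ?_⟩
    · rw [hn]; exact C.R_lt_r P _
    · rw [hn]; exact C.r_lt P ⟨by linarith [ht.1], by linarith [ht.2]⟩
  · simp only [outerBoundary, mem_sphere_zero_iff_norm]
    rw [hn, zero_sub]; exact C.r_neg_half P
  · simp only [outerBoundary, mem_sphere_zero_iff_norm]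
    rw [hn, show 2 * h - h = h by ring]; exact C.r_half P
  · exact (hlift _ _ t (C.curve_deriv P (hI t ht))).hasDerivWithinAt
  · rw [hn, hnv t ht]
  · have h1 := (hlift _ _ t (C.velocity_deriv P (hI t ht))).hasDerivWithinAt (s := Icc 0 (2 * h))
    convert! h1 using 1
    have hin := C.inner_curve P ι hω (t - h)
    simp only [radialGradient, inner_smul_left, conj_trivial, hin, hn, hnv t ht, mul_sub, map_sub,
      smul_smul]
    rw [show ∀ (a : ℝ) (x : ℂ), ι (ω * ((a : ℂ) * x)) = a • ι (ω * x) from fun a x => by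
        rw [← ι.map_smul]; congr 1; rw [Complex.real_smul]; ring,
      show ∀ (a : ℝ) (x : ℂ), ι (ω * ((a : ℂ) * x)) = a • ι (ω * x) from fun a x => by
        rw [← ι.map_smul]; congr 1; rw [Complex.real_smul]; ring]

end Chord

end

/-- The plane embeds isometrically in every Euclidean space of dimension at least two. -/
lemma exists_complex_isometry {n : ℕ} (hn : 2 ≤ n) :
    Nonempty (ℂ →ₗᵢ[ℝ] EuclideanSpace ℝ (Fin n)) := by
  let w : Fin 2 → EuclideanSpace ℝ (Fin n) := fun i => EuclideanSpace.single (Fin.castLE hn i) 1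
  have hw : Orthonormal ℝ w := by
    have := (EuclideanSpace.basisFun (Fin n) ℝ).orthonormal.comp (Fin.castLE hn)
      (Fin.castLE_injective hn)
    convert! this using 1
    funext i
    simp [w, EuclideanSpace.basisFun_apply]
  let b := Complex.orthonormalBasisOneI
  refine ⟨(b.toBasis.constr ℝ w).isometryOfOrthonormal (v := b.toBasis) ?_ ?_⟩
  · simp
  · convert! hw using 1
    funext i
    exact b.toBasis.constr_basis ℝ w i

section

variable {R : ℝ} {c ρ ρ' σ Q : ℝ → ℝ} {p : ℝ} {τ z r θ : ℝ → ℝ}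

lemma outerBoundary_norm (n : ℕ) (R : ℝ) :
    ∀ x ∈ outerBoundary n, ‖x‖ = 1 ∨ (0 < R ∧ ‖x‖ = R) := fun x hx => by
  left
  simpa [outerBoundary, mem_sphere_zero_iff_norm] using hx

namespace Chord

variable (P : Profile R c ρ ρ' σ Q) (C : Chord R ρ σ Q p τ z r θ)
include P C

lemma norm_mul_curve {n : ℕ} (ι : ℂ →ₗᵢ[ℝ] EuclideanSpace ℝ (Fin n)) {ω : ℂ} (hω : ‖ω‖ = 1) (t : ℝ) :
    ‖ι (ω * chordCurve r θ t)‖ = r t := by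
  rw [ι.norm_map, norm_mul, hω, one_mul, C.norm_curve P]

lemma momentumSq_curve {n : ℕ} (ι : ℂ →ₗᵢ[ℝ] EuclideanSpace ℝ (Fin n)) {ω : ℂ} (hω : ‖ω‖ = 1)
    {t : ℝ} (h : t ∈ Icc (-chordHalf ρ p τ) (chordHalf ρ p τ)) :
    momentumSq c (ι (ω * chordCurve r θ t)) (ι (ω * chordVelocity p z r θ t)) = p ^ 2 := by
  have hr := C.r_pos P t
  have hC := P.c_pos _ (C.r_mem P h)
  have h1 := C.ρ_r_sq P t
  rw [P.ρ_eq _ (C.r_mem P h)] at h1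
  have hp := C.p_pos P
  have hpos : (p ^ 2 + z t ^ 2) ≠ 0 := by positivity
  unfold momentumSq radialMoment
  rw [C.inner_curve P ι hω, C.norm_mul_curve P ι hω]
  have h2 : z t / (p ^ 2 + z t ^ 2) * r t ^ 2 / c (r t) ^ 2 = z t := by
    rw [← h1]; field_simp
  rw [h2, ← div_pow, h1]
  ring

lemma integral_r {f : ℝ → ℝ} (hf : ContinuousOn f (Icc (σ p) 1))
    (hc0 : R = 0 → derivWithin c (Icc R 1) 0 = 0) :
    ∫ t in (-chordHalf ρ p τ)..chordHalf ρ p τ, f (r t)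
      = 2 * ∫ s in Ioc R 1, f s * ρ s / (c s * √(ρ s ^ 2 - p ^ 2)) := by
  obtain ⟨ι⟩ := exists_complex_isometry (le_refl 2)
  have hω : ‖(1 : ℂ)‖ = 1 := norm_one
  have hpos := C.half_pos P
  set h := chordHalf ρ p τ with hh
  have hseg := C.geodesicSegment P ι hω
  have hcont : ContinuousOn (fun t => f ‖ι (1 * chordCurve r θ (t - h))‖) (Icc 0 (2 * h)) := by
    refine hf.comp hseg.norm_continuousOn fun t ht => ?_
    rw [C.norm_mul_curve P ι hω]
    exact ⟨C.le_r P _, C.r_le P ⟨by linarith [ht.1], by linarith [ht.2]⟩⟩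
  have h1 := hseg.integral_radius P hc0 (outerBoundary_norm 2 R) (C.p_pos P).le
    (C.momentumSq_curve P ι hω ⟨by linarith, by linarith⟩) (f := f) hcont
  rw [if_neg (fun hcon => absurd C.lt_p (not_lt.2 hcon.2))] at h1
  rw [← h1]
  simp only [C.norm_mul_curve P ι hω]
  rw [← hh, intervalIntegral.integral_comp_sub_right (fun t => f (r t))]
  congr 1 <;> ring

/-- An integral over radii with the singular chord weight, as a regular integral. -/
lemma setIntegral_radius {f : ℝ → ℝ} (hf : ContinuousOn f (Icc (σ p) 1))
    (hc0 : R = 0 → derivWithin c (Icc R 1) 0 = 0) :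
    ∫ s in Ioc R 1, f s * ρ s / (c s * √(ρ s ^ 2 - p ^ 2))
      = ∫ x in (0 : ℝ)..√(ρ 1 ^ 2 - p ^ 2),
          f (σ √(p ^ 2 + x ^ 2)) * Q √(p ^ 2 + x ^ 2) := by
  set Z := √(ρ 1 ^ 2 - p ^ 2) with hZ
  have hZp : 0 < Z := C.Z_pos P
  have h0 := C.integral_r P hf hc0
  have hmem : ∀ x ∈ Icc (-Z) Z, σ √(p ^ 2 + x ^ 2) ∈ Icc (σ p) 1 := fun x hx => by
    have e : r (τ x) = σ √(p ^ 2 + x ^ 2) := by rw [C.r_eq, C.z_τ]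
    rw [← e]
    refine ⟨C.le_r P _, C.r_le P ⟨?_, ?_⟩⟩
    · rw [← (C.z_strictMono P).le_iff_le, C.z_neg_half P, C.z_τ]; exact hx.1
    · rw [← (C.z_strictMono P).le_iff_le, C.z_half P, C.z_τ]; exact hx.2
  have hgc : ContinuousOn (fun x => f (σ √(p ^ 2 + x ^ 2)) * Q √(p ^ 2 + x ^ 2)) (Icc (-Z) Z) := by
    refine ContinuousOn.mul (hf.comp ?_ hmem) (C.integrand_continuous P).continuousOn
    exact (P.σ_cont.comp (by fun_prop)).continuousOn
  have hrc : ContinuousOn (fun t => f (r t)) (τ '' uIcc (-Z) Z) := by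
    rw [uIcc_of_le (by linarith)]
    refine hf.comp ?_ ?_
    · have : r = fun t => σ √(p ^ 2 + z t ^ 2) := funext C.r_eq
      have hzc : Continuous z := continuous_iff_continuousAt.2 fun t => (C.z_deriv t).continuousAt
      rw [this]
      exact (P.σ_cont.comp (by fun_prop)).continuousOn
    · rintro _ ⟨x, hx, rfl⟩
      rw [C.r_eq, C.z_τ]
      exact hmem x hx
  have h1 : ∫ x in (-Z)..Z, f (σ √(p ^ 2 + x ^ 2)) * Q √(p ^ 2 + x ^ 2)
      = ∫ t in (-chordHalf ρ p τ)..chordHalf ρ p τ, f (r t) := by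
    have := intervalIntegral.integral_comp_mul_deriv'' (a := -Z) (b := Z) (f := τ)
      (f' := fun x => Q √(p ^ 2 + x ^ 2)) (g := fun t => f (r t))
      (fun x _ => (C.τ_deriv P x).continuousAt.continuousWithinAt)
      (fun x _ => (C.τ_deriv P x).hasDerivWithinAt) (C.integrand_continuous P).continuousOn hrc
    rw [C.τ_neg P] at this
    unfold chordHalf
    rw [← this]
    refine intervalIntegral.integral_congr fun x _ => ?_
    simp only [Function.comp_apply]
    rw [C.r_eq, C.z_τ]
  have hsplit : ∫ x in (-Z)..Z, f (σ √(p ^ 2 + x ^ 2)) * Q √(p ^ 2 + x ^ 2)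
      = 2 * ∫ x in (0 : ℝ)..Z, f (σ √(p ^ 2 + x ^ 2)) * Q √(p ^ 2 + x ^ 2) := by
    rw [← intervalIntegral.integral_add_adjacent_intervals (b := 0)
      ((hgc.mono (Icc_subset_Icc_right hZp.le)).intervalIntegrable_of_Icc (by linarith))
      ((hgc.mono (Icc_subset_Icc_left (by linarith))).intervalIntegrable_of_Icc hZp.le)]
    have := intervalIntegral.integral_comp_neg (a := 0) (b := Z)
      (f := fun x : ℝ => f (σ √(p ^ 2 + x ^ 2)) * Q √(p ^ 2 + x ^ 2))
    simp only [neg_sq, neg_zero] at this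
    rw [← this]
    ring
  rw [h0, hsplit] at h1
  linarith

lemma half_eq (hc0 : R = 0 → derivWithin c (Icc R 1) 0 = 0) :
    chordHalf ρ p τ = halfLength ρ R p := by
  obtain ⟨ι⟩ := exists_complex_isometry (le_refl 2)
  have hω : ‖(1 : ℂ)‖ = 1 := norm_one
  have hpos := C.half_pos P
  have h1 := (C.geodesicSegment P ι hω).length_eq P hc0 (outerBoundary_norm 2 R) (C.p_pos P).le
    (C.momentumSq_curve P ι hω ⟨by linarith, by linarith⟩)
  rw [if_neg (fun hcon => absurd C.lt_p (not_lt.2 hcon.2))] at h1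
  linarith

lemma angle_eq (hc0 : R = 0 → derivWithin c (Icc R 1) 0 = 0) :
    θ (chordHalf ρ p τ) - θ (-chordHalf ρ p τ) = 2 * halfAngle ρ R p := by
  have hpos := C.half_pos P
  have hp := C.p_pos P
  have hσp : 0 < σ p := P.R_nonneg.trans_lt (C.R_lt_σp P)
  have hzc : Continuous z := continuous_iff_continuousAt.2 fun t => (C.z_deriv t).continuousAt
  have hcont2 : Continuous fun t => p / (p ^ 2 + z t ^ 2) :=
    continuous_const.div (by fun_prop) fun t => by positivity
  have hcc : ContinuousOn c (Icc R 1) := fun s hs => (P.c_deriv s hs).continuousWithinAt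
  have h1 := C.integral_r P (f := fun s => p * c s ^ 2 / s ^ 2) (by
    refine ContinuousOn.div (continuousOn_const.mul
      ((hcc.mono (Icc_subset_Icc_left (C.R_lt_σp P).le)).pow 2)) (by fun_prop) fun s hs => ?_
    exact pow_ne_zero _ (hσp.trans_le hs.1).ne') hc0
  have h2 : ∫ t in (-chordHalf ρ p τ)..chordHalf ρ p τ, p / (p ^ 2 + z t ^ 2)
      = θ (chordHalf ρ p τ) - θ (-chordHalf ρ p τ) :=
    intervalIntegral.integral_eq_sub_of_hasDerivAt (fun t _ => C.θ_deriv t)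
      (hcont2.intervalIntegrable _ _)
  rw [← h2]
  have h3 : ∫ t in (-chordHalf ρ p τ)..chordHalf ρ p τ, p / (p ^ 2 + z t ^ 2)
      = ∫ t in (-chordHalf ρ p τ)..chordHalf ρ p τ, p * c (r t) ^ 2 / r t ^ 2 := by
    refine intervalIntegral.integral_congr fun t ht => ?_
    rw [uIcc_of_le (by linarith)] at ht
    have hr := C.r_pos P t
    have hC := P.c_pos _ (C.r_mem P ht)
    rw [← C.ρ_r_sq P, P.ρ_eq _ (C.r_mem P ht)]
    field_simp
  rw [h3, h1]
  congr 1
  refine setIntegral_congr_fun measurableSet_Ioc fun s hs => ?_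
  have hsI : s ∈ Icc R 1 := ⟨hs.1.le, hs.2⟩
  have hs0 : 0 < s := P.R_nonneg.trans_lt hs.1
  have hρ := P.ρ_pos hsI hs0
  rw [P.c_eq hsI hs0]
  field_simp

/-- A chord whose angle is a rational multiple of `2π` closes up to a periodic broken ray. -/
theorem mem_lsp (hc0 : R = 0 → derivWithin c (Icc R 1) 0 = 0) {n : ℕ} (hn : 2 ≤ n) {K : ℕ}
    (hK : 1 ≤ K) {M : ℤ} (hM : K * (2 * halfAngle ρ R p) = M * (2 * Real.pi)) :
    K * (2 * halfLength ρ R p) ∈ lsp n R c := by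
  obtain ⟨ι⟩ := exists_complex_isometry hn
  have hpos := C.half_pos P
  have hang := C.angle_eq P hc0
  set h := chordHalf ρ p τ with hh
  set a : ℝ := θ h - θ (-h) with ha
  let ω : ℕ → ℂ := fun i => Complex.exp ((i * a : ℝ) * Complex.I)
  have hω : ∀ i, ‖ω i‖ = 1 := fun i => Complex.norm_exp_ofReal_mul_I _
  have hjoin : ∀ i, ω (i + 1) * chordCurve r θ (-h) = ω i * chordCurve r θ h := fun i => by
    simp only [ω, chordCurve]
    rw [C.r_half P, C.r_neg_half P, mul_left_comm, mul_left_comm (Complex.exp _),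
      ← Complex.exp_add, ← Complex.exp_add]
    congr 2
    simp only [ha]
    push_cast
    ring
  refine ⟨K, fun _ => 2 * h, fun i t => ι (ω i * chordCurve r θ (t - h)),
    fun i t => ι (ω i * chordVelocity p z r θ (t - h)),
    ⟨hK, fun i _ => C.geodesicSegment P ι (hω i), fun i _ => ?_, fun i _ => ?_, ?_⟩, ?_⟩
  · simp only [zero_sub, show 2 * h - h = h by ring]
    rw [hjoin]
  · simp only [zero_sub, show 2 * h - h = h by ring]
    rw [C.inner_curve P ι (hω i), C.norm_mul_curve P ι (hω i), C.r_half P]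
    unfold chordVelocity
    rw [show ω (i + 1) * ((z (-h) - p * Complex.I : ℂ)⁻¹ * chordCurve r θ (-h))
      = (z (-h) - p * Complex.I : ℂ)⁻¹ * (ω (i + 1) * chordCurve r θ (-h)) by ring, hjoin,
      C.inv_eq P, C.inv_eq P, hh, C.z_half P, C.z_neg_half P, ← hh, ← ι.map_smul, ← ι.map_sub]
    congr 1
    rw [Complex.real_smul]
    have hp := C.p_pos P
    have h2 : ((p ^ 2 + √(ρ 1 ^ 2 - p ^ 2) ^ 2 : ℝ) : ℂ) ≠ 0 := by
      rw [Complex.ofReal_ne_zero]; positivity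
    rw [neg_sq]
    push_cast at h2 ⊢
    field_simp
    ring
  · simp only [zero_sub, show 2 * h - h = h by ring]
    rw [← hjoin, Nat.sub_add_cancel hK]
    congr 2
    simp only [ω]
    rw [hang, hM, Nat.cast_zero, zero_mul, Complex.ofReal_zero, zero_mul, Complex.exp_zero,
      Complex.exp_eq_one_iff]
    exact ⟨M, by push_cast; ring⟩
  · rw [Finset.sum_const, Finset.card_range, nsmul_eq_mul, hh, C.half_eq P hc0]

end Chord

end

lemma integrableOn_inv_sqrt_abs_sub (r₀ a b : ℝ) :
    IntegrableOn (fun s => (√|s - r₀|)⁻¹) (Ioc a b) := by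
  have h0 : ∀ d : ℝ, 0 ≤ d → IntervalIntegrable (fun x : ℝ => (√|x|)⁻¹) volume 0 d := by
    intro d hd
    have h := intervalIntegral.intervalIntegrable_rpow' (a := 0) (b := d) (r := -(1 / 2))
      (by norm_num)
    refine h.congr fun x hx => ?_
    rw [uIoc_of_le hd] at hx
    rw [Real.rpow_neg hx.1.le, ← Real.sqrt_eq_rpow, abs_of_pos hx.1]
  have h1 : ∀ d : ℝ, IntervalIntegrable (fun x : ℝ => (√|x|)⁻¹) volume 0 d := by
    intro d
    rcases le_total 0 d with hd | hd
    · exact h0 d hd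
    · have := (h0 (-d) (by linarith)).comp_sub_left 0
      simpa using this
  rcases le_total a b with hab | hab
  · have h2 := ((h1 (a - r₀)).symm.trans (h1 (b - r₀))).comp_sub_right r₀
    simp only [sub_add_cancel] at h2
    exact (intervalIntegrable_iff_integrableOn_Ioc_of_le hab).1 h2
  · rw [Ioc_eq_empty (not_lt.2 hab)]
    exact integrableOn_empty

lemma abs_sqrt_sub_sqrt_le {a b : ℝ} (hb : b ≠ 0) : |√a - √b| ≤ |a - b| / √|b| := by
  have hb' : 0 < √|b| := Real.sqrt_pos.2 (abs_pos.2 hb)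
  rw [le_div_iff₀ hb']
  have hbs := Real.sq_sqrt (abs_nonneg b)
  rcases lt_or_gt_of_ne hb with h | h
  · rw [Real.sqrt_eq_zero_of_nonpos h.le, sub_zero, abs_of_nonneg (Real.sqrt_nonneg a)]
    rcases le_total a 0 with ha | ha
    · rw [Real.sqrt_eq_zero_of_nonpos ha, zero_mul]; exact abs_nonneg _
    · rw [abs_of_nonneg (by linarith : 0 ≤ a - b)]
      rw [abs_of_neg h] at hbs ⊢
      nlinarith [Real.sq_sqrt ha, sq_nonneg (√a - √(-b)), Real.sqrt_nonneg a]
  · rw [abs_of_pos h] at hbs ⊢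
    rcases le_total a 0 with ha | ha
    · rw [Real.sqrt_eq_zero_of_nonpos ha, zero_sub, abs_neg, abs_of_nonneg (Real.sqrt_nonneg b),
        abs_of_nonpos (by linarith : a - b ≤ 0)]
      nlinarith
    · have : a - b = (√a - √b) * (√a + √b) := by
        nlinarith [Real.sq_sqrt ha]
      rw [this, abs_mul, abs_of_nonneg (by positivity : 0 ≤ √a + √b)]
      have := Real.sqrt_nonneg a
      gcongr
      linarith

/-- Differentiation under the integral sign for `∫ √(a x s) / s`, where `a x₀` is allowed to have a
simple zero. -/
theorem hasDerivAt_integral_sqrt_div {R : ℝ} (hR : 0 ≤ R) {a : ℝ → ℝ → ℝ} {a' : ℝ → ℝ}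
    {x₀ A C W κ r₀ η : ℝ} (hη : 0 < η) (hκ : 0 < κ) (hC : 0 ≤ C)
    (hcont : ∀ x ∈ Metric.ball x₀ η, ContinuousOn (a x) (Ioc R 1))
    (hcont' : ContinuousOn a' (Ioc R 1))
    (hlip : ∀ s ∈ Ioc R 1, ∀ x ∈ Metric.ball x₀ η, |a x s - a x₀ s| ≤ C * |x - x₀|)
    (hder : ∀ s ∈ Ioc R 1, HasDerivAt (fun x => a x s) (a' s) x₀)
    (hlow : ∀ s ∈ Ioc R 1, κ * |s - r₀| ≤ |a x₀ s|)
    (hW : ∀ s ∈ Ioc R 1, 1 / s ≤ W ∨ ∀ x ∈ Metric.ball x₀ η, a x s ≤ 0)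
    (hA : ∀ s ∈ Ioc R 1, √(a x₀ s) / s ≤ A) :
    HasDerivAt (fun x => ∫ s in Ioc R 1, √(a x s) / s)
      (∫ s in Ioc R 1, a' s / (2 * √(a x₀ s)) / s) x₀ := by
  have hs0 : ∀ s ∈ Ioc R 1, 0 < s := fun s hs => hR.trans_lt hs.1
  have hx0 : x₀ ∈ Metric.ball x₀ η := Metric.mem_ball_self hη
  have hmeas : ∀ x ∈ Metric.ball x₀ η,
      AEStronglyMeasurable (fun s => √(a x s) / s) (volume.restrict (Ioc R 1)) := fun x hx =>
    (ContinuousOn.div (hcont x hx).sqrt continuousOn_id fun s hs => (hs0 s hs).ne')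
      |>.aestronglyMeasurable measurableSet_Ioc
  have hmeas' : AEStronglyMeasurable (fun s => a' s / (2 * √(a x₀ s)) / s)
      (volume.restrict (Ioc R 1)) := by
    have h1 := hcont'.aestronglyMeasurable (μ := volume) measurableSet_Ioc
    have h2 := ((hcont x₀ hx0).sqrt).aestronglyMeasurable (μ := volume) measurableSet_Ioc
    have h3 : AEStronglyMeasurable (fun s : ℝ => s) (volume.restrict (Ioc R 1)) :=
      continuous_id.aestronglyMeasurable
    exact (h1.aemeasurable.div (h2.aemeasurable.const_mul 2)).div h3.aemeasurable
      |>.aestronglyMeasurable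
  have hne : ∀ᵐ s ∂(volume.restrict (Ioc R 1)), s ∈ Ioc R 1 ∧ s ≠ r₀ := by
    refine (ae_restrict_mem measurableSet_Ioc).and ?_
    exact ae_restrict_of_ae (by simp [ae_iff])
  have hane : ∀ s ∈ Ioc R 1, s ≠ r₀ → a x₀ s ≠ 0 := fun s hs hsr h0 => by
    have h1 := hlow s hs
    rw [h0, abs_zero] at h1
    have := mul_pos hκ (abs_pos.2 (sub_ne_zero.2 hsr))
    linarith
  have hdiff : ∀ᵐ s ∂(volume.restrict (Ioc R 1)),
      HasDerivAt (fun x => √(a x s) / s) (a' s / (2 * √(a x₀ s)) / s) x₀ := by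
    filter_upwards [hne] with s hs
    exact ((hder s hs.1).sqrt (hane s hs.1 hs.2)).div_const s
  set bound : ℝ → ℝ := fun s => |W| * C * (√κ)⁻¹ * (√|s - r₀|)⁻¹ with hbound
  have hbi : Integrable bound (volume.restrict (Ioc R 1)) :=
    (integrableOn_inv_sqrt_abs_sub r₀ R 1).const_mul _
  have hint : Integrable (fun s => √(a x₀ s) / s) (volume.restrict (Ioc R 1)) := by
    refine Integrable.of_bound (hmeas x₀ hx0) A ?_
    filter_upwards [ae_restrict_mem measurableSet_Ioc] with s hs
    rw [Real.norm_of_nonneg (div_nonneg (Real.sqrt_nonneg _) (hs0 s hs).le)]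
    exact hA s hs
  have hlb : ∀ᵐ s ∂(volume.restrict (Ioc R 1)), ∀ x ∈ Metric.ball x₀ η,
      ‖√(a x s) / s - √(a x₀ s) / s‖ ≤ bound s * ‖x - x₀‖ := by
    filter_upwards [hne] with s hs x hx
    have hsp := hs0 s hs.1
    rcases hW s hs.1 with hw | hw
    · rw [← sub_div, norm_div, Real.norm_eq_abs, Real.norm_of_nonneg hsp.le, Real.norm_eq_abs,
        div_eq_mul_one_div]
      have h1 := abs_sqrt_sub_sqrt_le (a := a x s) (hane s hs.1 hs.2)
      have h2 := hlip s hs.1 x hx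
      have hpos : 0 < κ * |s - r₀| := mul_pos hκ (abs_pos.2 (sub_ne_zero.2 hs.2))
      have h3 : √(κ * |s - r₀|) ≤ √|a x₀ s| := Real.sqrt_le_sqrt (hlow s hs.1)
      have h4 : 0 < √(κ * |s - r₀|) := Real.sqrt_pos.2 hpos
      have h5 : |√(a x s) - √(a x₀ s)| ≤ C * |x - x₀| / √(κ * |s - r₀|) :=
        h1.trans (div_le_div₀ (by positivity) h2 h4 h3)
      calc |√(a x s) - √(a x₀ s)| * (1 / s)
          ≤ (C * |x - x₀| / √(κ * |s - r₀|)) * |W| := by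
            refine mul_le_mul h5 (hw.trans (le_abs_self W)) (by positivity) (by positivity)
        _ = bound s * |x - x₀| := by
            rw [hbound, Real.sqrt_mul hκ.le]
            field_simp
    · rw [Real.sqrt_eq_zero_of_nonpos (hw x hx), Real.sqrt_eq_zero_of_nonpos (hw x₀ hx0)]
      simp only [zero_div, sub_self, norm_zero]
      positivity
  set L : ℝ →L[ℝ] ℝ →L[ℝ] ℝ := ContinuousLinearMap.smulRightL ℝ ℝ ℝ 1
  have hm : AEStronglyMeasurable (L ∘ fun s => a' s / (2 * √(a x₀ s)) / s)
      (volume.restrict (Ioc R 1)) := L.continuous.comp_aestronglyMeasurable hmeas'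
  obtain ⟨hi, key⟩ := hasFDerivAt_integral_of_dominated_loc_of_lip' (𝕜 := ℝ)
    (Metric.ball_mem_nhds x₀ hη) hmeas hint hm hlb hbi
    (hdiff.mono fun s hs => hs.hasFDerivAt)
  have hi' : Integrable (fun s => a' s / (2 * √(a x₀ s)) / s) (volume.restrict (Ioc R 1)) := by
    rw [← integrable_norm_iff hm] at hi
    refine (integrable_norm_iff hmeas').1 ?_
    simpa [L, (· ∘ ·)] using! hi
  rw [hasDerivAt_iff_hasFDerivAt]
  simpa only [(· ∘ ·), ContinuousLinearMap.integral_comp_comm _ hi'] using! key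

/-- The (half) intercept function `length - momentum * angle` of chords. -/
noncomputable def intercept (ρ : ℝ → ℝ) (R p : ℝ) : ℝ :=
  ∫ s in Ioc R 1, √(ρ s ^ 2 - p ^ 2) / s

section

variable {R : ℝ} {c ρ ρ' σ Q : ℝ → ℝ} (P : Profile R c ρ ρ' σ Q)
include P

namespace Profile

lemma exists_low {p : ℝ} (hp : 0 < p) :
    ∃ κ > 0, ∀ s ∈ Ioc R 1, κ * |s - σ p| ≤ |ρ s ^ 2 - p ^ 2| := by
  obtain ⟨κ, hκ, h⟩ := P.exists_mul_abs_sub_le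
  refine ⟨p * κ, mul_pos hp hκ, fun s hs => ?_⟩
  have hρ := P.ρ_nonneg ⟨hs.1.le, hs.2⟩
  rw [sq_sub_sq, abs_mul, abs_of_pos (by linarith : 0 < ρ s + p), mul_assoc]
  exact mul_le_mul (by linarith) (h s p) (by positivity) (by linarith)

/-- Away from the radii which chords of momentum close to `p` do not reach, `1 / s` is bounded. -/
lemma exists_cutoff {p : ℝ} (hp : 0 < p) : ∃ W, ∀ s ∈ Ioc R 1, 1 / s ≤ W ∨ ρ s ≤ p / 2 := by
  by_cases hR : 0 < R
  · exact ⟨1 / R, fun s hs => Or.inl (one_div_le_one_div_of_le hR hs.1.le)⟩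
  · have hR0 : R = 0 := le_antisymm (not_lt.1 hR) P.R_nonneg
    have h0 : ρ 0 = 0 := by
      have := P.ρ_eq R P.mem_R
      rw [hR0] at this
      rw [this, zero_div]
    have h1 : 0 < σ (p / 2) := by
      rw [← P.ρ_lt, P.ρ_σ, h0]; linarith
    refine ⟨1 / σ (p / 2), fun s hs => ?_⟩
    rcases le_total s (σ (p / 2)) with h | h
    · right
      rw [← P.ρ_σ (p / 2)]
      exact P.ρ_le.2 h
    · exact Or.inl (one_div_le_one_div_of_le h1 h)

lemma exists_inv_c_le : ∃ A, ∀ s ∈ Icc R 1, 1 / c s ≤ A := by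
  have hcont : ContinuousOn (fun s => 1 / c s) (Icc R 1) :=
    continuousOn_const.div (fun s hs => (P.c_deriv s hs).continuousWithinAt)
      fun s hs => (P.c_pos s hs).ne'
  obtain ⟨A, hA⟩ := isCompact_Icc.exists_bound_of_continuousOn hcont
  exact ⟨A, fun s hs => (le_abs_self _).trans (hA s hs)⟩

lemma sqrt_div_le {p s : ℝ} (hs : s ∈ Ioc R 1) : √(ρ s ^ 2 - p ^ 2) / s ≤ 1 / c s := by
  have hsI : s ∈ Icc R 1 := ⟨hs.1.le, hs.2⟩
  have hs0 : 0 < s := P.R_nonneg.trans_lt hs.1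
  have h1 : √(ρ s ^ 2 - p ^ 2) ≤ ρ s := by
    rw [Real.sqrt_le_left (P.ρ_nonneg hsI)]
    nlinarith [sq_nonneg p]
  have hC := P.c_pos s hsI
  calc √(ρ s ^ 2 - p ^ 2) / s ≤ ρ s / s := by gcongr
    _ = 1 / c s := by rw [P.ρ_eq s hsI]; field_simp

/-- The derivative of the intercept with respect to the momentum is minus the angle. -/
theorem hasDerivAt_intercept {p : ℝ} (hp : 0 < p) :
    HasDerivAt (intercept ρ R) (-halfAngle ρ R p) p := by
  obtain ⟨κ, hκ, hlow⟩ := P.exists_low hp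
  obtain ⟨W, hW⟩ := P.exists_cutoff hp
  obtain ⟨A, hA⟩ := P.exists_inv_c_le
  have hs : ∀ s ∈ Ioc R 1, s ∈ Icc R 1 := fun s hs => ⟨hs.1.le, hs.2⟩
  have hball : ∀ x ∈ Metric.ball p (p / 2), p / 2 < x ∧ x < 3 * p / 2 := fun x hx => by
    rw [Metric.mem_ball, Real.dist_eq, abs_lt] at hx
    constructor <;> linarith [hx.1, hx.2]
  have h := hasDerivAt_integral_sqrt_div P.R_nonneg (a := fun x s => ρ s ^ 2 - x ^ 2)
    (a' := fun _ => -(2 * p)) (x₀ := p) (A := A) (C := 3 * p) (W := W) (half_pos hp) hκ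
    (by positivity) (fun x _ => ((P.ρ_cont.pow 2).sub continuous_const).continuousOn)
    continuousOn_const (fun s _ x hx => ?_) (fun s _ => ?_) hlow (fun s hsI => ?_)
    (fun s hsI => (P.sqrt_div_le hsI).trans (hA s (hs s hsI)))
  · convert! h using 1
    unfold halfAngle
    rw [← integral_neg]
    refine integral_congr_ae (Eventually.of_forall fun s => ?_)
    simp only
    rw [neg_div, neg_div, mul_div_mul_left _ _ two_ne_zero, div_div, mul_comm s]
  · obtain ⟨h1, h2⟩ := hball x hx
    have e : ρ s ^ 2 - x ^ 2 - (ρ s ^ 2 - p ^ 2) = -((x + p) * (x - p)) := by ring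
    rw [e, abs_neg, abs_mul, abs_of_pos (by linarith)]
    gcongr
    linarith
  · have := ((hasDerivAt_id p).pow 2).const_sub (ρ s ^ 2)
    convert! this using 1
    simp
  · refine (hW s hsI).imp_right fun h1 x hx => ?_
    have h2 := (hball x hx).1
    nlinarith [P.ρ_nonneg (hs s hsI)]

lemma integrableOn_angle {p : ℝ} (hp : 0 < p) :
    IntegrableOn (fun s => p / (s * √(ρ s ^ 2 - p ^ 2))) (Ioc R 1) := by
  obtain ⟨κ, hκ, hlow⟩ := P.exists_low hp
  obtain ⟨W, hW⟩ := P.exists_cutoff hp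
  have hg := (integrableOn_inv_sqrt_abs_sub (σ p) R 1).const_mul (p * |W| * (√κ)⁻¹)
  refine Integrable.mono' hg ?_ ?_
  · refine Measurable.aestronglyMeasurable ?_
    have := P.ρ_cont.measurable
    fun_prop
  · filter_upwards [ae_restrict_mem measurableSet_Ioc,
      ae_restrict_of_ae (show ∀ᵐ s : ℝ, s ≠ σ p by simp [ae_iff])] with s hs hsr
    have hs0 : 0 < s := P.R_nonneg.trans_lt hs.1
    rw [Real.norm_of_nonneg (by positivity)]
    rcases hW s hs with h | h
    · rcases le_total (ρ s ^ 2 - p ^ 2) 0 with h0 | h0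
      · rw [Real.sqrt_eq_zero_of_nonpos h0, mul_zero, div_zero]
        positivity
      · have h1 := hlow s hs
        rw [abs_of_nonneg h0] at h1
        have hpos : 0 < κ * |s - σ p| := mul_pos hκ (abs_pos.2 (sub_ne_zero.2 hsr))
        have h2 : √(κ * |s - σ p|) ≤ √(ρ s ^ 2 - p ^ 2) := Real.sqrt_le_sqrt h1
        have h3 : 0 < √(κ * |s - σ p|) := Real.sqrt_pos.2 hpos
        calc p / (s * √(ρ s ^ 2 - p ^ 2)) = p * (1 / s) * (1 / √(ρ s ^ 2 - p ^ 2)) := by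
              field_simp
          _ ≤ p * |W| * (1 / √(κ * |s - σ p|)) := by
              gcongr
              exact h.trans (le_abs_self W)
          _ = p * |W| * (√κ)⁻¹ * (√|s - σ p|)⁻¹ := by
              rw [Real.sqrt_mul hκ.le]; field_simp
    · have h1 : ρ s ^ 2 - p ^ 2 ≤ 0 := by
        nlinarith [P.ρ_nonneg (Ioc_subset_Icc_self hs)]
      rw [Real.sqrt_eq_zero_of_nonpos h1, mul_zero, div_zero]
      positivity

lemma integrableOn_intercept (p : ℝ) :
    IntegrableOn (fun s => √(ρ s ^ 2 - p ^ 2) / s) (Ioc R 1) := by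
  obtain ⟨A, hA⟩ := P.exists_inv_c_le
  refine Integrable.of_bound (C := A) ?_ ?_
  · refine Measurable.aestronglyMeasurable ?_
    have := P.ρ_cont.measurable
    fun_prop
  · filter_upwards [ae_restrict_mem measurableSet_Ioc] with s hs
    have hs0 : 0 < s := P.R_nonneg.trans_lt hs.1
    rw [Real.norm_of_nonneg (by positivity)]
    exact (P.sqrt_div_le hs).trans (hA s (Ioc_subset_Icc_self hs))

lemma halfLength_eq {p : ℝ} (hp : 0 < p) :
    halfLength ρ R p = intercept ρ R p + p * halfAngle ρ R p := by
  unfold halfLength intercept halfAngle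
  rw [← integral_const_mul, ← integral_add (P.integrableOn_intercept p)
    ((P.integrableOn_angle hp).const_mul p)]
  refine setIntegral_congr_fun measurableSet_Ioc fun s hs => ?_
  have hs0 : 0 < s := P.R_nonneg.trans_lt hs.1
  rcases le_or_gt (ρ s ^ 2 - p ^ 2) 0 with h0 | h0
  · simp only [Real.sqrt_eq_zero_of_nonpos h0, mul_zero, div_zero, zero_div, add_zero]
  · have h1 := Real.sqrt_pos.2 h0
    have h2 := Real.sq_sqrt h0.le
    field_simp
    linarith

end Profile

/-- The length spectrum, with or without inner reflections, has measure zero: up to countably many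
lengths it consists of critical values of functions of one variable. -/
theorem volume_brokenRayLengths {n : ℕ} {B : Set (EuclideanSpace ℝ (Fin n))}
    (hc0 : R = 0 → derivWithin c (Icc R 1) 0 = 0)
    (hB : ∀ x ∈ B, ‖x‖ = 1 ∨ (0 < R ∧ ‖x‖ = R)) : volume (brokenRayLengths R c B) = 0 := by
  let g : ℕ → ℤ → ℝ → ℝ := fun K M p => K * intercept ρ R p + M * (2 * Real.pi) * p
  let S : ℕ → ℤ → Set ℝ := fun K M => {p | 0 < p ∧ K * halfAngle ρ R p = M * (2 * Real.pi)}
  have hnull : ∀ K M, volume (g K M '' S K M) = 0 := fun K M => by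
    refine addHaar_image_eq_zero_of_det_fderivWithin_eq_zero volume
      (f' := fun p => (0 : ℝ →L[ℝ] ℝ)) (fun p hp => ?_) (fun p _ => by simp)
    have h1 : HasDerivAt (g K M) 0 p := by
      have := ((P.hasDerivAt_intercept hp.1).const_mul (K : ℝ)).add
        ((hasDerivAt_id p).const_mul (M * (2 * Real.pi)))
      convert! this using 1
      rw [mul_one]
      linarith [hp.2]
    have := h1.hasFDerivAt.hasFDerivWithinAt (s := S K M)
    convert! this using 1
    ext
    simp
  have hsub : brokenRayLengths R c B ⊆
      (range fun K : ℕ => K * halfLength ρ R 0) ∪ ⋃ K, ⋃ M, g K M '' S K M := by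
    intro l hl
    obtain ⟨K, p, hp, rfl, hcos⟩ := exists_momentum_of_mem_brokenRayLengths P hc0 hB hl
    rcases hp.eq_or_lt with h0 | h0
    · left
      exact ⟨K, by rw [← h0]⟩
    · right
      obtain ⟨M, hM⟩ := (Real.cos_eq_one_iff _).1 (hcos h0)
      refine mem_iUnion.2 ⟨K, mem_iUnion.2 ⟨M, p, ⟨h0, hM.symm⟩, ?_⟩⟩
      simp only [g]
      rw [P.halfLength_eq h0]
      linear_combination p * hM
  refine measure_mono_null hsub (measure_union_null ?_ ?_)
  · exact (countable_range _).measure_zero _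
  · exact measure_iUnion_null fun K => measure_iUnion_null fun M => hnull K M

end

lemma hasDerivAt_sqrt_add_sq {p : ℝ} (hp : 0 < p) (x : ℝ) :
    HasDerivAt (fun x => √(p ^ 2 + x ^ 2)) (x / √(p ^ 2 + x ^ 2)) x := by
  have hpos : p ^ 2 + x ^ 2 ≠ 0 := by positivity
  have h := (((hasDerivAt_id x).pow 2).const_add (p ^ 2)).sqrt hpos
  convert! h using 1
  simp only [Pi.pow_apply, id]
  field_simp
  simp [mul_comm]

lemma sqrt_add_sq_lipschitz {p : ℝ} (hp : 0 < p) : LipschitzWith 1 (fun x => √(p ^ 2 + x ^ 2)) := by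
  refine lipschitzWith_of_nnnorm_deriv_le
    (fun x => (hasDerivAt_sqrt_add_sq hp x).differentiableAt) fun x => ?_
  rw [(hasDerivAt_sqrt_add_sq hp x).deriv, ← NNReal.coe_le_coe, coe_nnnorm, norm_div,
    Real.norm_of_nonneg (Real.sqrt_nonneg _), NNReal.coe_one]
  refine div_le_one_of_le₀ ?_ (Real.sqrt_nonneg _)
  exact Real.abs_le_sqrt (by nlinarith)

/-- A set of full measure pulls back to a set of full measure under `x ↦ b √(a² + x²)`. -/
lemma ae_comp_mul_sqrt {a b : ℝ} (hb : 0 < b) {q : ℝ → Prop} (hq : ∀ᵐ u, q u) :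
    ∀ᵐ x : ℝ, q (b * √(a ^ 2 + x ^ 2)) := by
  set E : Set ℝ := {u | ¬ q u} with hE
  have hE0 : volume E = 0 := hq
  let φ : ℝ → ℝ := fun u => √((u / b) ^ 2 - a ^ 2)
  let E' : Set ℝ := E ∩ {u | (u / b) ^ 2 - a ^ 2 ≠ 0}
  have hE' : volume E' = 0 := measure_mono_null inter_subset_left hE0
  have hd : DifferentiableOn ℝ φ E' := fun u hu =>
    (DifferentiableAt.sqrt (f := fun u => (u / b) ^ 2 - a ^ 2) (by fun_prop)
      hu.2).differentiableWithinAt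
  have h1 := addHaar_image_eq_zero_of_differentiableOn_of_addHaar_eq_zero volume hd hE'
  have h2 := addHaar_image_eq_zero_of_differentiableOn_of_addHaar_eq_zero volume hd.neg hE'
  rw [ae_iff]
  refine measure_mono_null (t := {0} ∪ (φ '' E' ∪ (-φ) '' E')) (fun x hx => ?_)
    (measure_union_null (measure_singleton 0) (measure_union_null h1 h2))
  by_cases hx0 : x = 0
  · exact Or.inl hx0
  right
  have hsq : (b * √(a ^ 2 + x ^ 2) / b) ^ 2 - a ^ 2 = x ^ 2 := by
    rw [mul_div_cancel_left₀ _ hb.ne', Real.sq_sqrt (by positivity)]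
    ring
  have hmem : b * √(a ^ 2 + x ^ 2) ∈ E' := ⟨hx, by
    simp only [mem_ofPred_eq, hsq]
    exact pow_ne_zero 2 hx0⟩
  rcases le_total 0 x with h | h
  · exact Or.inl ⟨_, hmem, by simp only [φ, hsq, Real.sqrt_sq h]⟩
  · refine Or.inr ⟨_, hmem, ?_⟩
    simp only [φ, hsq, Pi.neg_apply, Real.sqrt_sq_eq_abs, abs_of_nonpos h, neg_neg]

/-- The (negative) derivative of the even Jacobi field along a chord, with respect to the radial
moment. -/
noncomputable def jacobiSlope (Q : ℝ → ℝ) (p w : ℝ) : ℝ :=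
  ∫ x in (0 : ℝ)..w, deriv Q √(p ^ 2 + x ^ 2) / √(p ^ 2 + x ^ 2)

/-- The even Jacobi field along a chord of momentum `p`, as a function of the radial moment. -/
noncomputable def jacobiField (Q : ℝ → ℝ) (p w : ℝ) : ℝ :=
  Q p - ∫ x in (0 : ℝ)..w, jacobiSlope Q p x

section Jacobi

variable {Q : ℝ → ℝ} {K : ℝ≥0} (hQ : LipschitzWith K Q) {p : ℝ} (hp : 0 < p)
include hQ hp

lemma abs_slope_integrand_le (x : ℝ) :
    ‖deriv Q √(p ^ 2 + x ^ 2) / √(p ^ 2 + x ^ 2)‖ ≤ K / p := by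
  rw [norm_div]
  have h1 : p ≤ ‖√(p ^ 2 + x ^ 2)‖ := by
    rw [Real.norm_of_nonneg (Real.sqrt_nonneg _)]
    exact Real.le_sqrt_of_sq_le (by nlinarith [sq_nonneg x])
  exact div_le_div₀ K.2 (norm_deriv_le_of_lipschitz hQ) hp h1

lemma slope_integrand_locallyIntegrable :
    LocallyIntegrable (fun x => deriv Q √(p ^ 2 + x ^ 2) / √(p ^ 2 + x ^ 2)) volume := by
  have hm : Measurable fun x => deriv Q √(p ^ 2 + x ^ 2) / √(p ^ 2 + x ^ 2) := by
    have h1 := measurable_deriv Q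
    have h2 : Measurable fun x : ℝ => √(p ^ 2 + x ^ 2) := by fun_prop
    exact (h1.comp h2).div h2
  have hc : LocallyIntegrable (fun _ : ℝ => (K : ℝ) / p) volume := locallyIntegrable_const _
  exact hc.mono hm.aestronglyMeasurable (Eventually.of_forall fun x =>
    (abs_slope_integrand_le hQ hp x).trans (le_abs_self _))

lemma slope_integrand_intervalIntegrable (a b : ℝ) :
    IntervalIntegrable (fun x => deriv Q √(p ^ 2 + x ^ 2) / √(p ^ 2 + x ^ 2)) volume a b :=
  intervalIntegrable_iff.mpr <|
    ((slope_integrand_locallyIntegrable hQ hp).integrableOn_isCompact isCompact_uIcc).mono_set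
      uIoc_subset_uIcc

lemma jacobiSlope_lipschitz : LipschitzWith (Real.toNNReal (K / p)) (jacobiSlope Q p) := by
  refine LipschitzWith.of_dist_le_mul fun x y => ?_
  rw [Real.coe_toNNReal _ (by positivity), dist_comm, Real.dist_eq, dist_comm, Real.dist_eq]
  unfold jacobiSlope
  rw [intervalIntegral.integral_interval_sub_left (slope_integrand_intervalIntegrable hQ hp 0 y)
    (slope_integrand_intervalIntegrable hQ hp 0 x)]
  exact intervalIntegral.norm_integral_le_of_norm_le_const fun t _ => abs_slope_integrand_le hQ hp t

lemma jacobiSlope_ae_hasDerivAt : ∀ᵐ x, HasDerivAt (jacobiSlope Q p)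
    (deriv Q √(p ^ 2 + x ^ 2) / √(p ^ 2 + x ^ 2)) x := by
  filter_upwards [LocallyIntegrable.ae_hasDerivAt_integral
    (slope_integrand_locallyIntegrable hQ hp)] with x hx
  exact hx 0

lemma jacobiField_hasDerivAt (w : ℝ) : HasDerivAt (jacobiField Q p) (-jacobiSlope Q p w) w :=
  (((jacobiSlope_lipschitz hQ hp).continuous.integral_hasStrictDerivAt 0 w).hasDerivAt).const_sub _

lemma ae_differentiableAt_sqrt : ∀ᵐ x : ℝ, DifferentiableAt ℝ Q √(p ^ 2 + x ^ 2) := by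
  have := ae_comp_mul_sqrt (a := p) one_pos (hQ.ae_differentiableAt (μ := volume))
  simpa only [one_mul] using this

/-- The first integral of the Jacobi equation. -/
lemma jacobiField_eq (w : ℝ) :
    jacobiField Q p w = Q √(p ^ 2 + w ^ 2) - w * jacobiSlope Q p w := by
  set f : ℝ → ℝ := fun x => Q √(p ^ 2 + x ^ 2) - x * jacobiSlope Q p x - jacobiField Q p x with hf
  have hIl := jacobiSlope_lipschitz hQ hp
  have hac : AbsolutelyContinuousOnInterval f 0 w := by
    refine (AbsolutelyContinuousOnInterval.sub ?_ ?_).sub ?_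
    · exact ((hQ.comp (sqrt_add_sq_lipschitz hp)).lipschitzOnWith
        (s := uIcc 0 w)).absolutelyContinuousOnInterval
    · exact ((LipschitzWith.id.lipschitzOnWith (s := uIcc 0 w)).absolutelyContinuousOnInterval).mul
        (hIl.lipschitzOnWith (s := uIcc 0 w)).absolutelyContinuousOnInterval
    · have hc : ContDiff ℝ 1 (jacobiField Q p) := by
        rw [contDiff_one_iff_deriv]
        refine ⟨fun x => (jacobiField_hasDerivAt hQ hp x).differentiableAt, ?_⟩
        have : deriv (jacobiField Q p) = fun x => -jacobiSlope Q p x :=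
          funext fun x => (jacobiField_hasDerivAt hQ hp x).deriv
        rw [this]
        exact hIl.continuous.neg
      exact hc.contDiffOn.absolutelyContinuousOnInterval
  have hd : ∀ᵐ x, x ∈ uIcc 0 w → HasDerivAt f 0 x := by
    filter_upwards [jacobiSlope_ae_hasDerivAt hQ hp, ae_differentiableAt_sqrt hQ hp]
      with x h1 h2 _
    have h3 := (h2.hasDerivAt.comp x (hasDerivAt_sqrt_add_sq hp x)).sub
      ((hasDerivAt_id x).mul h1) |>.sub (jacobiField_hasDerivAt hQ hp x)
    convert! h3 using 1
    simp only [id]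
    ring
  obtain ⟨C, hC⟩ := hac.const_of_ae_hasDerivAt_zero hd
  have h0 := hC 0 left_mem_uIcc
  have hw := hC w right_mem_uIcc
  have e0 : f 0 = 0 := by
    simp [hf, jacobiField, Real.sqrt_sq hp.le]
  have : f w = 0 := by rw [hw, ← h0, e0]
  simp only [hf] at this
  linarith

lemma jacobiSlope_neg (w : ℝ) : jacobiSlope Q p (-w) = -jacobiSlope Q p w := by
  unfold jacobiSlope
  have := intervalIntegral.integral_comp_neg (a := 0) (b := w)
    (f := fun x : ℝ => deriv Q √(p ^ 2 + x ^ 2) / √(p ^ 2 + x ^ 2))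
  simp only [neg_sq, neg_zero] at this
  rw [this, intervalIntegral.integral_symm]

lemma jacobiField_neg (w : ℝ) : jacobiField Q p (-w) = jacobiField Q p w := by
  rw [jacobiField_eq hQ hp, jacobiField_eq hQ hp, jacobiSlope_neg hQ hp, neg_sq]
  ring

end Jacobi

section

variable {R : ℝ} {c ρ ρ' σ Q : ℝ → ℝ} {p : ℝ} {τ z r θ : ℝ → ℝ}

/-- The Gaussian curvature in terms of the profile. -/
lemma Profile.gaussCurvature_eq (P : Profile R c ρ ρ' σ Q) {s : ℝ} (hs : s ∈ Ioo R 1)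
    (hd : DifferentiableAt ℝ Q (ρ s)) :
    gaussCurvature c s = deriv Q (ρ s) / ρ s / Q (ρ s) ^ 3 := by
  have hlog : ∀ x ∈ Ioo R 1, deriv (fun s => Real.log (c s)) x = (1 - 1 / Q (ρ x)) / x := by
    intro x hx
    have hxI := Ioo_subset_Icc_self hx
    have hx0 : 0 < x := P.R_nonneg.trans_lt hx.1
    have hC := P.c_pos x hxI
    have h1 := ((P.c_deriv x hxI).hasDerivAt (Icc_mem_nhds hx.1 hx.2)).log hC.ne'
    rw [h1.deriv, P.Q_eq x hxI, one_div_one_div, P.ρ'_eq x hxI]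
    field_simp
    ring
  have hs0 : 0 < s := P.R_nonneg.trans_lt hs.1
  have hsI := Ioo_subset_Icc_self hs
  have hQp := P.Q_pos (ρ s)
  have h2 : HasDerivAt (fun x => (1 - 1 / Q (ρ x)) / x) _ s :=
    (((hasDerivAt_const s (1 : ℝ)).div (hd.hasDerivAt.comp s (P.ρ_deriv s)) hQp.ne').const_sub
      1).div (hasDerivAt_id s) hs0.ne'
  have h3 : deriv (deriv fun s => Real.log (c s)) s = deriv (fun x => (1 - 1 / Q (ρ x)) / x) s := by
    refine Filter.EventuallyEq.deriv_eq ?_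
    filter_upwards [isOpen_Ioo.mem_nhds hs] with x hx using hlog x hx
  have hρ := P.ρ_pos hsI hs0
  have hρ' := P.ρ'_pos s
  have hρQ : ρ' s = ρ s / (s * Q (ρ s)) := by
    rw [P.Q_eq s hsI, P.c_eq hsI hs0]
    field_simp
  unfold gaussCurvature
  rw [h3, h2.deriv, hlog s hs, P.c_eq hsI hs0, hρQ]
  simp only [Function.comp_apply, Pi.div_apply]
  field_simp
  ring

namespace Chord

variable (P : Profile R c ρ ρ' σ Q) (C : Chord R ρ σ Q p τ z r θ)
include P C

lemma ae_comp_z {q : ℝ → Prop} (hq : ∀ᵐ x, q x) : ∀ᵐ t, q (z t) := by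
  have hd : DifferentiableOn ℝ τ {x | ¬ q x} := fun x _ =>
    (C.τ_deriv P x).differentiableAt.differentiableWithinAt
  have h := addHaar_image_eq_zero_of_differentiableOn_of_addHaar_eq_zero volume hd hq
  rw [ae_iff]
  refine measure_mono_null (t := τ '' {x | ¬ q x}) (fun t ht => ?_) h
  exact ⟨z t, ht, C.τ_z t⟩

lemma z_lipschitz : ∃ L, LipschitzWith L z := by
  obtain ⟨κ, hκ, hQ⟩ := P.Q_low
  refine ⟨Real.toNNReal (1 / κ), lipschitzWith_of_nnnorm_deriv_le
    (fun t => (C.z_deriv t).differentiableAt) fun t => ?_⟩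
  rw [(C.z_deriv t).deriv, ← NNReal.coe_le_coe, Real.coe_toNNReal _ (by positivity), coe_nnnorm,
    Real.norm_of_nonneg (one_div_nonneg.2 (P.Q_pos _).le)]
  exact one_div_le_one_div_of_le hκ (hQ _)

/-- The Jacobi equation along a chord. -/
lemma jacobi_equation {a b : ℝ} (ha : -chordHalf ρ p τ ≤ a) (hab : a ≤ b)
    (hb : b ≤ chordHalf ρ p τ) :
    IntervalIntegrable (fun t => gaussCurvature c (r t) * jacobiField Q p (z t)) volume a b ∧
    -jacobiSlope Q p (z b) / Q √(p ^ 2 + z b ^ 2) = -jacobiSlope Q p (z a) / Q √(p ^ 2 + z a ^ 2)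
      - ∫ t in a..b, gaussCurvature c (r t) * jacobiField Q p (z t) := by
  have hp := C.p_pos P
  obtain ⟨K, hQ⟩ := P.Q_lip
  obtain ⟨κ, hκ, hQκ⟩ := P.Q_low
  obtain ⟨L, hzL⟩ := C.z_lipschitz P
  set f : ℝ → ℝ := fun t => -jacobiSlope Q p (z t) * (Q √(p ^ 2 + z t ^ 2))⁻¹ with hf
  have hlip : ∃ M, LipschitzOnWith M f (uIcc a b) := by
    refine exists_lipschitzOnWith_mul isCompact_uIcc ?_ (exists_lipschitzOnWith_inv hκ ?_ ?_)
    · exact ⟨_, (((jacobiSlope_lipschitz hQ hp).comp hzL).neg).lipschitzOnWith⟩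
    · exact ⟨_, (hQ.comp ((sqrt_add_sq_lipschitz hp).comp hzL)).lipschitzOnWith⟩
    · exact fun t _ => hQκ _
  obtain ⟨M, hM⟩ := hlip
  have hac : AbsolutelyContinuousOnInterval f a b := hM.absolutelyContinuousOnInterval
  have hderiv : ∀ᵐ t, t ∈ uIoc a b →
      deriv f t = -(gaussCurvature c (r t) * jacobiField Q p (z t)) := by
    filter_upwards [C.ae_comp_z P (jacobiSlope_ae_hasDerivAt hQ hp),
      C.ae_comp_z P (ae_differentiableAt_sqrt hQ hp),
      (show ∀ᵐ t : ℝ, t ≠ b by simp [ae_iff])] with t h1 h2 h3 ht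
    rw [uIoc_of_le hab] at ht
    have htb : t < b := lt_of_le_of_ne ht.2 h3
    have htI : t ∈ Ioo (-chordHalf ρ p τ) (chordHalf ρ p τ) :=
      ⟨ha.trans_lt ht.1, htb.trans_le hb⟩
    have hrI : r t ∈ Ioo R 1 := ⟨C.R_lt_r P t, C.r_lt P htI⟩
    have hQp := P.Q_pos √(p ^ 2 + z t ^ 2)
    have h4 : HasDerivAt f _ t := ((h1.comp t (C.z_deriv t)).neg).mul
      ((h2.hasDerivAt.comp t ((hasDerivAt_sqrt_add_sq hp (z t)).comp t (C.z_deriv t))).inv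
        hQp.ne')
    rw [h4.deriv, P.gaussCurvature_eq hrI (by rw [C.ρ_r P]; exact h2), C.ρ_r P,
      jacobiField_eq hQ hp]
    have hu := C.sqrt_pos P t
    simp only [Function.comp_apply, Pi.neg_apply]
    field_simp
    ring
  have hii := hac.intervalIntegrable_deriv
  have hae : (fun t => -deriv f t) =ᵐ[volume.restrict (uIoc a b)]
      fun t => gaussCurvature c (r t) * jacobiField Q p (z t) := by
    rw [Filter.EventuallyEq, ae_restrict_iff' measurableSet_uIoc]
    filter_upwards [hderiv] with t ht hm
    rw [ht hm, neg_neg]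
  refine ⟨hii.neg.congr_ae hae, ?_⟩
  have h5 := hac.integral_deriv_eq_sub
  have h6 : ∫ t in a..b, gaussCurvature c (r t) * jacobiField Q p (z t)
      = ∫ t in a..b, -deriv f t :=
    intervalIntegral.integral_congr_ae (by
      filter_upwards [hderiv] with t ht hm
      rw [ht hm, neg_neg])
  rw [h6, intervalIntegral.integral_neg, h5]
  simp only [hf, div_eq_mul_inv]
  ring

/-- If the even Jacobi field vanishes at the ends of the chord then these are conjugate. -/
theorem endpointsConjugate (h0 : jacobiField Q p √(ρ 1 ^ 2 - p ^ 2) = 0)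
    (ι : ℂ →ₗᵢ[ℝ] EuclideanSpace ℝ (Fin 2)) {ω : ℂ} (hω : ‖ω‖ = 1) :
    EndpointsConjugate c (2 * chordHalf ρ p τ)
      (fun t => ι (ω * chordCurve r θ (t - chordHalf ρ p τ))) := by
  have hp := C.p_pos P
  obtain ⟨K, hQ⟩ := P.Q_lip
  have hpos := C.half_pos P
  set h := chordHalf ρ p τ with hh
  have hn : ∀ t, ‖ι (ω * chordCurve r θ (t - h))‖ = r (t - h) := fun t =>
    C.norm_mul_curve P ι hω _
  simp only [EndpointsConjugate, hn]
  refine ⟨fun t => jacobiField Q p (z (t - h)),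
    fun t => -jacobiSlope Q p (z (t - h)) / Q √(p ^ 2 + z (t - h) ^ 2), fun t _ => ?_, ?_,
    fun t ht => ?_, ?_, ?_, h, ⟨hpos.le, by linarith⟩, ?_⟩
  · have h1 := (jacobiField_hasDerivAt hQ hp (z (t - h))).comp t
      ((C.z_deriv (t - h)).comp_sub_const t h)
    have h2 := h1.hasDerivWithinAt (s := Icc 0 (2 * h))
    convert! h2 using 1
    ring
  · have := (C.jacobi_equation P (a := -h) (b := h) le_rfl (by linarith) le_rfl).1.comp_sub_right h
    convert! this using 1 <;> ring
  · have := (C.jacobi_equation P (a := -h) (b := t - h) le_rfl (by linarith [ht.1])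
      (by linarith [ht.2])).2
    simp only [zero_sub]
    rw [this, intervalIntegral.integral_comp_sub_right
      (fun t => gaussCurvature c (r t) * jacobiField Q p (z t)), zero_sub]
  · simp only [zero_sub]
    rw [hh, C.z_neg_half P, jacobiField_neg hQ hp, h0]
  · simp only [show 2 * h - h = h by ring]
    rw [hh, C.z_half P, h0]
  · simp only [sub_self, C.z_zero P, jacobiField, intervalIntegral.integral_same, sub_zero]
    exact (P.Q_pos p).ne'

/-- The radius of a chord with conjugate end points belongs to the exceptional set of the countable
conjugacy condition. -/
theorem conjugate_radius (h0 : jacobiField Q p √(ρ 1 ^ 2 - p ^ 2) = 0) :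
    σ p ∈ {s : ℝ | s ∈ Ioo R 1 ∧
      ∃ (T : ℝ) (γ v : ℝ → EuclideanSpace ℝ (Fin 2)),
        IsGeodesicSegment R c (outerBoundary 2) T γ v ∧
        IsLeast ((fun t => ‖γ t‖) '' Icc 0 T) s ∧
        EndpointsConjugate c T γ} := by
  obtain ⟨ι⟩ := exists_complex_isometry (le_refl 2)
  have hω : ‖(1 : ℂ)‖ = 1 := norm_one
  have hpos := C.half_pos P
  have h1 : σ p < 1 := by rw [← P.ρ_lt, P.ρ_σ]; exact C.p_lt
  refine ⟨⟨C.R_lt_σp P, h1⟩, _, _, _, C.geodesicSegment P ι hω, ⟨?_, ?_⟩,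
    C.endpointsConjugate P h0 ι hω⟩
  · refine ⟨chordHalf ρ p τ, ⟨hpos.le, by linarith⟩, ?_⟩
    simp only [C.norm_mul_curve P ι hω, sub_self, C.r_zero P]
  · rintro _ ⟨t, _, rfl⟩
    simp only [C.norm_mul_curve P ι hω]
    exact C.le_r P _

end Chord

end

section

variable {R : ℝ} {c ρ ρ' σ Q : ℝ → ℝ} (P : Profile R c ρ ρ' σ Q)
  (hc0 : R = 0 → derivWithin c (Icc R 1) 0 = 0)
include P hc0

namespace Profile

lemma halfAngle_eq {p : ℝ} (h1 : ρ R < p) (h2 : p < ρ 1) :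
    halfAngle ρ R p = ∫ y in (0 : ℝ)..√(ρ 1 ^ 2 - p ^ 2) / p,
      Q (p * √(1 + y ^ 2)) / (1 + y ^ 2) := by
  obtain ⟨τ, z, r, θ, C⟩ := exists_chord P h1 h2
  have hp := C.p_pos P
  have hσp : 0 < σ p := P.R_nonneg.trans_lt (C.R_lt_σp P)
  have hcc : ContinuousOn c (Icc R 1) := fun s hs => (P.c_deriv s hs).continuousWithinAt
  have h3 := C.setIntegral_radius P (f := fun s => p * c s ^ 2 / s ^ 2) (by
    refine ContinuousOn.div (continuousOn_const.mul
      ((hcc.mono (Icc_subset_Icc_left (C.R_lt_σp P).le)).pow 2)) (by fun_prop) fun s hs => ?_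
    exact pow_ne_zero _ (hσp.trans_le hs.1).ne') hc0
  have h4 : halfAngle ρ R p
      = ∫ s in Ioc R 1, p * c s ^ 2 / s ^ 2 * ρ s / (c s * √(ρ s ^ 2 - p ^ 2)) := by
    refine setIntegral_congr_fun measurableSet_Ioc fun s hs => ?_
    have hsI : s ∈ Icc R 1 := ⟨hs.1.le, hs.2⟩
    have hs0 : 0 < s := P.R_nonneg.trans_lt hs.1
    have hρ := P.ρ_pos hsI hs0
    rw [P.c_eq hsI hs0]
    field_simp
  have hZ := C.Z_pos P
  rw [h4, h3]
  have h5 := intervalIntegral.mul_integral_comp_mul_left (a := 0) (b := √(ρ 1 ^ 2 - p ^ 2) / p)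
    (f := fun x => p * c (σ √(p ^ 2 + x ^ 2)) ^ 2 / σ √(p ^ 2 + x ^ 2) ^ 2 * Q √(p ^ 2 + x ^ 2)) p
  rw [mul_zero, mul_div_cancel₀ _ hp.ne'] at h5
  rw [← h5, ← intervalIntegral.integral_const_mul]
  refine intervalIntegral.integral_congr fun y hy => ?_
  rw [uIcc_of_le (by positivity)] at hy
  have hsq : √(p ^ 2 + (p * y) ^ 2) = p * √(1 + y ^ 2) := by
    rw [show p ^ 2 + (p * y) ^ 2 = p ^ 2 * (1 + y ^ 2) by ring, Real.sqrt_mul (sq_nonneg p),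
      Real.sqrt_sq hp.le]
  have hle : p * √(1 + y ^ 2) ≤ ρ 1 := by
    rw [← hsq]
    apply Real.sqrt_le_iff.2 ⟨P.ρ_one_pos.le, ?_⟩
    have h6 : p * y ≤ √(ρ 1 ^ 2 - p ^ 2) := by
      have := hy.2
      rw [le_div_iff₀ hp] at this
      linarith
    have h7 := pow_le_pow_left₀ (mul_nonneg hp.le hy.1) h6 2
    rw [C.sq_Z P] at h7
    linarith
  have hge : p ≤ p * √(1 + y ^ 2) := by
    refine le_mul_of_one_le_right hp.le (Real.one_le_sqrt.2 ?_)
    nlinarith [sq_nonneg y]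
  set s := σ (p * √(1 + y ^ 2)) with hs
  have hρs : ρ s = p * √(1 + y ^ 2) := P.ρ_σ _
  have hsI : s ∈ Icc R 1 := ⟨by rw [← P.ρ_le, hρs]; linarith, by rw [← P.ρ_le, hρs]; exact hle⟩
  have hs0 : 0 < s := by
    refine hσp.trans_le ?_
    rw [← P.ρ_le, hρs, P.ρ_σ]; exact hge
  have h1y : 0 < √(1 + y ^ 2) := by positivity
  simp only [hsq]
  rw [← hs, P.c_eq hsI hs0, hρs]
  have h8 : √(1 + y ^ 2) ^ 2 = 1 + y ^ 2 := Real.sq_sqrt (by positivity)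
  obtain ⟨w, hw⟩ : ∃ w, w = √(1 + y ^ 2) := ⟨_, rfl⟩
  rw [← hw] at h8 h1y ⊢
  rw [← h8]
  field_simp

/-- The derivative of the angle of a chord with respect to its momentum is governed by the value of
the even Jacobi field at the end of the chord. -/
theorem hasDerivAt_halfAngle {p : ℝ} (h1 : ρ R < p) (h2 : p < ρ 1) :
    HasDerivAt (halfAngle ρ R)
      (-(jacobiField Q p √(ρ 1 ^ 2 - p ^ 2) / √(ρ 1 ^ 2 - p ^ 2))) p := by
  obtain ⟨τ, z, r, θ, C⟩ := exists_chord P h1 h2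
  have hp := C.p_pos P
  have hZ := C.Z_pos P
  obtain ⟨K, hQ⟩ := P.Q_lip
  set Z := √(ρ 1 ^ 2 - p ^ 2) with hZdef
  let Qt : ℝ → ℝ := fun u => Q (min u (ρ 1))
  have hQt : LipschitzWith K Qt := by
    have : LipschitzWith 1 fun u : ℝ => min u (ρ 1) := LipschitzWith.id.min_const _
    have h := hQ.comp this
    rwa [mul_one] at h
  let Y : ℝ → ℝ := fun q => √(ρ 1 ^ 2 - q ^ 2) / q
  have hYp : Y p = Z / p := rfl
  have hYpos : 0 < Y p := by rw [hYp]; positivity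
  have hmul : ∀ q > 0, ∀ y ≥ 0, q < ρ 1 → (q * √(1 + y ^ 2) ≤ ρ 1 ↔ y ≤ Y q) := by
    intro q hq y hy hq1
    have e1 : q * √(1 + y ^ 2) = √(q ^ 2 + (q * y) ^ 2) := by
      rw [show q ^ 2 + (q * y) ^ 2 = q ^ 2 * (1 + y ^ 2) by ring, Real.sqrt_mul (sq_nonneg q),
        Real.sqrt_sq hq.le]
    rw [e1, Real.sqrt_le_left P.ρ_one_pos.le, le_div_iff₀ hq, Real.le_sqrt (by nlinarith)]
    · constructor <;> intro h <;> nlinarith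
    · nlinarith
  set N : ℝ := Y p + 1 with hN
  have hYder : HasDerivAt Y (-(ρ 1 ^ 2) / (p ^ 2 * Z)) p := by
    have h3 : HasDerivAt (fun q => √(ρ 1 ^ 2 - q ^ 2)) (-(2 * p) / (2 * Z)) p := by
      have := (((hasDerivAt_id p).pow 2).const_sub (ρ 1 ^ 2)).sqrt
        (by simpa using (Real.sqrt_pos.1 hZ).ne')
      convert! this using 1
      simp [hZdef]
    have h4 := h3.div (hasDerivAt_id p) hp.ne'
    convert! h4 using 1
    have h5 : Z ^ 2 = ρ 1 ^ 2 - p ^ 2 := C.sq_Z P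
    simp only [id]
    rw [← hZdef]
    field_simp
    linarith
  have hev : ∀ᶠ q in 𝓝 p, ρ R < q ∧ q < ρ 1 ∧ Y q < N ∧ 0 < q := by
    refine (eventually_gt_nhds h1).and ((eventually_lt_nhds h2).and
      ((hYder.continuousAt.eventually (eventually_lt_nhds ?_)).and (eventually_gt_nhds hp)))
    rw [hN]; linarith
  have hgc : ∀ q : ℝ, Continuous fun y : ℝ => Qt (q * √(1 + y ^ 2)) / (1 + y ^ 2) := fun q =>
    (hQt.continuous.comp (by fun_prop)).div (by fun_prop) fun y => by positivity
  have hform : ∀ᶠ q in 𝓝 p, halfAngle ρ R q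
      = (∫ y in (0 : ℝ)..N, Qt (q * √(1 + y ^ 2)) / (1 + y ^ 2))
        - Q (ρ 1) * (Real.arctan N - Real.arctan (Y q)) := by
    filter_upwards [hev] with q ⟨hq1, hq2, hq3, hq0⟩
    have hYq : 0 ≤ Y q := by positivity
    rw [P.halfAngle_eq hc0 hq1 hq2,
      ← intervalIntegral.integral_add_adjacent_intervals (b := Y q)
        ((hgc q).intervalIntegrable _ _) ((hgc q).intervalIntegrable _ _)]
    have e1 : ∫ y in (0 : ℝ)..Y q, Qt (q * √(1 + y ^ 2)) / (1 + y ^ 2)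
        = ∫ y in (0 : ℝ)..Y q, Q (q * √(1 + y ^ 2)) / (1 + y ^ 2) := by
      refine intervalIntegral.integral_congr fun y hy => ?_
      rw [uIcc_of_le hYq] at hy
      simp only [Qt]
      rw [min_eq_left ((hmul q hq0 y hy.1 hq2).2 hy.2)]
    have e2 : ∫ y in Y q..N, Qt (q * √(1 + y ^ 2)) / (1 + y ^ 2)
        = ∫ y in Y q..N, Q (ρ 1) * (1 / (1 + y ^ 2)) := by
      refine intervalIntegral.integral_congr fun y hy => ?_
      rw [uIcc_of_le hq3.le] at hy
      simp only [Qt]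
      have : ρ 1 ≤ q * √(1 + y ^ 2) := by
        rcases hy.1.eq_or_lt with h | h
        · have e1 : q * √(1 + y ^ 2) = √(q ^ 2 + (q * y) ^ 2) := by
            rw [show q ^ 2 + (q * y) ^ 2 = q ^ 2 * (1 + y ^ 2) by ring,
              Real.sqrt_mul (sq_nonneg q), Real.sqrt_sq hq0.le]
          rw [e1, ← h]
          apply Real.le_sqrt_of_sq_le
          simp only [Y]
          rw [mul_div_cancel₀ _ hq0.ne', Real.sq_sqrt (by nlinarith)]
          linarith
        · by_contra hcon
          exact absurd ((hmul q hq0 y (hYq.trans hy.1) hq2).1 (not_le.1 hcon).le) (not_le.2 h)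
      rw [min_eq_right this]
      ring
    rw [e1, e2, intervalIntegral.integral_const_mul, integral_one_div_one_add_sq]
    ring
  have hN0 : 0 ≤ N := by linarith
  have hdiff : ∀ᵐ y : ℝ, DifferentiableAt ℝ Qt (p * √(1 + y ^ 2)) := by
    have := ae_comp_mul_sqrt (a := 1) hp (hQt.ae_differentiableAt (μ := volume))
    simpa only [one_pow] using this
  have hint := hasDerivAt_integral_of_dominated_loc_of_lip (𝕜 := ℝ)
    (μ := volume.restrict (Ioc 0 N)) (x₀ := p) (s := univ)
    (F := fun q y => Qt (q * √(1 + y ^ 2)) / (1 + y ^ 2))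
    (F' := fun y => deriv Qt (p * √(1 + y ^ 2)) * √(1 + y ^ 2) / (1 + y ^ 2))
    (bound := fun y => K * √(1 + y ^ 2) / (1 + y ^ 2)) univ_mem
    (Eventually.of_forall fun q => (hgc q).aestronglyMeasurable)
    ((hgc p).integrableOn_Ioc) (by
      refine Measurable.aestronglyMeasurable ?_
      have h1 := measurable_deriv Qt
      have h2 : Measurable fun y : ℝ => p * √(1 + y ^ 2) := by fun_prop
      exact ((h1.comp h2).mul (by fun_prop)).div (by fun_prop))
    (by
      refine Eventually.of_forall fun y => (LipschitzWith.of_dist_le_mul fun a b => ?_).lipschitzOnWith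
      have hb : 0 ≤ K * √(1 + y ^ 2) / (1 + y ^ 2) := by positivity
      rw [Real.coe_nnabs, abs_of_nonneg hb, Real.dist_eq, ← sub_div, abs_div,
        abs_of_pos (by positivity : 0 < 1 + y ^ 2)]
      have h3 := hQt.dist_le_mul (a * √(1 + y ^ 2)) (b * √(1 + y ^ 2))
      rw [Real.dist_eq, Real.dist_eq, ← sub_mul, abs_mul, abs_of_nonneg (Real.sqrt_nonneg _)] at h3
      rw [div_mul_eq_mul_div, Real.dist_eq]
      gcongr
      linarith)
    (by
      have : Continuous fun y : ℝ => K * √(1 + y ^ 2) / (1 + y ^ 2) :=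
        Continuous.div (by fun_prop) (by fun_prop) fun y => by positivity
      exact this.integrableOn_Ioc)
    (by
      filter_upwards [ae_restrict_of_ae hdiff] with y hy
      have h3 := (hy.hasDerivAt.comp p ((hasDerivAt_id p).mul_const √(1 + y ^ 2))).div_const
        (1 + y ^ 2)
      convert! h3 using 1
      rw [one_mul])
  have hslope : ∫ y in Ioc 0 N, deriv Qt (p * √(1 + y ^ 2)) * √(1 + y ^ 2) / (1 + y ^ 2)
      = jacobiSlope Q p Z := by
    have e0 : jacobiSlope Q p Z
        = ∫ y in (0 : ℝ)..Y p, deriv Q (p * √(1 + y ^ 2)) * √(1 + y ^ 2) / (1 + y ^ 2) := by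
      have h5 := intervalIntegral.mul_integral_comp_mul_left (a := 0) (b := Y p)
        (f := fun x => deriv Q √(p ^ 2 + x ^ 2) / √(p ^ 2 + x ^ 2)) p
      rw [mul_zero, hYp, mul_div_cancel₀ _ hp.ne'] at h5
      unfold jacobiSlope
      rw [← h5, ← intervalIntegral.integral_const_mul, hYp]
      refine intervalIntegral.integral_congr fun y _ => ?_
      have hsq : √(p ^ 2 + (p * y) ^ 2) = p * √(1 + y ^ 2) := by
        rw [show p ^ 2 + (p * y) ^ 2 = p ^ 2 * (1 + y ^ 2) by ring, Real.sqrt_mul (sq_nonneg p),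
          Real.sqrt_sq hp.le]
      simp only [hsq]
      have h8 : √(1 + y ^ 2) ^ 2 = 1 + y ^ 2 := Real.sq_sqrt (by positivity)
      have h9 : 0 < √(1 + y ^ 2) := by positivity
      obtain ⟨w, hw⟩ : ∃ w, w = √(1 + y ^ 2) := ⟨_, rfl⟩
      rw [← hw] at h8 h9 ⊢
      rw [← h8]
      field_simp
    rw [e0, intervalIntegral.integral_of_le hYpos.le, integral_Ioc_eq_integral_Ioo (x := 0) (y := Y p)]
    have hzero : ∀ y ∈ Ioc 0 N \ Ioo 0 (Y p), y ≠ Y p →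
        deriv Qt (p * √(1 + y ^ 2)) * √(1 + y ^ 2) / (1 + y ^ 2) = 0 := by
      intro y hy hne
      have hlt : Y p < y := by
        rcases lt_trichotomy y (Y p) with h | h | h
        · exact absurd ⟨hy.1.1, h⟩ hy.2
        · exact absurd h hne
        · exact h
      have h3 : ρ 1 < p * √(1 + y ^ 2) := by
        by_contra hcon
        exact absurd ((hmul p hp y hy.1.1.le h2).1 (not_lt.1 hcon)) (not_le.2 hlt)
      have h4 : Qt =ᶠ[𝓝 (p * √(1 + y ^ 2))] fun _ => Q (ρ 1) := by
        filter_upwards [eventually_gt_nhds h3] with u hu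
        simp only [Qt]
        rw [min_eq_right hu.le]
      rw [h4.deriv_eq, deriv_const, zero_mul, zero_div]
    have e2 : ∫ y in Ioc 0 N, deriv Qt (p * √(1 + y ^ 2)) * √(1 + y ^ 2) / (1 + y ^ 2)
        = ∫ y in Ioo 0 (Y p), deriv Qt (p * √(1 + y ^ 2)) * √(1 + y ^ 2) / (1 + y ^ 2) := by
      refine (setIntegral_eq_of_subset_of_ae_sdiff_eq_zero measurableSet_Ioc.nullMeasurableSet
        (fun y hy => ⟨hy.1, by rw [hN]; linarith [hy.2]⟩) ?_)
      filter_upwards [show ∀ᵐ y : ℝ, y ≠ Y p by simp [ae_iff]] with y hy hm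
      exact hzero y hm hy
    rw [e2]
    refine setIntegral_congr_fun measurableSet_Ioo fun y hy => ?_
    have h3 : p * √(1 + y ^ 2) < ρ 1 := by
      refine lt_of_le_of_ne ((hmul p hp y hy.1.le h2).2 hy.2.le) fun heq => ?_
      have h4 : p * √(1 + ((y + Y p) / 2) ^ 2) ≤ ρ 1 :=
        (hmul p hp _ (by linarith [hy.1]) h2).2 (by linarith [hy.2])
      have h5 : √(1 + y ^ 2) < √(1 + ((y + Y p) / 2) ^ 2) := by
        apply Real.sqrt_lt_sqrt (by positivity)
        nlinarith [hy.1, hy.2]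
      nlinarith
    have h4 : Qt =ᶠ[𝓝 (p * √(1 + y ^ 2))] Q := by
      filter_upwards [eventually_lt_nhds h3] with u hu
      simp only [Qt]
      rw [min_eq_left hu.le]
    rw [h4.deriv_eq]
  have htotal := (hint.2.sub ((hYder.arctan.const_sub (Real.arctan N)).const_mul (Q (ρ 1))))
  refine HasDerivAt.congr_of_eventuallyEq ?_ (f := fun q =>
    (∫ y in Ioc 0 N, Qt (q * √(1 + y ^ 2)) / (1 + y ^ 2))
        - Q (ρ 1) * (Real.arctan N - Real.arctan (Y q))) ?_
  · convert! htotal using 1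
    rw [hslope, jacobiField_eq hQ hp, C.sq_Z P, hYp]
    have h5 : ρ 1 ^ 2 = Z ^ 2 + p ^ 2 := by rw [C.sq_Z P]; ring
    rw [show √(p ^ 2 + (ρ 1 ^ 2 - p ^ 2)) = ρ 1 by
      rw [add_sub_cancel, Real.sqrt_sq P.ρ_one_pos.le]]
    have h6 : 1 + (Z / p) ^ 2 = ρ 1 ^ 2 / p ^ 2 := by
      rw [h5]; field_simp; ring
    rw [h6]
    have := P.ρ_one_pos
    field_simp
    ring
  · filter_upwards [hform] with q hq
    rw [hq, intervalIntegral.integral_of_le hN0]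

/-- Under the countable conjugacy condition the angle of chords is not locally constant. -/
theorem exists_halfAngle_ne (hcc : CountableConjugacy R c) {a b : ℝ} (ha : ρ R ≤ a) (hab : a < b)
    (hb : b ≤ ρ 1) : ∃ p ∈ Ioo a b, ∃ q ∈ Ioo a b, p < q ∧ halfAngle ρ R p ≠ halfAngle ρ R q := by
  by_contra hcon
  push Not at hcon
  have hconst : ∀ p ∈ Ioo a b, ∀ q ∈ Ioo a b, halfAngle ρ R p = halfAngle ρ R q := by
    intro p hp q hq
    rcases lt_trichotomy p q with h | h | h
    · exact hcon p hp q hq h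
    · rw [h]
    · exact (hcon q hq p hp h).symm
  have hsub : σ '' Ioo a b ⊆ {s : ℝ | s ∈ Ioo R 1 ∧
      ∃ (T : ℝ) (γ v : ℝ → EuclideanSpace ℝ (Fin 2)),
        IsGeodesicSegment R c (outerBoundary 2) T γ v ∧
        IsLeast ((fun t => ‖γ t‖) '' Icc 0 T) s ∧
        EndpointsConjugate c T γ} := by
    rintro _ ⟨p, hp, rfl⟩
    have h1 : ρ R < p := ha.trans_lt hp.1
    have h2 : p < ρ 1 := hp.2.trans_le hb
    obtain ⟨τ, z, r, θ, C⟩ := exists_chord P h1 h2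
    refine C.conjugate_radius P ?_
    have hd := P.hasDerivAt_halfAngle hc0 h1 h2
    have h0 : HasDerivAt (halfAngle ρ R) 0 p := by
      refine (hasDerivAt_const p (halfAngle ρ R p)).congr_of_eventuallyEq ?_
      filter_upwards [isOpen_Ioo.mem_nhds hp] with q hq using hconst q hq p hp
    have h3 := hd.unique h0
    rw [neg_eq_zero, div_eq_zero_iff] at h3
    exact h3.resolve_right (C.Z_pos P).ne'
  have hcount : (Ioo a b).Countable := by
    have h1 : (σ '' Ioo a b).Countable := hcc.mono hsub
    have h2 : ρ '' (σ '' Ioo a b) = Ioo a b := by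
      rw [← image_comp]
      have : ρ ∘ σ = id := funext P.ρ_σ
      rw [this, image_id]
    rw [← h2]
    exact h1.image ρ
  exact hcount.measure_zero volume |>.not_gt (by rw [Real.volume_Ioo]; simpa using hab)

end Profile

end

/-- The integral of a continuous radial function over a disc in terms of its integrals over
parallel chords. -/
lemma integral_disc_eq_zero {g : ℝ → ℝ} (hg : Continuous g) {M : ℝ} (hM : 0 < M)
    (h : ∀ m ∈ Ioo (-M) M, ∫ x in (0 : ℝ)..√(M ^ 2 - m ^ 2), g (m ^ 2 + x ^ 2) = 0) :
    ∫ t in (0 : ℝ)..M, t * g (t ^ 2) = 0 := by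
  set φ : ℝ → ℝ := (Iio (M ^ 2)).indicator g with hφ
  let f : ℝ × ℝ → ℝ := fun q => φ (q.1 ^ 2 + q.2 ^ 2)
  obtain ⟨A, hA⟩ := (isCompact_Icc (a := 0) (b := M ^ 2)).exists_bound_of_continuousOn
    hg.continuousOn
  have hφm : Measurable φ := hg.measurable.indicator measurableSet_Iio
  have hfm : Measurable f := hφm.comp (by fun_prop)
  have hfint : Integrable f (volume.prod volume) := by
    have h1 : IntegrableOn f (Icc (-M) M ×ˢ Icc (-M) M) (volume.prod volume) := by
      refine Measure.integrableOn_of_bounded (M := |A|) ?_ hfm.aestronglyMeasurable ?_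
      · exact ((isCompact_Icc.prod isCompact_Icc).measure_lt_top).ne
      · refine Eventually.of_forall fun q => ?_
        simp only [f, hφ]
        by_cases hq : q.1 ^ 2 + q.2 ^ 2 ∈ Iio (M ^ 2)
        · rw [indicator_of_mem hq]
          exact (hA _ ⟨by positivity, le_of_lt hq⟩).trans (le_abs_self A)
        · rw [indicator_of_notMem hq, norm_zero]
          exact abs_nonneg A
    refine (integrableOn_iff_integrable_of_support_subset fun q hq => ?_).1 h1
    by_contra hcon
    apply hq
    simp only [f, hφ]
    refine indicator_of_notMem (fun hlt => hcon ?_) _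
    have hlt' : q.1 ^ 2 + q.2 ^ 2 < M ^ 2 := hlt
    exact ⟨abs_le.1 (abs_le_of_sq_le_sq (by nlinarith [sq_nonneg q.2]) hM.le),
      abs_le.1 (abs_le_of_sq_le_sq (by nlinarith [sq_nonneg q.1]) hM.le)⟩
  have hplane : ∫ q, f q = 0 := by
    rw [Measure.volume_eq_prod, integral_prod _ hfint]
    refine integral_eq_zero_of_ae (Eventually.of_forall fun m => ?_)
    simp only [f, Pi.zero_apply]
    by_cases hm : m ∈ Ioo (-M) M
    · have hpos : 0 < M ^ 2 - m ^ 2 := by nlinarith [hm.1, hm.2]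
      set s := √(M ^ 2 - m ^ 2) with hs
      have hs0 : 0 < s := Real.sqrt_pos.2 hpos
      have hss : s ^ 2 = M ^ 2 - m ^ 2 := Real.sq_sqrt hpos.le
      have e1 : (fun x => φ (m ^ 2 + x ^ 2)) = (Ioo (-s) s).indicator fun x => g (m ^ 2 + x ^ 2) := by
        funext x
        simp only [hφ, indicator]
        have : m ^ 2 + x ^ 2 ∈ Iio (M ^ 2) ↔ x ∈ Ioo (-s) s := by
          rw [mem_Iio, mem_Ioo, ← abs_lt, ← sq_lt_sq₀ (abs_nonneg x) hs0.le, sq_abs, hss]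
          constructor <;> intro _ <;> linarith
        simp only [this]
      have hc : Continuous fun x : ℝ => g (m ^ 2 + x ^ 2) := by fun_prop
      rw [e1, integral_indicator measurableSet_Ioo, ← integral_Ioc_eq_integral_Ioo,
        ← intervalIntegral.integral_of_le (by linarith),
        ← intervalIntegral.integral_add_adjacent_intervals (b := 0) (hc.intervalIntegrable _ _)
          (hc.intervalIntegrable _ _)]
      have h2 := intervalIntegral.integral_comp_neg (a := 0) (b := s)
        (f := fun x : ℝ => g (m ^ 2 + x ^ 2))
      simp only [neg_sq, neg_zero] at h2
      rw [← h2, hs, h m hm, add_zero]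
    · refine integral_eq_zero_of_ae (Eventually.of_forall fun x => ?_)
      refine indicator_of_notMem (fun hlt => hm ?_) _
      have hlt' : m ^ 2 + x ^ 2 < M ^ 2 := hlt
      exact abs_lt.1 (abs_lt_of_sq_lt_sq (by nlinarith [sq_nonneg x]) hM.le)
  rw [← integral_comp_polarCoord_symm f] at hplane
  have e2 : ∀ q : ℝ × ℝ, q.1 • f (polarCoord.symm q) = (q.1 * φ (q.1 ^ 2)) * 1 := fun q => by
    simp only [f, polarCoord_symm_apply, smul_eq_mul, mul_one]
    congr 2
    rw [mul_pow, mul_pow, ← mul_add, Real.cos_sq_add_sin_sq, mul_one]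
  simp only [e2, polarCoord_target, Measure.volume_eq_prod] at hplane
  rw [setIntegral_prod_mul (fun t : ℝ => t * φ (t ^ 2)) (fun _ : ℝ => (1 : ℝ))] at hplane
  have h3 : ∫ _ in Ioo (-Real.pi) Real.pi, (1 : ℝ) = 2 * Real.pi := by
    simp [Real.pi_pos.le]
    ring
  rw [h3, mul_eq_zero_iff_right (by positivity)] at hplane
  have h4 : ∫ t in Ioi (0 : ℝ), t * φ (t ^ 2) = ∫ t in Ioo 0 M, t * φ (t ^ 2) := by
    refine setIntegral_eq_of_subset_of_forall_sdiff_eq_zero measurableSet_Ioi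
      (fun t ht => ht.1) fun t ht => ?_
    have : ¬ t ^ 2 ∈ Iio (M ^ 2) := fun hlt =>
      ht.2 ⟨ht.1, lt_of_pow_lt_pow_left₀ 2 hM.le hlt⟩
    rw [hφ, indicator_of_notMem this, mul_zero]
  rw [intervalIntegral.integral_of_le hM.le, integral_Ioc_eq_integral_Ioo]
  refine Eq.trans ?_ hplane
  rw [h4]
  refine setIntegral_congr_fun measurableSet_Ioo fun t ht => ?_
  have : t ^ 2 ∈ Iio (M ^ 2) := pow_lt_pow_left₀ ht.2 ht.1.le two_ne_zero
  simp only [hφ, indicator_of_mem this]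

/-- Injectivity of the Abel transform: a continuous function whose integrals over a dense set of
chords vanish is zero. -/
theorem eq_zero_of_abel {k : ℝ → ℝ} {a b : ℝ} (ha : 0 ≤ a) (hab : a < b)
    (hk : ContinuousOn k (Icc a b))
    (h : ∀ p₁ p₂, a ≤ p₁ → p₁ < p₂ → p₂ ≤ b → ∃ p ∈ Ioo p₁ p₂,
      ∫ x in (0 : ℝ)..√(b ^ 2 - p ^ 2), k √(p ^ 2 + x ^ 2) = 0) :
    ∀ u ∈ Ioo a b, k u = 0 := by
  let kt : ℝ → ℝ := fun u => k (projIcc a b hab.le u)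
  have hkt : Continuous kt :=
    hk.comp_continuous (continuous_subtype_val.comp continuous_projIcc) fun t =>
      (projIcc a b hab.le t).2
  have hkeq : ∀ u ∈ Icc a b, kt u = k u := fun u hu => by simp only [kt, projIcc_of_mem hab.le hu]
  let W : ℝ → ℝ := fun p => ∫ x in (0 : ℝ)..√(b ^ 2 - p ^ 2), kt √(p ^ 2 + x ^ 2)
  have hW : Continuous W := by
    refine intervalIntegral.continuous_parametric_intervalIntegral_of_continuous
      (f := fun p x => kt √(p ^ 2 + x ^ 2)) ?_ (by fun_prop)
    exact hkt.comp (by fun_prop)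
  have hWeq : ∀ p ∈ Ioo a b, W p = ∫ x in (0 : ℝ)..√(b ^ 2 - p ^ 2), k √(p ^ 2 + x ^ 2) := by
    intro p hp
    refine intervalIntegral.integral_congr fun x hx => ?_
    have hp0 : 0 ≤ p := ha.trans hp.1.le
    rw [uIcc_of_le (Real.sqrt_nonneg _)] at hx
    refine hkeq _ ⟨?_, ?_⟩
    · exact hp.1.le.trans (Real.le_sqrt_of_sq_le (by nlinarith [sq_nonneg x]))
    · have h1 := pow_le_pow_left₀ hx.1 hx.2 2
      rw [Real.sq_sqrt (by nlinarith [hp.2])] at h1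
      exact Real.sqrt_le_iff.2 ⟨by linarith [hp.2], by linarith⟩
  have hW0 : ∀ p ∈ Ioo a b, W p = 0 := by
    intro p hp
    by_contra hne
    have hopen : IsOpen (W ⁻¹' {0}ᶜ ∩ Ioo a b) :=
      (isOpen_compl_singleton.preimage hW).inter isOpen_Ioo
    obtain ⟨δ, hδ, hball⟩ := Metric.isOpen_iff.1 hopen p ⟨hne, hp⟩
    have hsub : Ioo (p - δ) (p + δ) ⊆ W ⁻¹' {0}ᶜ ∩ Ioo a b := by
      rwa [Real.ball_eq_Ioo] at hball
    obtain ⟨q, hq, hq0⟩ := h p (min (p + δ) b) hp.1.le (lt_min (by linarith) hp.2)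
      (min_le_right _ _)
    have hqm := hsub ⟨by linarith [hq.1], hq.2.trans_le (min_le_left _ _)⟩
    exact hqm.1 (by rw [mem_singleton_iff, hWeq q hqm.2, hq0])
  have hH : ∀ q ∈ Ioo a b, ∫ u in q..b, u * kt u = 0 := by
    intro q hq
    have hq0 : 0 < q := ha.trans_lt hq.1
    have hpos : 0 < b ^ 2 - q ^ 2 := by nlinarith [hq.2]
    set M := √(b ^ 2 - q ^ 2) with hM
    have hM0 : 0 < M := Real.sqrt_pos.2 hpos
    have hMM : M ^ 2 = b ^ 2 - q ^ 2 := Real.sq_sqrt hpos.le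
    have h1 := integral_disc_eq_zero (g := fun v => kt √(q ^ 2 + v)) (by fun_prop) hM0
      (fun m hm => by
        have hm2 : m ^ 2 < M ^ 2 := by nlinarith [hm.1, hm.2]
        have hsq : √(q ^ 2 + m ^ 2) ^ 2 = q ^ 2 + m ^ 2 := Real.sq_sqrt (by positivity)
        have hp : √(q ^ 2 + m ^ 2) ∈ Ioo a b := by
          refine ⟨hq.1.trans_le (Real.le_sqrt_of_sq_le (by nlinarith [sq_nonneg m])), ?_⟩
          exact (Real.sqrt_lt' (by linarith [hq.2])).2 (by linarith)
        have h2 := hW0 _ hp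
        simp only [W, hsq] at h2
        rw [hMM, show b ^ 2 - q ^ 2 - m ^ 2 = b ^ 2 - (q ^ 2 + m ^ 2) by ring]
        refine Eq.trans ?_ h2
        simp only [add_assoc])
    have hder : ∀ t : ℝ, HasDerivAt (fun t => √(q ^ 2 + t ^ 2)) (t / √(q ^ 2 + t ^ 2)) t :=
      fun t => hasDerivAt_sqrt_add_sq hq0 t
    have h3 := intervalIntegral.integral_comp_mul_deriv (a := 0) (b := M)
      (f := fun t => √(q ^ 2 + t ^ 2)) (f' := fun t => t / √(q ^ 2 + t ^ 2))
      (g := fun u => u * kt u) (fun t _ => hder t)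
      (Continuous.continuousOn (continuous_id.div (by fun_prop) fun t => by positivity))
      (by fun_prop)
    have e0 : √(q ^ 2 + 0 ^ 2) = q := by rw [zero_pow two_ne_zero, add_zero, Real.sqrt_sq hq0.le]
    have eM : √(q ^ 2 + M ^ 2) = b := by
      rw [hMM, add_sub_cancel, Real.sqrt_sq (by linarith [hq.2])]
    simp only [e0, eM] at h3
    rw [← h3]
    refine Eq.trans ?_ h1
    refine intervalIntegral.integral_congr fun t _ => ?_
    have : 0 < √(q ^ 2 + t ^ 2) := by positivity
    simp only [Function.comp_apply]
    field_simp
  intro u hu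
  have hu0 : 0 < u := ha.trans_lt hu.1
  have hd : HasDerivAt (fun q => ∫ x in q..b, x * kt x) (-(u * kt u)) u := by
    have hc : Continuous fun x => x * kt x := by fun_prop
    exact intervalIntegral.integral_hasDerivAt_left (hc.intervalIntegrable _ _)
      hc.aestronglyMeasurable.stronglyMeasurableAtFilter hc.continuousAt
  have h0 : HasDerivAt (fun q => ∫ x in q..b, x * kt x) 0 u := by
    refine (hasDerivAt_const u (0 : ℝ)).congr_of_eventuallyEq ?_
    filter_upwards [isOpen_Ioo.mem_nhds hu] with q hq using hH q hq
  have h5 := hd.unique h0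
  rw [neg_eq_zero, mul_eq_zero] at h5
  rw [← hkeq u (Ioo_subset_Icc_self hu)]
  exact h5.resolve_left hu0.ne'

/-- Local uniform bounds for a family of functions depending `C¹`-smoothly on a parameter. -/
lemma exists_deriv_of_contDiffOn {ε R τ₀ : ℝ} (hR1 : R < 1) {w : ℝ → ℝ → ℝ}
    (hw : ContDiffOn ℝ 1 (fun q : ℝ × ℝ => w q.1 q.2) (Ioo (-ε) ε ×ˢ Icc R 1))
    (hτ : τ₀ ∈ Ioo (-ε) ε) :
    ∃ (w' : ℝ → ℝ) (η C A : ℝ), 0 < η ∧ Metric.ball τ₀ η ⊆ Ioo (-ε) ε ∧ 0 ≤ C ∧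
      ContinuousOn w' (Icc R 1) ∧ (∀ s ∈ Icc R 1, HasDerivAt (fun τ => w τ s) (w' s) τ₀) ∧
      (∀ τ ∈ Metric.ball τ₀ η, ∀ s ∈ Icc R 1, |w τ s - w τ₀ s| ≤ C * |τ - τ₀|) ∧
      ∀ τ ∈ Metric.ball τ₀ η, ∀ s ∈ Icc R 1, |w τ s| ≤ A := by
  set U := Ioo (-ε) ε ×ˢ Icc R 1 with hU
  have hud : UniqueDiffOn ℝ U := isOpen_Ioo.uniqueDiffOn.prod (uniqueDiffOn_Icc hR1)
  let D : ℝ × ℝ → ℝ := fun q => fderivWithin ℝ (fun q : ℝ × ℝ => w q.1 q.2) U q (1, 0)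
  have hD : ContinuousOn D U := (hw.continuousOn_fderivWithin hud le_rfl).clm_apply
    continuousOn_const
  have hder : ∀ τ ∈ Ioo (-ε) ε, ∀ s ∈ Icc R 1, HasDerivAt (fun τ => w τ s) (D (τ, s)) τ := by
    intro τ hτ s hs
    have h1 := ((hw.differentiableOn one_ne_zero) (τ, s) ⟨hτ, hs⟩).hasFDerivWithinAt
    have h2 : HasDerivAt (fun τ : ℝ => (τ, s)) ((1 : ℝ), (0 : ℝ)) τ :=
      (hasDerivAt_id τ).prodMk (hasDerivAt_const τ s)
    refine h1.comp_hasDerivAt τ h2 ?_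
    filter_upwards [isOpen_Ioo.mem_nhds hτ] with x hx using ⟨hx, hs⟩
  obtain ⟨δ, hδ, hδU⟩ := Metric.isOpen_iff.1 isOpen_Ioo τ₀ hτ
  have hcb : Metric.closedBall τ₀ (δ / 2) ⊆ Ioo (-ε) ε :=
    (Metric.closedBall_subset_ball (by linarith)).trans hδU
  have hK : IsCompact (Metric.closedBall τ₀ (δ / 2) ×ˢ Icc R 1) :=
    (isCompact_closedBall _ _).prod isCompact_Icc
  have hKU : Metric.closedBall τ₀ (δ / 2) ×ˢ Icc R 1 ⊆ U := prod_mono_left hcb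
  obtain ⟨C, hC⟩ := hK.exists_bound_of_continuousOn (hD.mono hKU)
  obtain ⟨A, hA⟩ := hK.exists_bound_of_continuousOn (hw.continuousOn.mono hKU)
  have hb := Metric.ball_subset_closedBall (x := τ₀) (ε := δ / 2)
  refine ⟨fun s => D (τ₀, s), δ / 2, |C|, A, by linarith, hb.trans hcb, abs_nonneg _,
    hD.comp (by fun_prop) fun s hs => ⟨hτ, hs⟩, fun s hs => hder τ₀ hτ s hs, fun τ hτ s hs => ?_,
    fun τ hτ s hs => hA (τ, s) ⟨hb hτ, hs⟩⟩
  exact (convex_ball τ₀ (δ / 2)).norm_image_sub_le_of_norm_hasDerivWithin_le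
    (f := fun τ => w τ s) (f' := fun τ => D (τ, s))
    (fun x hx => (hder x (hcb (hb hx)) s hs).hasDerivWithinAt)
    (fun x hx => (hC (x, s) ⟨hb hx, hs⟩).trans (le_abs_self C))
    (Metric.mem_ball_self (by linarith)) hτ

/-- If the local maximal values of `F τ` on an interval lie in a null set, then the maximum does
not depend on `τ`, so that `τ ↦ F τ p` has a local maximum for some `p`. -/
lemma exists_isLocalMax_param {F : ℝ → ℝ → ℝ} {τ₀ η p₁ p₂ d₁ d₂ : ℝ} {S : Set ℝ} (hη : 0 < η)
    (hp : p₁ < p₂)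
    (hF : ContinuousOn (fun q : ℝ × ℝ => F q.1 q.2) (Metric.ball τ₀ η ×ˢ Icc p₁ p₂))
    (h₁ : HasDerivAt (F τ₀) d₁ p₁) (hd₁ : 0 < d₁) (h₂ : HasDerivAt (F τ₀) d₂ p₂) (hd₂ : d₂ < 0)
    (hS : volume S = 0)
    (hmem : ∀ τ ∈ Metric.ball τ₀ η, ∀ p ∈ Ioo p₁ p₂, IsLocalMax (F τ) p → F τ p ∈ S) :
    ∃ p ∈ Ioo p₁ p₂, IsLocalMax (fun τ => F τ p) τ₀ := by
  have hτ₀ : τ₀ ∈ Metric.ball τ₀ η := Metric.mem_ball_self hη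
  have hτc : ∀ p ∈ Icc p₁ p₂, ContinuousAt (fun τ => F τ p) τ₀ := fun p hp =>
    (hF.comp (f := fun τ => (τ, p)) (s := Metric.ball τ₀ η) (by fun_prop)
      fun τ hτ => ⟨hτ, hp⟩).continuousAt (Metric.ball_mem_nhds _ hη)
  have hpc : ∀ τ ∈ Metric.ball τ₀ η, ContinuousOn (F τ) (Icc p₁ p₂) := fun τ hτ =>
    hF.comp (f := fun p => (τ, p)) (by fun_prop) fun p hp => ⟨hτ, hp⟩
  have l1 : p₁ ∈ Icc p₁ p₂ := left_mem_Icc.2 hp.le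
  have l2 : p₂ ∈ Icc p₁ p₂ := right_mem_Icc.2 hp.le
  obtain ⟨q₁, hq₁, hlt₁⟩ : ∃ q ∈ Icc p₁ p₂, F τ₀ p₁ < F τ₀ q := by
    by_contra! hcon
    have hl : IsLocalMaxOn (F τ₀) (Icc p₁ p₂) p₁ := IsMaxOn.localize hcon
    have h := hl.hasFDerivWithinAt_nonpos h₁.hasFDerivAt.hasFDerivWithinAt
      (sub_mem_posTangentConeAt_of_segment_subset (y := p₂) (segment_eq_Icc hp.le).subset)
    simp only [ContinuousLinearMap.toSpanSingleton_apply, smul_eq_mul] at h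
    nlinarith
  obtain ⟨q₂, hq₂, hlt₂⟩ : ∃ q ∈ Icc p₁ p₂, F τ₀ p₂ < F τ₀ q := by
    by_contra! hcon
    have hl : IsLocalMaxOn (F τ₀) (Icc p₁ p₂) p₂ := IsMaxOn.localize hcon
    have h := hl.hasFDerivWithinAt_nonpos h₂.hasFDerivAt.hasFDerivWithinAt
      (sub_mem_posTangentConeAt_of_segment_subset (y := p₁)
        ((segment_symm ℝ p₂ p₁).trans (segment_eq_Icc hp.le)).subset)
    simp only [ContinuousLinearMap.toSpanSingleton_apply, smul_eq_mul] at h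
    nlinarith
  have hev : ∀ᶠ τ in 𝓝 τ₀, τ ∈ Metric.ball τ₀ η ∧ F τ p₁ < F τ q₁ ∧ F τ p₂ < F τ q₂ :=
    (show ∀ᶠ τ in 𝓝 τ₀, τ ∈ Metric.ball τ₀ η from Metric.ball_mem_nhds _ hη).and <|
      ((hτc _ l1).eventually_lt (hτc _ hq₁) hlt₁).and ((hτc _ l2).eventually_lt (hτc _ hq₂) hlt₂)
  obtain ⟨δ, hδ, hball⟩ := Metric.eventually_nhds_iff_ball.1 hev
  let m : ℝ → ℝ := fun τ => sSup (F τ '' Icc p₁ p₂)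
  have hmax : ∀ τ ∈ Metric.ball τ₀ δ, ∃ p ∈ Ioo p₁ p₂, m τ = F τ p ∧ ∀ q ∈ Icc p₁ p₂, F τ q ≤ F τ p := by
    intro τ hτ
    obtain ⟨hτη, e1, e2⟩ := hball τ hτ
    obtain ⟨p, hpI, hpe, hpm⟩ := isCompact_Icc.exists_sSup_image_eq_and_ge ⟨p₁, l1⟩ (hpc τ hτη)
    refine ⟨p, ⟨hpI.1.lt_of_ne ?_, hpI.2.lt_of_ne ?_⟩, hpe, hpm⟩
    · rintro rfl
      exact absurd (hpm _ hq₁) (not_le.2 e1)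
    · rintro rfl
      exact absurd (hpm _ hq₂) (not_le.2 e2)
  have hmS : m '' Metric.ball τ₀ δ ⊆ S := by
    rintro _ ⟨τ, hτ, rfl⟩
    obtain ⟨p, hpI, hpe, hpm⟩ := hmax τ hτ
    rw [hpe]
    refine hmem τ (hball τ hτ).1 p hpI ?_
    filter_upwards [Icc_mem_nhds hpI.1 hpI.2] with q hq using hpm q hq
  have hmc : ContinuousOn m (Metric.ball τ₀ δ) := by
    rw [continuousOn_iff_continuous_domRestrict]
    have := isCompact_univ.continuous_sSup (K := (univ : Set (Icc p₁ p₂)))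
      (f := fun (τ : Metric.ball τ₀ δ) (p : Icc p₁ p₂) => F τ p) (by
        refine hF.comp_continuous (f := fun q : Metric.ball τ₀ δ × Icc p₁ p₂ =>
          ((q.1 : ℝ), (q.2 : ℝ))) (by fun_prop) fun q => ⟨(hball q.1 q.1.2).1, q.2.2⟩)
    convert! this using 2 with τ
    simp only [Set.domRestrict_apply, m, image_univ]
    congr 1
    ext y
    simp
  have hconst : ∀ τ ∈ Metric.ball τ₀ δ, m τ = m τ₀ := by
    intro τ hτ
    have hpre : (m '' Metric.ball τ₀ δ).OrdConnected :=
      ((convex_ball τ₀ δ).isPreconnected.image m hmc).ordConnected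
    have hz : volume (uIcc (m τ) (m τ₀)) = 0 := measure_mono_null
      ((hpre.uIcc_subset (mem_image_of_mem m hτ)
        (mem_image_of_mem m (Metric.mem_ball_self hδ))).trans hmS) hS
    rw [Real.volume_interval, ENNReal.ofReal_eq_zero] at hz
    linarith [abs_nonpos_iff.1 hz]
  obtain ⟨p, hpI, hpe, -⟩ := hmax τ₀ (Metric.mem_ball_self hδ)
  refine ⟨p, hpI, ?_⟩
  filter_upwards [Metric.ball_mem_nhds _ hδ] with τ hτ
  obtain ⟨q, -, hqe, hqm⟩ := hmax τ hτ
  rw [← hpe, ← hconst τ hτ, hqe]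
  exact hqm p (Ioo_subset_Icc_self hpI)

/-- Continuity of the intercept function in the sound speed and the momentum. -/
lemma continuousOn_intercept {w : ℝ → ℝ → ℝ} {R τ₀ η A : ℝ} (hR : 0 ≤ R)
    (hw : ContinuousOn (fun q : ℝ × ℝ => w q.1 q.2) (Metric.ball τ₀ η ×ˢ Icc R 1))
    (hA : ∀ τ ∈ Metric.ball τ₀ η, ∀ s ∈ Icc R 1, |w τ s| ≤ A) :
    ContinuousOn (fun q : ℝ × ℝ => intercept (fun s => s * w q.1 s) R q.2)
      (Metric.ball τ₀ η ×ˢ univ) := by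
  refine continuousOn_of_dominated (bound := fun _ => A) (fun q hq => ?_) (fun q hq => ?_)
    (integrable_const _) ?_
  · refine ContinuousOn.aestronglyMeasurable ?_ measurableSet_Ioc
    have h1 : ContinuousOn (fun s => w q.1 s) (Ioc R 1) :=
      hw.comp (f := fun s => (q.1, s)) (by fun_prop) fun s hs => ⟨hq.1, Ioc_subset_Icc_self hs⟩
    exact ContinuousOn.div (by fun_prop) continuousOn_id fun s hs => (hR.trans_lt hs.1).ne'
  · filter_upwards [ae_restrict_mem measurableSet_Ioc] with s hs
    have hs0 : 0 < s := hR.trans_lt hs.1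
    rw [Real.norm_of_nonneg (by positivity), div_le_iff₀ hs0]
    refine (Real.sqrt_le_sqrt (sub_le_self _ (sq_nonneg q.2))).trans ?_
    rw [Real.sqrt_sq_eq_abs, abs_mul, abs_of_pos hs0, mul_comm]
    exact mul_le_mul_of_nonneg_right (hA _ hq.1 s (Ioc_subset_Icc_self hs)) hs0.le
  · filter_upwards [ae_restrict_mem measurableSet_Ioc] with s hs
    have h1 : ContinuousOn (fun q : ℝ × ℝ => w q.1 s) (Metric.ball τ₀ η ×ˢ univ) :=
      hw.comp (f := fun q : ℝ × ℝ => (q.1, s)) (by fun_prop)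
        fun q hq => ⟨hq.1, Ioc_subset_Icc_self hs⟩
    exact (((continuousOn_const.mul h1).pow 2).sub (by fun_prop)).sqrt.div_const s

/-- The derivative of the intercept function with respect to the sound speed. -/
lemma hasDerivAt_intercept_param {w : ℝ → ℝ → ℝ} {w' : ℝ → ℝ} {R τ₀ η C A p : ℝ}
    {c ρ ρ' σ Q : ℝ → ℝ} (P : Profile R c ρ ρ' σ Q) (hη : 0 < η) (hC : 0 ≤ C) (hp : 0 < p)
    (hwc : ∀ s ∈ Icc R 1, w τ₀ s = (c s)⁻¹)
    (hw : ContinuousOn (fun q : ℝ × ℝ => w q.1 q.2) (Metric.ball τ₀ η ×ˢ Icc R 1))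
    (hw' : ContinuousOn w' (Icc R 1))
    (hder : ∀ s ∈ Icc R 1, HasDerivAt (fun τ => w τ s) (w' s) τ₀)
    (hlip : ∀ τ ∈ Metric.ball τ₀ η, ∀ s ∈ Icc R 1, |w τ s - w τ₀ s| ≤ C * |τ - τ₀|)
    (hA : ∀ τ ∈ Metric.ball τ₀ η, ∀ s ∈ Icc R 1, |w τ s| ≤ A) :
    HasDerivAt (fun τ => intercept (fun s => s * w τ s) R p)
      (∫ s in Ioc R 1, (w' s * c s) * ρ s / (c s * √(ρ s ^ 2 - p ^ 2))) τ₀ := by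
  have hτ₀ : τ₀ ∈ Metric.ball τ₀ η := Metric.mem_ball_self hη
  have hI : ∀ s ∈ Ioc R 1, s ∈ Icc R 1 := fun s hs => Ioc_subset_Icc_self hs
  have hA0 : 0 ≤ A := (abs_nonneg _).trans (hA _ hτ₀ _ P.mem_one)
  have hwτ : ∀ τ ∈ Metric.ball τ₀ η, ContinuousOn (w τ) (Ioc R 1) := fun τ hτ =>
    hw.comp (f := fun s => (τ, s)) (by fun_prop) fun s hs => ⟨hτ, hI s hs⟩
  have hρ : ∀ s ∈ Icc R 1, ρ s = s * w τ₀ s := fun s hs => by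
    rw [P.ρ_eq s hs, hwc s hs, div_eq_mul_inv]
  obtain ⟨κ, hκ, hlow⟩ := P.exists_low hp
  obtain ⟨B, hB⟩ := P.exists_inv_c_le
  have h := hasDerivAt_integral_sqrt_div P.R_nonneg
    (a := fun τ s => (s * w τ s) ^ 2 - p ^ 2) (a' := fun s => 2 * s ^ 2 * w τ₀ s * w' s) (x₀ := τ₀)
    (A := B) (C := 2 * A * C) (W := A / p) (κ := κ) (r₀ := σ p) hη hκ (by positivity)
    (fun τ hτ => ?_) ?_ (fun s hs τ hτ => ?_) (fun s hs => ?_) (fun s hs => ?_) (fun s hs => ?_)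
    (fun s hs => ?_)
  · convert! h using 1
    refine setIntegral_congr_fun measurableSet_Ioc fun s hs => ?_
    have hs0 : 0 < s := P.R_nonneg.trans_lt hs.1
    have hc := P.c_pos s (hI s hs)
    rw [← hρ s (hI s hs)]
    rcases eq_or_ne (√(ρ s ^ 2 - p ^ 2)) 0 with h0 | h0
    · simp only [h0, mul_zero, div_zero, zero_div]
    · rw [P.ρ_eq s (hI s hs)] at h0 ⊢
      rw [hwc s (hI s hs)]
      field_simp
  · have := hwτ τ hτ
    fun_prop
  · have h1 := hwτ τ₀ hτ₀
    have h2 := hw'.mono Ioc_subset_Icc_self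
    fun_prop
  · have hs0 : 0 < s := P.R_nonneg.trans_lt hs.1
    have e : (s * w τ s) ^ 2 - p ^ 2 - ((s * w τ₀ s) ^ 2 - p ^ 2)
        = s ^ 2 * ((w τ s + w τ₀ s) * (w τ s - w τ₀ s)) := by ring
    rw [e, abs_mul, abs_mul, abs_of_nonneg (sq_nonneg s)]
    have hs1 : s ^ 2 ≤ 1 := pow_le_one₀ hs0.le hs.2
    have h1 : |w τ s + w τ₀ s| ≤ 2 * A :=
      (abs_add_le _ _).trans (by linarith [hA _ hτ s (hI s hs), hA _ hτ₀ s (hI s hs)])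
    calc _ ≤ 1 * (2 * A * (C * |τ - τ₀|)) := by
          have := hlip τ hτ s (hI s hs)
          gcongr
      _ = _ := by ring
  · have := (((hder s (hI s hs)).const_mul s).pow 2).sub_const (p ^ 2)
    convert! this using 1
    norm_num
    ring
  · rw [← hρ s (hI s hs)]
    exact hlow s hs
  · have hs0 : 0 < s := P.R_nonneg.trans_lt hs.1
    rcases le_total p (s * A) with h | h
    · left
      rw [div_le_div_iff₀ hs0 hp]
      linarith
    · right
      intro τ hτ
      have h1 : |s * w τ s| ≤ p := by
        rw [abs_mul, abs_of_pos hs0]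
        exact (mul_le_mul_of_nonneg_left (hA τ hτ s (hI s hs)) hs0.le).trans h
      simp only [sub_nonpos]
      exact sq_le_sq.2 (by rwa [abs_of_pos hp])
  · rw [← hρ s (hI s hs)]
    exact (P.sqrt_div_le hs).trans (hB s (hI s hs))

lemma Profile.intercept_eq {R : ℝ} {c ρ ρ' σ Q : ℝ → ℝ} (P : Profile R c ρ ρ' σ Q) :
    intercept (fun s => s * (c s)⁻¹) R = intercept ρ R := by
  funext p
  refine setIntegral_congr_fun measurableSet_Ioc fun s hs => ?_
  simp only [P.ρ_eq s (Ioc_subset_Icc_self hs), div_eq_mul_inv]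

/-- Critical values of `length + momentum * (x π - angle)` are, up to a factor, lengths of periodic
broken rays. -/
lemma mem_lsp_of_isLocalExtr {R : ℝ} {c ρ ρ' σ Q : ℝ → ℝ} (P : Profile R c ρ ρ' σ Q)
    (hc0 : R = 0 → derivWithin c (Icc R 1) 0 = 0) {n : ℕ} (hn : 2 ≤ n) {p : ℝ} (h1 : ρ R < p)
    (h2 : p < ρ 1) {x : ℚ}
    (h : IsLocalExtr (fun p => intercept ρ R p + p * (x * Real.pi)) p) :
    x.den * (2 * (intercept ρ R p + p * (x * Real.pi))) ∈ lsp n R c := by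
  have hp : 0 < p := P.ρ_R_nonneg.trans_lt h1
  have hd := (P.hasDerivAt_intercept hp).add ((hasDerivAt_id p).mul_const (x * Real.pi))
  have h0 : halfAngle ρ R p = x * Real.pi := by
    have := h.hasDerivAt_eq_zero hd
    linarith
  obtain ⟨τ, z, r, θ, C⟩ := exists_chord P h1 h2
  have hx : (x.den : ℝ) * x = x.num := by
    have hden : (x.den : ℝ) ≠ 0 := Nat.cast_ne_zero.2 x.den_nz
    rw [Rat.cast_def]
    field_simp
  have hm := C.mem_lsp P hc0 hn (K := x.den) (M := x.num) x.pos (by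
    rw [h0, ← hx]
    ring)
  rwa [P.halfLength_eq hp, h0] at hm

section

variable {ε R : ℝ} {c : ℝ → ℝ → ℝ} {n : ℕ} {S : Set ℝ}

/-- The variation of the slowness vanishes if all lengths stay in a fixed null set. -/
theorem IsAdmissibleFamily.hasDerivAt_inv (hA : IsAdmissibleFamily ε R c) (hR : 0 ≤ R)
    (hR1 : R < 1) (hn : 2 ≤ n)
    (hc0 : R = 0 → ∀ τ ∈ Ioo (-ε) ε, derivWithin (c τ) (Icc R 1) 0 = 0)
    (hS : volume S = 0) (hlsp : ∀ τ ∈ Ioo (-ε) ε, lsp n R (c τ) ⊆ S) {τ₀ : ℝ}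
    (hτ₀ : τ₀ ∈ Ioo (-ε) ε) {s : ℝ} (hs : s ∈ Ioo R 1) :
    HasDerivAt (fun τ => (c τ s)⁻¹) 0 τ₀ := by
  have hw : ContDiffOn ℝ 1 (fun q : ℝ × ℝ => (c q.1 q.2)⁻¹) (Ioo (-ε) ε ×ˢ Icc R 1) :=
    hA.contDiffOn.inv fun q hq => ((hA.soundSpeed q.1 hq.1).pos q.2 hq.2).ne'
  obtain ⟨w', η, C, A, hη, hηU, hC, hw'c, hder, hlip, hbd⟩ :=
    exists_deriv_of_contDiffOn (w := fun τ s => (c τ s)⁻¹) hR1 hw hτ₀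
  have hwc : ContinuousOn (fun q : ℝ × ℝ => (c q.1 q.2)⁻¹) (Metric.ball τ₀ η ×ˢ Icc R 1) :=
    hw.continuousOn.mono (prod_mono_left hηU)
  have hc0' : ∀ τ ∈ Ioo (-ε) ε, R = 0 → derivWithin (c τ) (Icc R 1) 0 = 0 := fun τ hτ h => hc0 h τ hτ
  obtain ⟨ρ, ρ', σ, Q, P⟩ := exists_profile hR hR1 (hA.soundSpeed τ₀ hτ₀) (hA.herglotz τ₀ hτ₀)
  have hcc : ContinuousOn (c τ₀) (Icc R 1) := fun s hs => (P.c_deriv s hs).continuousWithinAt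
  have key : ∀ p₁ p₂, ρ R ≤ p₁ → p₁ < p₂ → p₂ ≤ ρ 1 → ∃ p ∈ Ioo p₁ p₂,
      ∫ x in (0 : ℝ)..√(ρ 1 ^ 2 - p ^ 2), (w' (σ √(p ^ 2 + x ^ 2)) * c τ₀ (σ √(p ^ 2 + x ^ 2)))
        * Q √(p ^ 2 + x ^ 2) = 0 := by
    intro a b ha hab hb
    obtain ⟨p₁, hp₁, p₂, hp₂, hp, hne⟩ := P.exists_halfAngle_ne (hc0' τ₀ hτ₀)
      (hA.countableConjugacy τ₀ hτ₀) ha hab hb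
    have h0p₁ : 0 < p₁ := P.ρ_R_nonneg.trans_lt (ha.trans_lt hp₁.1)
    obtain ⟨e, he, x, hx₁, hx₂⟩ : ∃ e : ℝ, (e = 1 ∨ e = -1) ∧ ∃ x : ℚ,
        0 < e * (x * Real.pi - halfAngle ρ R p₁) ∧ e * (x * Real.pi - halfAngle ρ R p₂) < 0 := by
      have hpi := Real.pi_pos
      rcases lt_or_gt_of_ne hne with h | h
      · obtain ⟨x, h1, h2⟩ := exists_rat_btwn (div_lt_div_of_pos_right h hpi)
        rw [div_lt_iff₀ hpi] at h1
        rw [lt_div_iff₀ hpi] at h2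
        exact ⟨1, Or.inl rfl, x, by linarith, by linarith⟩
      · obtain ⟨x, h1, h2⟩ := exists_rat_btwn (div_lt_div_of_pos_right h hpi)
        rw [div_lt_iff₀ hpi] at h1
        rw [lt_div_iff₀ hpi] at h2
        exact ⟨-1, Or.inr rfl, x, by linarith, by linarith⟩
    have he0 : e ≠ 0 := by rcases he with rfl | rfl <;> norm_num
    have hee : e * e = 1 := by rcases he with rfl | rfl <;> norm_num
    have hK : (0 : ℝ) < x.den * 2 := by
      have : (0 : ℝ) < x.den := Nat.cast_pos.2 x.pos
      positivity
    let I : ℝ → ℝ → ℝ := fun τ p => intercept (fun s => s * (c τ s)⁻¹) R p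
    have hIτ₀ : I τ₀ = intercept ρ R := P.intercept_eq
    obtain ⟨δ, hδ, hδη, hin⟩ : ∃ δ > 0, Metric.ball τ₀ δ ⊆ Metric.ball τ₀ η ∧
        ∀ τ ∈ Metric.ball τ₀ δ, R * (c τ R)⁻¹ < p₁ ∧ p₂ < 1 * (c τ 1)⁻¹ := by
      have e1 : R * (c τ₀ R)⁻¹ < p₁ := by
        rw [← div_eq_mul_inv, ← P.ρ_eq R P.mem_R]; exact ha.trans_lt hp₁.1
      have e2 : p₂ < 1 * (c τ₀ 1)⁻¹ := by
        rw [← div_eq_mul_inv, ← P.ρ_eq 1 P.mem_one]; exact hp₂.2.trans_le hb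
      have hev := (((hder R P.mem_R).continuousAt.const_mul R).eventually_lt
        (continuousAt_const (y := p₁)) e1).and ((continuousAt_const (y := p₂)).eventually_lt
          ((hder 1 P.mem_one).continuousAt.const_mul 1) e2)
      obtain ⟨δ, hδ, h⟩ := Metric.eventually_nhds_iff_ball.1 hev
      exact ⟨min δ η, lt_min hδ hη, Metric.ball_subset_ball (min_le_right _ _),
        fun τ hτ => h τ (Metric.ball_subset_ball (min_le_left _ _) hτ)⟩
    have hId : ∀ p, 0 < p → HasDerivAt (fun p => e * (I τ₀ p + p * (x * Real.pi)))
        (e * (x * Real.pi - halfAngle ρ R p)) p := fun p h0 => by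
      rw [hIτ₀]
      have := ((P.hasDerivAt_intercept h0).add
        ((hasDerivAt_id p).mul_const (x * Real.pi))).const_mul e
      convert! this using 1
      ring
    have hmax := exists_isLocalMax_param
      (F := fun τ p => e * (I τ p + p * (x * Real.pi)))
      (S := (fun y => (x.den * 2 * e) * y) ⁻¹' S) hδ hp ?_ (hId p₁ h0p₁) hx₁
      (hId p₂ (h0p₁.trans hp)) hx₂ ?_ ?_
    · obtain ⟨p, hpI, hpmax⟩ := hmax
      have h0p : 0 < p := h0p₁.trans hpI.1
      have hρR : ρ R < p := (ha.trans_lt hp₁.1).trans hpI.1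
      have hρ1 : p < ρ 1 := (hpI.2.trans hp₂.2).trans_le hb
      refine ⟨p, ⟨hp₁.1.trans hpI.1, hpI.2.trans hp₂.2⟩, ?_⟩
      obtain ⟨t, z, r, θ, Ch⟩ := exists_chord P hρR hρ1
      have hsub : Icc (σ p) 1 ⊆ Icc R 1 := Icc_subset_Icc_left (Ch.R_lt_σp P).le
      rw [← Ch.setIntegral_radius P (f := fun s => w' s * c τ₀ s)
        ((hw'c.mul hcc).mono hsub) (hc0' τ₀ hτ₀)]
      have hd := hasDerivAt_intercept_param P hη hC h0p (fun _ _ => rfl) hwc hw'c hder hlip hbd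
      have := hpmax.hasDerivAt_eq_zero ((hd.add_const (p * (x * Real.pi))).const_mul e)
      exact (mul_eq_zero.1 this).resolve_left he0
    · have h1 := (continuousOn_intercept hR hwc hbd).mono
        (prod_mono hδη (subset_univ (Icc p₁ p₂)))
      exact continuousOn_const.mul (h1.add (by fun_prop))
    · rw [Real.volume_preimage_mul_left (mul_ne_zero hK.ne' he0), hS, mul_zero]
    · intro τ hτ q hq hqmax
      have hτU := hηU (hδη hτ)
      obtain ⟨ρτ, ρτ', στ, Qτ, Pτ⟩ :=
        exists_profile hR hR1 (hA.soundSpeed τ hτU) (hA.herglotz τ hτU)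
      have hIτ : I τ = intercept ρτ R := Pτ.intercept_eq
      have hρR : ρτ R < q := by
        rw [Pτ.ρ_eq R Pτ.mem_R, div_eq_mul_inv]; exact (hin τ hτ).1.trans hq.1
      have hρ1 : q < ρτ 1 := by
        rw [Pτ.ρ_eq 1 Pτ.mem_one, div_eq_mul_inv]; exact hq.2.trans (hin τ hτ).2
      simp only [hIτ] at hqmax
      have hext : IsLocalExtr (fun p => intercept ρτ R p + p * (x * Real.pi)) q := by
        rcases he with rfl | rfl
        · exact Or.inr (show IsLocalMax _ _ by simpa only [one_mul] using hqmax)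
        · exact Or.inl (show IsLocalMin _ _ by simpa only [neg_one_mul, neg_neg] using hqmax.neg)
      have hm := mem_lsp_of_isLocalExtr Pτ (hc0' τ hτU) hn hρR hρ1 hext
      simp only [mem_preimage, hIτ]
      convert! hlsp τ hτU hm using 1
      linear_combination (x.den * 2 * (intercept ρτ R q + q * (x * Real.pi))) * hee
  have hk : ContinuousOn (fun u => w' (σ u) * c τ₀ (σ u) * Q u) (Icc (ρ R) (ρ 1)) := by
    have hσ : MapsTo σ (Icc (ρ R) (ρ 1)) (Icc R 1) := fun u hu =>
      ⟨by rw [← P.ρ_le, P.ρ_σ]; exact hu.1, by rw [← P.ρ_le, P.ρ_σ]; exact hu.2⟩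
    exact ((hw'c.comp P.σ_cont.continuousOn hσ).mul (hcc.comp P.σ_cont.continuousOn hσ)).mul
      P.Q_cont.continuousOn
  have h0 := eq_zero_of_abel P.ρ_R_nonneg (P.ρ_lt.2 hR1) hk key (ρ s)
    ⟨P.ρ_lt.2 hs.1, P.ρ_lt.2 hs.2⟩
  have hsI := Ioo_subset_Icc_self hs
  simp only [P.σ_ρ] at h0
  have hw0 : w' s = 0 := by
    rw [mul_assoc, mul_eq_zero] at h0
    exact h0.resolve_right (mul_pos (P.c_pos s hsI) (P.Q_pos _)).ne'
  rw [← hw0]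
  exact hder s hsI

/-- A family of sound speeds all of whose lengths stay in a fixed null set is constant. -/
theorem IsAdmissibleFamily.eq (hA : IsAdmissibleFamily ε R c) (hR : 0 ≤ R)
    (hR1 : R < 1) (hn : 2 ≤ n)
    (hc0 : R = 0 → ∀ τ ∈ Ioo (-ε) ε, derivWithin (c τ) (Icc R 1) 0 = 0)
    (hS : volume S = 0) (hlsp : ∀ τ ∈ Ioo (-ε) ε, lsp n R (c τ) ⊆ S) {τ σ : ℝ}
    (hτ : τ ∈ Ioo (-ε) ε) (hσ : σ ∈ Ioo (-ε) ε) {r : ℝ} (hr : r ∈ Icc R 1) :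
    c τ r = c σ r := by
  have hopen : EqOn (c τ) (c σ) (Ioo R 1) := fun s hs => by
    have h : ∀ x ∈ Ioo (-ε) ε, HasDerivAt (fun τ => (c τ s)⁻¹) 0 x := fun x hx =>
      hA.hasDerivAt_inv hR hR1 hn hc0 hS hlsp hx hs
    have h1 := (convex_Ioo (-ε) ε).norm_image_sub_le_of_norm_hasDerivWithin_le (C := 0)
      (fun x hx => (h x hx).hasDerivWithinAt) (fun x _ => by simp) hσ hτ
    rw [zero_mul, norm_le_zero_iff, sub_eq_zero] at h1
    exact inv_injective h1
  have hc : ∀ τ ∈ Ioo (-ε) ε, ContinuousOn (c τ) (Icc R 1) := fun τ hτ =>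
    (hA.soundSpeed τ hτ).differentiableOn.continuousOn
  refine hopen.of_subset_closure (hc τ hτ) (hc σ hσ) Ioo_subset_Icc_self ?_ hr
  rw [closure_Ioo hR1.ne]

/-- The length spectrum with reflections on part of the boundary spheres has measure zero. -/
lemma IsAdmissibleFamily.volume_brokenRayLengths (hA : IsAdmissibleFamily ε R c) (hR : 0 ≤ R)
    (hR1 : R < 1) (hc0 : R = 0 → ∀ τ ∈ Ioo (-ε) ε, derivWithin (c τ) (Icc R 1) 0 = 0) {τ : ℝ}
    (hτ : τ ∈ Ioo (-ε) ε) {B : Set (EuclideanSpace ℝ (Fin n))}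
    (hB : ∀ x ∈ B, ‖x‖ = 1 ∨ (0 < R ∧ ‖x‖ = R)) : volume (brokenRayLengths R (c τ) B) = 0 := by
  obtain ⟨ρ, ρ', σ, Q, P⟩ := exists_profile hR hR1 (hA.soundSpeed τ hτ) (hA.herglotz τ hτ)
  exact RadialRigidity.volume_brokenRayLengths P (fun h => hc0 h τ hτ) hB

end

end RadialRigidity

theorem mainTheorem2 (N N' : ℕ) (hN : 1 ≤ N + N')
    (R : Fin N → ℝ) (hR : ∀ i, R i ∈ Set.Ico (0 : ℝ) 1)
    (R' : Fin N' → ℝ) (hR' : ∀ i, R' i ∈ Set.Ioo (0 : ℝ) 1)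
    (n : Fin N → ℕ) (hn : ∀ i, 2 ≤ n i)
    (n' : Fin N' → ℕ) (hn' : ∀ i, 2 ≤ n' i)
    (ε : ℝ) (hε : 0 < ε)
    (c : Fin N → ℝ → ℝ → ℝ) (c' : Fin N' → ℝ → ℝ → ℝ)
    (hc : ∀ i, RadialRigidity.IsAdmissibleFamily ε (R i) (c i))
    (hc' : ∀ i, RadialRigidity.IsAdmissibleFamily ε (R' i) (c' i))
    (hc0 : ∀ i, R i = 0 → ∀ τ ∈ Set.Ioo (-ε) ε, derivWithin (c i τ) (Set.Icc (R i) 1) 0 = 0)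
    (hlsp : ∀ τ ∈ Set.Ioo (-ε) ε, ∀ σ ∈ Set.Ioo (-ε) ε,
      (⋃ i, RadialRigidity.lsp (n i) (R i) (c i τ)) ∪
          (⋃ i, RadialRigidity.lsp' (n' i) (R' i) (c' i τ)) =
        (⋃ i, RadialRigidity.lsp (n i) (R i) (c i σ)) ∪
          (⋃ i, RadialRigidity.lsp' (n' i) (R' i) (c' i σ))) :
    (∀ i, ∀ τ ∈ Set.Ioo (-ε) ε, ∀ σ ∈ Set.Ioo (-ε) ε, ∀ r ∈ Set.Icc (R i) 1,
        c i τ r = c i σ r) ∧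
      (∀ i, ∀ τ ∈ Set.Ioo (-ε) ε, ∀ σ ∈ Set.Ioo (-ε) ε, ∀ r ∈ Set.Icc (R' i) 1,
        c' i τ r = c' i σ r) := by
  have h0 : (0 : ℝ) ∈ Ioo (-ε) ε := ⟨by linarith, hε⟩
  have hc0' : ∀ i, R' i = 0 → ∀ τ ∈ Ioo (-ε) ε, derivWithin (c' i τ) (Icc (R' i) 1) 0 = 0 :=
    fun i h => absurd h (hR' i).1.ne'
  have hS : volume ((⋃ i, RadialRigidity.lsp (n i) (R i) (c i 0)) ∪
      (⋃ i, RadialRigidity.lsp' (n' i) (R' i) (c' i 0))) = 0 := by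
    refine measure_union_null (measure_iUnion_null fun i => ?_) (measure_iUnion_null fun i => ?_)
    · exact (hc i).volume_brokenRayLengths (hR i).1 (hR i).2 (hc0 i) h0
        (RadialRigidity.outerBoundary_norm (n i) (R i))
    · refine (hc' i).volume_brokenRayLengths (hR' i).1.le (hR' i).2 (hc0' i) h0 fun x hx => ?_
      rcases hx with hx | hx
      · exact RadialRigidity.outerBoundary_norm (n' i) (R' i) x hx
      · exact Or.inr ⟨(hR' i).1, mem_sphere_zero_iff_norm.1 hx⟩
  refine ⟨fun i τ hτ σ hσ r hr => ?_, fun i τ hτ σ hσ r hr => ?_⟩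
  · refine (hc i).eq (hR i).1 (hR i).2 (hn i) (hc0 i) hS (fun τ hτ => ?_) hτ hσ hr
    rw [← hlsp τ hτ 0 h0]
    exact (subset_iUnion (fun i => RadialRigidity.lsp (n i) (R i) (c i τ)) i).trans
      subset_union_left
  · refine (hc' i).eq (hR' i).1.le (hR' i).2 (hn' i) (hc0' i) hS (fun τ hτ => ?_) hτ hσ hr
    rw [← hlsp τ hτ 0 h0]
    exact ((RadialRigidity.lsp_subset_lsp' (n' i) (R' i) (c' i τ)).trans
      (subset_iUnion (fun i => RadialRigidity.lsp' (n' i) (R' i) (c' i τ)) i)).trans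
      subset_union_right
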